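/- Let $(I,\cdot)$ be an anisotropic super Cartan datum: a finite set $I$ with a symmetric $\mathbb Z$-bilinear form on $\mathbb Z[I]$ and a parity $p:I\to\{0,1\}$ such that $d_i=\tfrac{i\cdot i}{2}\in\mathbb Z_{>0}$, $a_{ij}=\tfrac{2\,i\cdot j}{i\cdot i}\in\mathbb Z_{\le 0}$ for $i\ne j$, and $a_{ij}\in 2\mathbb Z$ if $p(i)=1$. Assume that it is bar-consistent ($d_i\equiv p(i)\bmod 2$) and that $p(i)=1$ for some $i$. Let $(Y,X,\langle\cdot,\cdot\rangle)$ be an associated root datum: finitely generated free abelian groups with a perfect pairing $Y\times X\to\mathbb Z$ and embeddings $I\to Y$, $i\mapsto i$, and $I\to X$, $i\mapsto i'$, with $\langle i,j'\rangle=a_{ij}$; assume that the image of $I$ in $Y$ is linearly independent. Let $\mathbb Q(v)^\pi=\mathbb Q(v)[\pi]/(\pi^2-1)$, $v_i=v^{d_i}$, $\pi_i=\pi^{d_i}$, $b_{ij}=1-a_{ij}$, and $$\begin{bmatrix}n\\k\end{bmatrix}_{v_i,\pi_i}=\frac{\prod_{l=n-k+1}^n((\pi_iv_i)^l-v_i^{-l})}{\prod_{m=1}^k((\pi_iv_i)^m-v_i^{-m})}.$$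 Let $\mathbf f$ be the $\mathbb Q(v)^\pi$-algebra on generators $\theta_i$ $(i\in I)$ with the Serre relations $$\sum_{k=0}^{b_{ij}}(-1)^k\pi^{\binom k2p(i)+kp(i)p(j)}\begin{bmatrix}b_{ij}\\k\end{bmatrix}_{v_i,\pi_i}\theta_i^{b_{ij}-k}\theta_j\theta_i^k=0\qquad(i\neq j).$$ Let ${}'\mathbf f$ be the free algebra on the $\theta_i$, graded by $|\theta_i|=i$ (with parity $p(|x|)$), and let $r:{}'\mathbf f\to{}'\mathbf f\otimes{}'\mathbf f$ be the algebra homomorphism with $r(\theta_i)=\theta_i\otimes1+1\otimes\theta_i$, where the tensor square has the product $(x_1\otimes x_2)(y_1\otimes y_2)=\pi^{p(x_2)p(y_1)}v^{-|x_2|\cdot|y_1|}x_1y_1\otimes x_2y_2$. The standard form on $\mathbf f$ is the bilinear form $(\cdot,\cdot):\mathbf f\times\mathbf f\to\mathbb Q(v)^\pi$ with $(1,1)=1$, $(\theta_i,\theta_j)=\delta_{ij}(1-\pi_iv_i^2)^{-1}$, $(x,yz)=(r(x),y\otimes z)$ and $(xy,z)=(x\otimes y,r(z))$, where $(x\otimes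 y,x'\otimes y')=(x,x')(y,y')$ and $r(\cdot)$ is computed on any lift to ${}'\mathbf f$ and then mapped to $\mathbf f\otimes\mathbf f$. Let $\mathbf U$ be the $\mathbb Q(v)^\pi$-algebra with generators $E_i,F_i,K_\mu,J_\mu$ $(i\in I,\mu\in Y)$ and relations $J_\mu J_\nu=J_{\mu+\nu}$, $K_\mu K_\nu=K_{\mu+\nu}$, $K_0=J_0=J_\nu^2=1$, $J_\mu K_\nu=K_\nu J_\mu$; $J_\mu E_i=\pi^{\langle\mu,i'\rangle}E_iJ_\mu$, $J_\mu F_i=\pi^{-\langle\mu,i'\rangle}F_iJ_\mu$, $K_\mu E_i=v^{\langle\mu,i'\rangle}E_iK_\mu$, $K_\mu F_i=v^{-\langle\mu,i'\rangle}F_iK_\mu$; $$E_iF_j-\pi^{p(i)p(j)}F_jE_i=\delta_{ij}\frac{J_{d_ii}K_{d_ii}-K_{-d_ii}}{\pi_iv_i-v_i^{-1}};$$ and the Serre relations above for the $E_i$ and for the $F_i$ in place of the $\theta_i$. It is graded by $|E_i|=i$, $|F_i|=-i$, $|K_\mu|=|J_\mu|=0$. Let $x\mapsto x^-$ be the homomorphism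 $\mathbf f\to\mathbf U$, $\theta_i\mapsto F_i$, and let $\tau_1$ be the $\mathbb Q(v)^\pi$-linear anti-automorphism of $\mathbf U$ with $\tau_1(E_i)=v_i^{-1}K_{-d_ii}F_i$, $\tau_1(F_i)=v_i^{-1}K_{d_ii}E_i$, $\tau_1(K_\mu)=K_\mu$, $\tau_1(J_\mu)=J_\mu$. Let $\dot{\mathbf U}=\bigoplus_{\lambda\in X}\mathbf U1_\lambda$ be the modified form, where $\mathbf U1_\lambda$ is the quotient of $\mathbf U$ by the left ideal generated by all $K_\nu-v^{\langle\nu,\lambda\rangle}$ and $J_\nu-\pi^{\langle\nu,\lambda\rangle}$ $(\nu\in Y)$, $x1_\lambda$ is the class of $x$, $\mathbf U$ acts by $u(x1_\lambda)=(ux)1_\lambda$, and the (non-unital, associative) product is $(x1_\lambda)(y1_\eta)=(xy)1_\eta$ if $\lambda=\eta+|y|'$ and $0$ otherwise, for homogeneous $y$ (here $\nu\mapsto\nu'$ is the linear extension of $i\mapsto i'$). Theorem. The standard form on $\mathbf f$ exists and is unique, and there is a unique $\mathbb Q(v)^\pi$-bilinear pairing $(\cdot,\cdot):\dot{\mathbf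 U}\times\dot{\mathbf U}\to\mathbb Q(v)^\pi$ such that 1. $(1_{\lambda_1}x1_{\lambda_2},1_{\lambda_1'}x'1_{\lambda_2'})=0$ unless $\lambda_1=\lambda_1'$ and $\lambda_2=\lambda_2'$, for all $x,x'\in\dot{\mathbf U}$; 2. $(ux,y)=(x,\tau_1(u)y)$ for all $x,y\in\dot{\mathbf U}$ and $u\in\mathbf U$; 3. $(x^-1_\lambda,x'^-1_\lambda)=(x,x')$ for all $x,x'\in\mathbf f$ and all $\lambda\in X$, where the right-hand side is the standard form on $\mathbf f$; 4. $(x,y)=(y,x)$ for all $x,y\in\dot{\mathbf U}$. -/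

import Mathlib

open scoped Polynomial TensorProduct

set_option linter.unusedSimpArgs false

namespace QCov

noncomputable section

/-- The ring `ℚ(v)^π = ℚ(v)[π]/(π² - 1)`. -/
def Qvpi : Type := AdjoinRoot (Polynomial.X ^ 2 - 1 : (RatFunc ℚ)[X])

instance : CommRing Qvpi := inferInstanceAs (CommRing (AdjoinRoot (Polynomial.X ^ 2 - 1 : (RatFunc ℚ)[X])))

instance : Algebra (RatFunc ℚ) Qvpi :=
  inferInstanceAs (Algebra (RatFunc ℚ) (AdjoinRoot (Polynomial.X ^ 2 - 1 : (RatFunc ℚ)[X])))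

/-- The class of `π`. -/
def piElt : Qvpi := AdjoinRoot.root (Polynomial.X ^ 2 - 1 : (RatFunc ℚ)[X])

theorem piElt_mul_self : piElt * piElt = 1 := by
  have h : AdjoinRoot.mk (Polynomial.X ^ 2 - 1 : (RatFunc ℚ)[X])
      (Polynomial.X ^ 2 - 1) = 0 := AdjoinRoot.mk_self
  rw [map_sub, map_pow, AdjoinRoot.mk_X, map_one, sub_eq_zero] at h
  exact (pow_two _).symm.trans h

/-- `π` as a unit. -/
def piU : Qvpiˣ := ⟨piElt, piElt, piElt_mul_self, piElt_mul_self⟩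

/-- `v` as a unit. -/
def vU : Qvpiˣ :=
  Units.map (algebraMap (RatFunc ℚ) Qvpi).toMonoidHom (Units.mk0 RatFunc.X RatFunc.X_ne_zero)

theorem piU_mul_self : piU * piU = 1 := Units.ext piElt_mul_self

theorem piU_pow_congr {m n : ℕ} (h : m % 2 = n % 2) : piU ^ m = piU ^ n := by
  rw [← Nat.div_add_mod m 2, ← Nat.div_add_mod n 2, h, pow_add, pow_add, pow_mul, pow_mul,
    pow_two, piU_mul_self, one_pow, one_pow]

theorem ratFunc_X_zpow_ne_one {n : ℤ} (hn : n ≠ 0) (c : ℚ) :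
    (RatFunc.X : RatFunc ℚ) ^ n ≠ RatFunc.C c := by
  intro h
  have h2 := congrArg RatFunc.intDegree h
  rw [RatFunc.intDegree_C] at h2
  have key : ∀ m : ℕ, RatFunc.intDegree ((RatFunc.X : RatFunc ℚ) ^ m) = m := by
    intro m
    rw [← RatFunc.algebraMap_X, ← map_pow, RatFunc.intDegree_polynomial]
    simp
  obtain ⟨m, rfl | rfl⟩ := n.eq_nat_or_neg
  · rw [zpow_natCast, key] at h2; exact hn (by exact_mod_cast h2)
  · rw [zpow_neg, zpow_natCast, RatFunc.intDegree_inv, key] at h2; exact hn h2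

/-- The denominators `(π^a v^b) - v^{-b}`, `b ≠ 0`, which occur below are invertible in `ℚ(v)^π`,
so that the uses of `Ring.inverse` below are genuine inverses. -/
theorem isUnit_qden (a : ℤ) {b : ℤ} (hb : b ≠ 0) :
    IsUnit (((piU ^ a * vU ^ b : Qvpiˣ) : Qvpi) - ((vU ^ (-b) : Qvpiˣ) : Qvpi)) := by
  have hsq : ((piU ^ a : Qvpiˣ) : Qvpi) ^ 2 = 1 := by
    rw [← Units.val_pow_eq_pow_val, ← zpow_natCast, ← zpow_mul, mul_comm, zpow_mul, zpow_natCast,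
      pow_two, piU_mul_self, one_zpow, Units.val_one]
  have hu : IsUnit (((vU ^ (2 * b) : Qvpiˣ) : Qvpi) - ((vU ^ (-(2 * b)) : Qvpiˣ) : Qvpi)) := by
    have hv : ∀ n : ℤ, ((vU ^ n : Qvpiˣ) : Qvpi) =
        algebraMap (RatFunc ℚ) Qvpi (RatFunc.X ^ n) := by
      intro n
      rw [vU, ← map_zpow, Units.coe_map]
      simp
    rw [hv, hv, ← map_sub]
    apply IsUnit.map
    rw [isUnit_iff_ne_zero, sub_ne_zero, zpow_neg]
    intro h
    have h0 : (RatFunc.X : RatFunc ℚ) ^ (2 * b) ≠ 0 := zpow_ne_zero _ RatFunc.X_ne_zero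
    replace h := mul_eq_one_iff_eq_inv₀ h0 |>.2 h
    rw [ ← zpow_add₀ RatFunc.X_ne_zero] at h
    exact ratFunc_X_zpow_ne_one (n := 2 * b + 2 * b) (by omega) 1 (by simpa using h)
  have hfac : (((piU ^ a * vU ^ b : Qvpiˣ) : Qvpi) - ((vU ^ (-b) : Qvpiˣ) : Qvpi)) *
      (((piU ^ a * vU ^ b : Qvpiˣ) : Qvpi) + ((vU ^ (-b) : Qvpiˣ) : Qvpi)) =
      ((vU ^ (2 * b) : Qvpiˣ) : Qvpi) - ((vU ^ (-(2 * b)) : Qvpiˣ) : Qvpi) := by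
    have e1 : ((vU ^ (2 * b) : Qvpiˣ) : Qvpi) = ((vU ^ b : Qvpiˣ) : Qvpi) ^ 2 := by
      rw [two_mul, zpow_add, Units.val_mul, pow_two]
    have e2 : ((vU ^ (-(2 * b)) : Qvpiˣ) : Qvpi) = ((vU ^ (-b) : Qvpiˣ) : Qvpi) ^ 2 := by
      rw [two_mul, neg_add, zpow_add, Units.val_mul, pow_two]
    rw [e1, e2, Units.val_mul]
    linear_combination ((vU ^ b : Qvpiˣ) : Qvpi) ^ 2 * hsq
  rw [← hfac] at hu
  exact isUnit_of_mul_isUnit_left hu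

/-- A bar-consistent anisotropic super Cartan datum with at least one odd index. The symmetric
bilinear form on `ℤ[I]` is given by its values `dot i j = i · j` on the basis `I`; `d i = (i · i)/2`,
`a i j = 2 (i · j)/(i · i)`, and `p i ∈ {0, 1}` is the parity of `i`. -/
structure CartanDatum (I : Type*) where
  dot : I → I → ℤ
  dot_symm : ∀ i j, dot i j = dot j i
  d : I → ℕ
  d_pos : ∀ i, 0 < d i
  dot_self : ∀ i, dot i i = 2 * (d i : ℤ)
  a : I → I → ℤ
  d_mul_a : ∀ i j, (d i : ℤ) * a i j = dot i j
  a_nonpos : ∀ i j, i ≠ j → a i j ≤ 0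
  p : I → ℕ
  p_lt_two : ∀ i, p i < 2
  a_even_of_odd : ∀ i j, p i = 1 → Even (a i j)
  bar_consistent : ∀ i, d i % 2 = p i % 2
  exists_odd : ∃ i, p i = 1

/-- A root datum `(Y, X, ⟨·,·⟩)` associated to a Cartan datum, with the embeddings
`I → Y`, `i ↦ i` (`coroot`) and `I → X`, `i ↦ i'` (`root`). -/
structure RootDatum {I : Type*} (C : CartanDatum I) (Y X : Type*)
    [AddCommGroup Y] [AddCommGroup X] where
  pairing : Y →ₗ[ℤ] X →ₗ[ℤ] ℤ
  perfect : pairing.IsPerfPair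
  coroot : I → Y
  coroot_injective : Function.Injective coroot
  root : I → X
  root_injective : Function.Injective root
  pairing_coroot_root : ∀ i j, pairing (coroot i) (root j) = C.a i j

section Datum

variable {I : Type*} (C : CartanDatum I)

/-- `v_i = v^{d_i}`. -/
def vi (i : I) : Qvpiˣ := vU ^ C.d i

/-- `π_i = π^{d_i}`. -/
def pii (i : I) : Qvpiˣ := piU ^ C.d i

/-- `(π_i v_i)^n - v_i^{-n}`. -/
def qnum (i : I) (n : ℕ) : Qvpi :=
  (((pii C i * vi C i) ^ n : Qvpiˣ) : Qvpi) - (((vi C i)⁻¹ ^ n : Qvpiˣ) : Qvpi)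

/-- The binomial coefficient `[n choose k]` with parameters `v_i, π_i` (for `k ≤ n`). -/
def qbinom (i : I) (n k : ℕ) : Qvpi :=
  (∏ l ∈ Finset.Icc (n - k + 1) n, qnum C i l) *
    Ring.inverse (∏ m ∈ Finset.Icc 1 k, qnum C i m)

/-- `b_{ij} = 1 - a_{ij}` (a positive integer for `i ≠ j`). -/
def bexp (i j : I) : ℕ := (1 - C.a i j).toNat

/-- The coefficient of the `k`-th term of the Serre relation. -/
def serreCoeff (i j : I) (k : ℕ) : Qvpi :=
  (-1) ^ k * ((piU ^ (k.choose 2 * C.p i + k * C.p i * C.p j) : Qvpiˣ) : Qvpi) *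
    qbinom C i (bexp C i j) k

/-- The Serre expression in a family of elements `x i` of an algebra. -/
def serre {A : Type*} [Ring A] [Algebra Qvpi A] (x : I → A) (i j : I) : A :=
  ∑ k ∈ Finset.range (bexp C i j + 1),
    serreCoeff C i j k • (x i ^ (bexp C i j - k) * x j * x i ^ k)

theorem map_serre {A B : Type*} [Ring A] [Algebra Qvpi A] [Ring B] [Algebra Qvpi B]
    (φ : A →ₐ[Qvpi] B) (x : I → A) (i j : I) :
    φ (serre C x i j) = serre C (fun i => φ (x i)) i j := by
  simp [serre, map_sum, map_smul, map_mul, map_pow]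

theorem isUnit_qnum (i : I) {n : ℕ} (hn : 0 < n) : IsUnit (qnum C i n) := by
  have h := isUnit_qden (C.d i * n : ℤ) (b := C.d i * n)
    (by have := C.d_pos i; positivity)
  have e1 : piU ^ (C.d i * n : ℤ) * vU ^ (C.d i * n : ℤ) = (pii C i * vi C i) ^ n := by
    rw [pii, vi, mul_pow, ← pow_mul, ← pow_mul]
    norm_cast
  have e2 : vU ^ (-(C.d i * n : ℤ)) = (vi C i)⁻¹ ^ n := by
    rw [vi, inv_pow, ← pow_mul, zpow_neg]
    norm_cast
  rw [e1, e2] at h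
  exact h

theorem qbinom_mul (i : I) {n k : ℕ} (hk : k ≤ n) :
    qbinom C i n k * ((∏ m ∈ Finset.Icc 1 k, qnum C i m) *
      ∏ m ∈ Finset.Icc 1 (n - k), qnum C i m) = ∏ m ∈ Finset.Icc 1 n, qnum C i m := by
  have hu : IsUnit (∏ m ∈ Finset.Icc 1 k, qnum C i m) :=
    (Finset.prod_induction _ IsUnit (fun _ _ => IsUnit.mul) isUnit_one
      fun m hm => isUnit_qnum C i (Finset.mem_Icc.1 hm).1)
  have hs : (∏ m ∈ Finset.Icc 1 n, qnum C i m) = (∏ m ∈ Finset.Icc 1 (n - k), qnum C i m) *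
      ∏ m ∈ Finset.Icc (n - k + 1) n, qnum C i m := by
    have e : ∀ a b : ℕ, Finset.Icc a b = Finset.Ico a (b + 1) := fun a b => by
      ext; simp only [Finset.mem_Icc, Finset.mem_Ico]; omega
    rw [e, e, e, Finset.prod_Ico_consecutive _ (by omega) (by omega)]
  rw [hs, qbinom]
  calc _ = (Ring.inverse (∏ m ∈ Finset.Icc 1 k, qnum C i m) * ∏ m ∈ Finset.Icc 1 k, qnum C i m) *
        ((∏ m ∈ Finset.Icc 1 (n - k), qnum C i m) *
          ∏ m ∈ Finset.Icc (n - k + 1) n, qnum C i m) := by ring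
    _ = _ := by rw [Ring.inverse_mul_cancel _ hu, one_mul]

theorem qbinom_symm (i : I) {n k : ℕ} (hk : k ≤ n) : qbinom C i n (n - k) = qbinom C i n k := by
  have h1 := qbinom_mul C i hk
  have h2 := qbinom_mul C i (Nat.sub_le n k)
  rw [Nat.sub_sub_self hk, mul_comm (∏ m ∈ Finset.Icc 1 (n - k), qnum C i m)] at h2
  have hu : ∀ k, IsUnit (∏ m ∈ Finset.Icc 1 k, qnum C i m) := fun k =>
    (Finset.prod_induction _ IsUnit (fun _ _ => IsUnit.mul) isUnit_one
      fun m hm => isUnit_qnum C i (Finset.mem_Icc.1 hm).1)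
  exact ((hu k).mul (hu (n - k))).mul_right_cancel (h2.trans h1.symm)

theorem bexp_odd {i j : I} (hij : i ≠ j) (hp : C.p i = 1) : bexp C i j % 2 = 1 := by
  have h1 := C.a_nonpos i j hij
  obtain ⟨r, hr⟩ := C.a_even_of_odd i j hp
  rw [bexp]
  omega

theorem serreCoeff_symm {i j : I} (hij : i ≠ j) :
    ∃ c : Qvpiˣ, ∀ k, k ≤ bexp C i j →
      serreCoeff C i j (bexp C i j - k) = (c : Qvpi) * serreCoeff C i j k := by
  have hpar : C.p i = 0 ∨ (C.p i = 1 ∧ bexp C i j % 2 = 1) := by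
    have := C.p_lt_two i
    rcases Nat.eq_zero_or_pos (C.p i) with h | h
    · exact Or.inl h
    · have h1 : C.p i = 1 := by omega
      exact Or.inr ⟨h1, bexp_odd C hij h1⟩
  refine ⟨(-1) ^ bexp C i j *
    piU ^ ((bexp C i j).choose 2 * C.p i + bexp C i j * C.p i * C.p j), fun k hk => ?_⟩
  have hq := qbinom_symm C i hk
  unfold serreCoeff
  rw [hq]
  generalize bexp C i j = b at *
  obtain ⟨m, rfl⟩ : ∃ m, b = m + k := ⟨b - k, by omega⟩
  rw [Nat.add_sub_cancel]
  have hpi : piU ^ (m.choose 2 * C.p i + m * C.p i * C.p j) =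
      piU ^ ((m + k).choose 2 * C.p i + (m + k) * C.p i * C.p j) *
        piU ^ (k.choose 2 * C.p i + k * C.p i * C.p j) := by
    rw [← pow_add]
    apply piU_pow_congr
    rcases hpar with h | ⟨h, hodd⟩
    · simp [h]
    · have hmk : (m * k) % 2 = 0 := by
        rcases Nat.even_or_odd m with ⟨r, hr⟩ | ⟨r, hr⟩
        · rw [hr, ← two_mul, mul_assoc, Nat.mul_mod_right]
        · rcases Nat.even_or_odd k with ⟨t, ht⟩ | ⟨t, ht⟩
          · rw [ht, ← two_mul, Nat.mul_left_comm, Nat.mul_mod_right]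
          · omega
      have hch : (m + k).choose 2 = m.choose 2 + k.choose 2 + m * k := by
        rw [Nat.add_choose_eq]
        simp [Finset.Nat.antidiagonal_succ]
        ring
      rw [h, hch]
      ring_nf
      omega
  have hs : ((-1 : Qvpi)) ^ m = (-1) ^ (m + k) * (-1) ^ k := by
    rw [pow_add, mul_assoc, ← pow_add, ← two_mul, pow_mul]
    simp
  rw [hpi, hs]
  push_cast
  ring

/-! ### The half quantum covering group -/

/-- The Serre relations defining `𝐟`. -/
inductive FRel : FreeAlgebra Qvpi I → FreeAlgebra Qvpi I → Prop
  | serre (i j : I) (h : i ≠ j) : FRel (serre C (FreeAlgebra.ι Qvpi) i j) 0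

/-- The algebra `𝐟` on generators `θ_i` subject to the Serre relations. -/
def Half : Type _ := RingQuot (FRel C)

instance : Ring (Half C) := inferInstanceAs (Ring (RingQuot (FRel C)))

instance : Algebra Qvpi (Half C) := inferInstanceAs (Algebra Qvpi (RingQuot (FRel C)))

/-- The quotient map from the free algebra on the `θ_i` to `𝐟`. -/
def Half.mk : FreeAlgebra Qvpi I →ₐ[Qvpi] Half C := RingQuot.mkAlgHom Qvpi (FRel C)

/-- The generator `θ_i` of `𝐟`. -/
def Half.θ (i : I) : Half C := Half.mk C (FreeAlgebra.ι Qvpi i)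

theorem Half.serre_eq_zero {i j : I} (h : i ≠ j) : serre C (Half.θ C) i j = 0 := by
  have := RingQuot.mkAlgHom_rel Qvpi (FRel.serre (C := C) i j h)
  rw [map_zero] at this
  exact (map_serre C (Half.mk C) (FreeAlgebra.ι Qvpi) i j).symm.trans this

/-- An algebra homomorphism out of `𝐟`, given by the images of the generators. -/
def Half.lift {A : Type*} [Ring A] [Algebra Qvpi A] (x : I → A)
    (h : ∀ i j, i ≠ j → serre C x i j = 0) : Half C →ₐ[Qvpi] A :=
  RingQuot.liftAlgHom Qvpi ⟨FreeAlgebra.lift Qvpi x, by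
    rintro _ _ ⟨i, j, hij⟩
    rw [map_serre, map_zero]
    simpa using h i j hij⟩

theorem Half.lift_θ {A : Type*} [Ring A] [Algebra Qvpi A] (x : I → A)
    (h : ∀ i j, i ≠ j → serre C x i j = 0) (i : I) : Half.lift C x h (Half.θ C i) = x i := by
  refine (RingQuot.liftAlgHom_mkAlgHom_apply Qvpi _ _ _).trans ?_
  simp

/-- The automorphism `x ↦ π^{p(i) p(x)} v^{- i · |x|} x` (`x` homogeneous) of the free algebra. -/
def twist (i : I) : FreeAlgebra Qvpi I →ₐ[Qvpi] FreeAlgebra Qvpi I :=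
  FreeAlgebra.lift Qvpi fun j =>
    ((piU ^ (C.p i * C.p j) * vU ^ (-C.dot i j) : Qvpiˣ) : Qvpi) • FreeAlgebra.ι Qvpi j

/-- Left multiplication by `θ_i ⊗ 1 + 1 ⊗ θ_i` on the tensor square of the free algebra, with
respect to the twisted product
`(x₁ ⊗ x₂)(y₁ ⊗ y₂) = π^{p(x₂) p(y₁)} v^{- |x₂| · |y₁|} x₁ y₁ ⊗ x₂ y₂`. -/
def coprodGen (i : I) : Module.End Qvpi (FreeAlgebra Qvpi I ⊗[Qvpi] FreeAlgebra Qvpi I) :=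
  TensorProduct.map (LinearMap.mulLeft Qvpi (FreeAlgebra.ι Qvpi i)) LinearMap.id +
    TensorProduct.map (twist C i).toLinearMap (LinearMap.mulLeft Qvpi (FreeAlgebra.ι Qvpi i))

/-- The twisted coproduct `r` of the free algebra: the homomorphism to its tensor square with the
twisted product above such that `r(θ_i) = θ_i ⊗ 1 + 1 ⊗ θ_i`. -/
def coprod : FreeAlgebra Qvpi I →ₗ[Qvpi] FreeAlgebra Qvpi I ⊗[Qvpi] FreeAlgebra Qvpi I :=
  (LinearMap.applyₗ (1 ⊗ₜ 1)).comp (FreeAlgebra.lift Qvpi (coprodGen C)).toLinearMap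

/-- The coproduct of an element of the free algebra, with values in `𝐟 ⊗ 𝐟`. -/
def coprodHalf : FreeAlgebra Qvpi I →ₗ[Qvpi] Half C ⊗[Qvpi] Half C :=
  (TensorProduct.map (Half.mk C).toLinearMap (Half.mk C).toLinearMap).comp (coprod C)

/-- The properties which characterise the standard bilinear form on `𝐟`. The last two say
`(x, y z) = (r(x), y ⊗ z)` and `(x y, z) = (x ⊗ y, r(z))`, where
`(x ⊗ y, x' ⊗ y') = (x, x') (y, y')`. -/
structure IsStandardForm (B : Half C →ₗ[Qvpi] Half C →ₗ[Qvpi] Qvpi) : Prop where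
  one_one : B 1 1 = 1
  gen_self : ∀ i, B (Half.θ C i) (Half.θ C i) =
    Ring.inverse (1 - ((pii C i * vi C i ^ 2 : Qvpiˣ) : Qvpi))
  gen_ne : ∀ i j, i ≠ j → B (Half.θ C i) (Half.θ C j) = 0
  mul_right : ∀ (x : FreeAlgebra Qvpi I) (y z : Half C), B (Half.mk C x) (y * z) =
    LinearMap.mul' Qvpi Qvpi (TensorProduct.map (B.flip y) (B.flip z) (coprodHalf C x))
  mul_left : ∀ (x y : Half C) (z : FreeAlgebra Qvpi I), B (x * y) (Half.mk C z) =
    LinearMap.mul' Qvpi Qvpi (TensorProduct.map (B x) (B y) (coprodHalf C z))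

end Datum

/-! ### The quantum covering group -/

/-- The symbols `E_i, F_i, K_μ, J_μ`. -/
inductive UGen (I Y : Type*)
  | E (i : I)
  | F (i : I)
  | K (μ : Y)
  | J (μ : Y)

section Covering

variable {I Y X : Type*} [AddCommGroup Y] [AddCommGroup X] {C : CartanDatum I}
  (D : RootDatum C Y X)

/-- The defining relations of `𝐔`, for a family of elements of an algebra indexed by the symbols:
`Rel D g x y` says that `x = y` is one of the relations. -/
inductive Rel {A : Type*} [Ring A] [Algebra Qvpi A] (g : UGen I Y → A) : A → A → Prop
  | JJ (μ ν : Y) : Rel g (g (.J μ) * g (.J ν)) (g (.J (μ + ν)))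
  | KK (μ ν : Y) : Rel g (g (.K μ) * g (.K ν)) (g (.K (μ + ν)))
  | K_zero : Rel g (g (.K 0)) 1
  | J_zero : Rel g (g (.J 0)) 1
  | J_sq (ν : Y) : Rel g (g (.J ν) ^ 2) 1
  | JK (μ ν : Y) : Rel g (g (.J μ) * g (.K ν)) (g (.K ν) * g (.J μ))
  | JE (μ : Y) (i : I) : Rel g (g (.J μ) * g (.E i))
      (((piU ^ D.pairing μ (D.root i) : Qvpiˣ) : Qvpi) • (g (.E i) * g (.J μ)))
  | JF (μ : Y) (i : I) : Rel g (g (.J μ) * g (.F i))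
      (((piU ^ (-D.pairing μ (D.root i)) : Qvpiˣ) : Qvpi) • (g (.F i) * g (.J μ)))
  | KE (μ : Y) (i : I) : Rel g (g (.K μ) * g (.E i))
      (((vU ^ D.pairing μ (D.root i) : Qvpiˣ) : Qvpi) • (g (.E i) * g (.K μ)))
  | KF (μ : Y) (i : I) : Rel g (g (.K μ) * g (.F i))
      (((vU ^ (-D.pairing μ (D.root i)) : Qvpiˣ) : Qvpi) • (g (.F i) * g (.K μ)))
  | EF_self (i : I) : Rel g
      (g (.E i) * g (.F i) -
        ((piU ^ (C.p i * C.p i) : Qvpiˣ) : Qvpi) • (g (.F i) * g (.E i)))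
      (Ring.inverse (((pii C i * vi C i : Qvpiˣ) : Qvpi) - (((vi C i)⁻¹ : Qvpiˣ) : Qvpi)) •
        (g (.J (C.d i • D.coroot i)) * g (.K (C.d i • D.coroot i)) -
          g (.K (-(C.d i • D.coroot i)))))
  | EF_ne (i j : I) (h : i ≠ j) : Rel g
      (g (.E i) * g (.F j) -
        ((piU ^ (C.p i * C.p j) : Qvpiˣ) : Qvpi) • (g (.F j) * g (.E i))) 0
  | serreE (i j : I) (h : i ≠ j) : Rel g (serre C (fun i => g (.E i)) i j) 0
  | serreF (i j : I) (h : i ≠ j) : Rel g (serre C (fun i => g (.F i)) i j) 0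

theorem Rel.map {A B : Type*} [Ring A] [Algebra Qvpi A] [Ring B] [Algebra Qvpi B]
    (φ : A →ₐ[Qvpi] B) {g : UGen I Y → A} {x y : A} (h : Rel D g x y) :
    Rel D (fun s => φ (g s)) (φ x) (φ y) := by
  cases h <;> simp only [map_mul, map_smul, map_sub, map_one, map_zero, map_pow, map_serre] <;>
    constructor <;> assumption

/-- The quantum covering group `𝐔`. -/
def U : Type _ := RingQuot (Rel D (FreeAlgebra.ι Qvpi : UGen I Y → FreeAlgebra Qvpi (UGen I Y)))

instance : Ring (U D) := inferInstanceAs (Ring (RingQuot _))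

instance : Algebra Qvpi (U D) := inferInstanceAs (Algebra Qvpi (RingQuot _))

/-- The generators of `𝐔`. -/
def gen (s : UGen I Y) : U D := RingQuot.mkAlgHom Qvpi (Rel D _) (FreeAlgebra.ι Qvpi s)

theorem gen_rel {x y : U D} (h : Rel D (gen D) x y) : x = y := by
  have key : ∀ x y, Rel D (FreeAlgebra.ι Qvpi : UGen I Y → _) x y →
      (RingQuot.mkAlgHom Qvpi (Rel D _) x : U D) = RingQuot.mkAlgHom Qvpi (Rel D _) y :=
    fun x y h => RingQuot.mkAlgHom_rel Qvpi h
  suffices H : ∃ a b, Rel D (FreeAlgebra.ι Qvpi : UGen I Y → _) a b ∧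
      (RingQuot.mkAlgHom Qvpi (Rel D _) a : U D) = x ∧
      (RingQuot.mkAlgHom Qvpi (Rel D _) b : U D) = y by
    obtain ⟨a, b, hab, rfl, rfl⟩ := H
    exact key a b hab
  cases h
  case JJ μ ν =>
    refine ⟨_, _, .JJ μ ν, ?_, ?_⟩ <;>
      (try simp only [map_mul, map_smul, map_sub, map_one, map_zero, map_pow, map_serre]) <;> rfl
  case KK μ ν =>
    refine ⟨_, _, .KK μ ν, ?_, ?_⟩ <;>
      (try simp only [map_mul, map_smul, map_sub, map_one, map_zero, map_pow, map_serre]) <;> rfl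
  case K_zero =>
    refine ⟨_, _, .K_zero, ?_, ?_⟩ <;>
      (try simp only [map_mul, map_smul, map_sub, map_one, map_zero, map_pow, map_serre]) <;> rfl
  case J_zero =>
    refine ⟨_, _, .J_zero, ?_, ?_⟩ <;>
      (try simp only [map_mul, map_smul, map_sub, map_one, map_zero, map_pow, map_serre]) <;> rfl
  case J_sq ν =>
    refine ⟨_, _, .J_sq ν, ?_, ?_⟩ <;>
      (try simp only [map_mul, map_smul, map_sub, map_one, map_zero, map_pow, map_serre]) <;> rfl
  case JK μ ν =>
    refine ⟨_, _, .JK μ ν, ?_, ?_⟩ <;>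
      (try simp only [map_mul, map_smul, map_sub, map_one, map_zero, map_pow, map_serre]) <;> rfl
  case JE μ i =>
    refine ⟨_, _, .JE μ i, ?_, ?_⟩ <;>
      (try simp only [map_mul, map_smul, map_sub, map_one, map_zero, map_pow, map_serre]) <;> rfl
  case JF μ i =>
    refine ⟨_, _, .JF μ i, ?_, ?_⟩ <;>
      (try simp only [map_mul, map_smul, map_sub, map_one, map_zero, map_pow, map_serre]) <;> rfl
  case KE μ i =>
    refine ⟨_, _, .KE μ i, ?_, ?_⟩ <;>
      (try simp only [map_mul, map_smul, map_sub, map_one, map_zero, map_pow, map_serre]) <;> rfl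
  case KF μ i =>
    refine ⟨_, _, .KF μ i, ?_, ?_⟩ <;>
      (try simp only [map_mul, map_smul, map_sub, map_one, map_zero, map_pow, map_serre]) <;> rfl
  case EF_self i =>
    refine ⟨_, _, .EF_self i, ?_, ?_⟩ <;>
      (try simp only [map_mul, map_smul, map_sub, map_one, map_zero, map_pow, map_serre]) <;> rfl
  case EF_ne i j h =>
    refine ⟨_, _, .EF_ne i j ‹_›, ?_, ?_⟩ <;>
      (try simp only [map_mul, map_smul, map_sub, map_one, map_zero, map_pow, map_serre]) <;> rfl
  case serreE i j h =>
    refine ⟨_, _, .serreE i j ‹_›, ?_, ?_⟩ <;>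
      (try simp only [map_mul, map_smul, map_sub, map_one, map_zero, map_pow, map_serre]) <;> rfl
  case serreF i j h =>
    refine ⟨_, _, .serreF i j ‹_›, ?_, ?_⟩ <;>
      (try simp only [map_mul, map_smul, map_sub, map_one, map_zero, map_pow, map_serre]) <;> rfl

/-- An algebra homomorphism out of `𝐔`, given by the images of the generators. -/
def U.lift {A : Type*} [Ring A] [Algebra Qvpi A] (g : UGen I Y → A)
    (h : ∀ x y, Rel D g x y → x = y) : U D →ₐ[Qvpi] A :=
  RingQuot.liftAlgHom Qvpi ⟨FreeAlgebra.lift Qvpi g, fun x y hxy => h _ _ (by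
    have := hxy.map D (FreeAlgebra.lift Qvpi g)
    simpa using this)⟩

theorem U.lift_gen {A : Type*} [Ring A] [Algebra Qvpi A] (g : UGen I Y → A)
    (h : ∀ x y, Rel D g x y → x = y) (s : UGen I Y) : U.lift D g h (gen D s) = g s := by
  refine (RingQuot.liftAlgHom_mkAlgHom_apply Qvpi _ _ _).trans ?_
  simp

theorem U.induction {P : U D → Prop} (hgen : ∀ s, P (gen D s))
    (halg : ∀ r, P (algebraMap Qvpi (U D) r)) (hmul : ∀ x y, P x → P y → P (x * y))
    (hadd : ∀ x y, P x → P y → P (x + y)) (x : U D) : P x := by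
  obtain ⟨x, rfl⟩ := RingQuot.mkAlgHom_surjective Qvpi (Rel D _) x
  induction x using FreeAlgebra.induction with
  | grade0 r =>
    rw [AlgHom.commutes]
    exact halg r
  | grade1 s => exact hgen s
  | mul a b ha hb => rw [map_mul]; exact hmul _ _ ha hb
  | add a b ha hb => rw [map_add]; exact hadd _ _ ha hb

/-- The homomorphism `x ↦ x⁻`, `θ_i ↦ F_i`, from `𝐟` to `𝐔`. -/
def minus : Half C →ₐ[Qvpi] U D :=
  Half.lift C (fun i => gen D (.F i)) fun i j h => gen_rel D (.serreF i j h)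

/-- The images of the generators under `τ₁`, as elements of the opposite algebra:
`E_i ↦ v_i⁻¹ K̃_{-i} F_i`, `F_i ↦ v_i⁻¹ K̃_i E_i`, `K_μ ↦ K_μ`, `J_μ ↦ J_μ`, where
`K̃_{± i} = K_{± d_i i}`. -/
def tauGen : UGen I Y → (U D)ᵐᵒᵖ
  | .E i => MulOpposite.op ((((vi C i)⁻¹ : Qvpiˣ) : Qvpi) •
      (gen D (.K (-(C.d i • D.coroot i))) * gen D (.F i)))
  | .F i => MulOpposite.op ((((vi C i)⁻¹ : Qvpiˣ) : Qvpi) •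
      (gen D (.K (C.d i • D.coroot i)) * gen D (.E i)))
  | .K μ => MulOpposite.op (gen D (.K μ))
  | .J μ => MulOpposite.op (gen D (.J μ))

theorem pow_mul_comm_of_comm {A : Type*} [Ring A] [Algebra Qvpi A] {x κ : A} {q : Qvpi}
    (h : x * κ = q • (κ * x)) (m n : ℕ) : x ^ m * κ ^ n = q ^ (m * n) • (κ ^ n * x ^ m) := by
  have h1 : ∀ m, x ^ m * κ = q ^ m • (κ * x ^ m) := by
    intro m
    induction m with
    | zero => simp
    | succ m ih =>
      rw [pow_succ, mul_assoc, h, mul_smul_comm, ← mul_assoc, ih, smul_mul_assoc, smul_smul,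
        mul_assoc, ← pow_succ, ← pow_succ']
  induction n with
  | zero => simp
  | succ n ih =>
    rw [pow_succ, ← mul_assoc, ih, smul_mul_assoc, mul_assoc, h1, mul_smul_comm, smul_smul,
      ← pow_add, ← mul_assoc]
    rfl

theorem mul_pow_of_comm {A : Type*} [Ring A] [Algebra Qvpi A] {x κ : A} {q : Qvpi}
    (h : x * κ = q • (κ * x)) (n : ℕ) : (κ * x) ^ n = q ^ n.choose 2 • (κ ^ n * x ^ n) := by
  induction n with
  | zero => simp
  | succ n ih =>
    have h1 := pow_mul_comm_of_comm h n 1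
    rw [pow_one, mul_one] at h1
    calc (κ * x) ^ (n + 1) = q ^ n.choose 2 • (κ ^ n * (x ^ n * κ) * x) := by
          rw [pow_succ, ih, smul_mul_assoc]; simp only [mul_assoc]
      _ = _ := by
          rw [h1, mul_smul_comm, smul_mul_assoc, smul_smul, ← pow_add, Nat.choose_succ_succ' n 1,
            Nat.choose_one_right, add_comm n, pow_succ κ, pow_succ x]
          simp only [mul_assoc]

theorem serre_term_twist {A : Type*} [Ring A] [Algebra Qvpi A] {x y κ ν : A} {q r : Qvpi}
    (hxκ : x * κ = q • (κ * x)) (hxν : x * ν = r • (ν * x)) (hyκ : y * κ = r • (κ * y))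
    (hκν : κ * ν = ν * κ) (k m : ℕ) :
    (κ * x) ^ k * (ν * y) * (κ * x) ^ m =
      (q ^ (k + m).choose 2 * r ^ (k + m)) • (κ ^ (k + m) * ν * (x ^ k * y * x ^ m)) := by
  have h1 := pow_mul_comm_of_comm hxν k 1
  have h2 := pow_mul_comm_of_comm hyκ 1 m
  have h3 := pow_mul_comm_of_comm hxκ k m
  simp only [pow_one, mul_one, one_mul] at h1 h2
  have hc : κ ^ m * ν = ν * κ ^ m := (Commute.pow_left hκν m).eq
  calc (κ * x) ^ k * (ν * y) * (κ * x) ^ m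
      = (q ^ k.choose 2 * q ^ m.choose 2) •
          (κ ^ k * (x ^ k * ν) * (y * κ ^ m) * x ^ m) := by
        rw [mul_pow_of_comm hxκ, mul_pow_of_comm hxκ, smul_mul_assoc, smul_mul_assoc,
          mul_smul_comm, smul_smul]
        simp only [mul_assoc]
    _ = (q ^ k.choose 2 * q ^ m.choose 2 * r ^ k * r ^ m) •
          (κ ^ k * ν * (x ^ k * κ ^ m) * y * x ^ m) := by
        rw [h1, h2]
        simp only [mul_smul_comm, smul_mul_assoc, smul_smul, mul_assoc]
        congr 1; ring
    _ = (q ^ k.choose 2 * q ^ m.choose 2 * r ^ k * r ^ m * q ^ (k * m)) •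
          (κ ^ k * (ν * κ ^ m) * (x ^ k * y * x ^ m)) := by
        rw [h3]
        simp only [mul_smul_comm, smul_mul_assoc, smul_smul, mul_assoc]
    _ = _ := by
        rw [← hc, pow_add κ]
        have hch : (m + k).choose 2 = m.choose 2 + k.choose 2 + m * k := by
          rw [Nat.add_choose_eq]
          simp [Finset.Nat.antidiagonal_succ]
          ring
        rw [add_comm k m, hch]
        simp only [mul_assoc]
        congr 1; ring

theorem serre_op_eq_zero {A : Type*} [Ring A] [Algebra Qvpi A] (x κ : I → A) (s : I → Qvpi)
    (q : I → I → Qvpi) (hq : ∀ i j, q i j = q j i)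
    (hx : ∀ i j, x i * κ j = q i j • (κ j * x i)) (hκ : ∀ i j, κ i * κ j = κ j * κ i)
    {i j : I} (hij : i ≠ j) (h0 : serre C x i j = 0) :
    serre C (fun i => MulOpposite.op (s i • (κ i * x i))) i j = 0 := by
  apply MulOpposite.unop_injective
  obtain ⟨c, hc⟩ := serreCoeff_symm C hij
  have hterm : ∀ k ∈ Finset.range (bexp C i j + 1),
      MulOpposite.unop (serreCoeff C i j k • (MulOpposite.op (s i • (κ i * x i)) ^
        (bexp C i j - k) * MulOpposite.op (s j • (κ j * x j)) *
        MulOpposite.op (s i • (κ i * x i)) ^ k)) =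
      (s i ^ bexp C i j * s j * (q i i ^ (bexp C i j).choose 2 * q i j ^ bexp C i j)) •
        (κ i ^ bexp C i j * κ j * (serreCoeff C i j k •
          (x i ^ k * x j * x i ^ (bexp C i j - k)))) := by
    intro k hk
    obtain ⟨m, hm⟩ : ∃ m, bexp C i j = k + m :=
      ⟨bexp C i j - k, by have := Finset.mem_range.1 hk; omega⟩
    rw [hm, Nat.add_sub_cancel_left]
    simp only [MulOpposite.unop_smul, MulOpposite.unop_mul, MulOpposite.unop_pow,
      MulOpposite.unop_op, smul_pow, smul_mul_assoc, mul_smul_comm, smul_smul, ← mul_assoc]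
    have ht := serre_term_twist (hx i i) (hx i j) ((hx j i).trans (by rw [hq j i])) (hκ i j) k m
    simp only [← mul_assoc] at ht
    rw [ht, smul_smul]
    congr 1
    ring
  unfold serre
  rw [Finset.unop_sum, Finset.sum_congr rfl hterm, ← Finset.smul_sum, ← Finset.mul_sum,
    ← Finset.sum_range_reflect]
  have hrefl : ∀ k ∈ Finset.range (bexp C i j + 1),
      serreCoeff C i j (bexp C i j + 1 - 1 - k) • (x i ^ (bexp C i j + 1 - 1 - k) * x j *
        x i ^ (bexp C i j - (bexp C i j + 1 - 1 - k))) =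
      (c : Qvpi) • (serreCoeff C i j k • (x i ^ (bexp C i j - k) * x j * x i ^ k)) := by
    intro k hk
    have hk' : k ≤ bexp C i j := by have := Finset.mem_range.1 hk; omega
    rw [Nat.add_sub_cancel, Nat.sub_sub_self hk', hc k hk', smul_smul]
  rw [Finset.sum_congr rfl hrefl, ← Finset.smul_sum]
  rw [serre] at h0
  rw [h0]
  simp

theorem dot_eq_pairing (i j : I) :
    D.pairing (C.d j • D.coroot j) (D.root i) = C.dot i j := by
  rw [map_nsmul, LinearMap.smul_apply, D.pairing_coroot_root, C.dot_symm, ← C.d_mul_a]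
  simp

theorem K_mul_comm (μ ν : Y) :
    gen D (.K μ) * gen D (.K ν) = gen D (.K ν) * gen D (.K μ) := by
  rw [gen_rel D (.KK μ ν), gen_rel D (.KK ν μ), add_comm]

theorem F_mul_K (i : I) (μ : Y) : gen D (.F i) * gen D (.K μ) =
    ((vU ^ D.pairing μ (D.root i) : Qvpiˣ) : Qvpi) • (gen D (.K μ) * gen D (.F i)) := by
  rw [gen_rel D (.KF μ i), smul_smul, ← Units.val_mul, ← zpow_add, add_neg_cancel, zpow_zero,
    Units.val_one, one_smul]

theorem E_mul_K (i : I) (μ : Y) : gen D (.E i) * gen D (.K μ) =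
    ((vU ^ (-D.pairing μ (D.root i)) : Qvpiˣ) : Qvpi) • (gen D (.K μ) * gen D (.E i)) := by
  rw [gen_rel D (.KE μ i), smul_smul, ← Units.val_mul, ← zpow_add, neg_add_cancel, zpow_zero,
    Units.val_one, one_smul]

theorem tau_EF (i j : I) :
    gen D (.K (C.d j • D.coroot j)) * gen D (.E j) *
      (gen D (.K (-(C.d i • D.coroot i))) * gen D (.F i)) =
    ((vU ^ C.dot i j : Qvpiˣ) : Qvpi) •
      (gen D (.K (C.d j • D.coroot j + -(C.d i • D.coroot i))) * (gen D (.E j) * gen D (.F i))) := by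
  rw [← gen_rel D (.KK _ _), mul_assoc, ← mul_assoc (gen D (.E j)), E_mul_K, map_neg,
    LinearMap.neg_apply, neg_neg, dot_eq_pairing, C.dot_symm j i]
  simp only [smul_mul_assoc, mul_smul_comm, mul_assoc]

theorem tau_FE (i j : I) :
    gen D (.K (-(C.d i • D.coroot i))) * gen D (.F i) *
      (gen D (.K (C.d j • D.coroot j)) * gen D (.E j)) =
    ((vU ^ C.dot i j : Qvpiˣ) : Qvpi) •
      (gen D (.K (C.d j • D.coroot j + -(C.d i • D.coroot i))) * (gen D (.F i) * gen D (.E j))) := by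
  rw [← gen_rel D (.KK _ _), mul_assoc, ← mul_assoc (gen D (.F i)), F_mul_K, dot_eq_pairing,
    K_mul_comm]
  simp only [smul_mul_assoc, mul_smul_comm, mul_assoc]

theorem tauGen_rel {x y : (U D)ᵐᵒᵖ} (h : Rel D (tauGen D) x y) : x = y := by
  apply MulOpposite.unop_injective
  cases h
  case JJ μ ν =>
    exact (gen_rel D (.JJ ν μ)).trans (by rw [add_comm]; rfl)
  case KK μ ν =>
    exact (gen_rel D (.KK ν μ)).trans (by rw [add_comm]; rfl)
  case K_zero => exact gen_rel D .K_zero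
  case J_zero => exact gen_rel D .J_zero
  case J_sq ν => exact gen_rel D (.J_sq ν)
  case JK μ ν => exact (gen_rel D (.JK μ ν)).symm
  case JE μ i =>
    simp only [tauGen, MulOpposite.unop_mul, MulOpposite.unop_smul, MulOpposite.unop_op,
      smul_mul_assoc, mul_smul_comm]
    rw [smul_comm]
    congr 1
    rw [← mul_assoc, gen_rel D (.JK _ _), mul_assoc, mul_assoc, gen_rel D (.JF _ _),
      mul_smul_comm, smul_smul, ← Units.val_mul, ← zpow_add, add_neg_cancel, zpow_zero,
      Units.val_one, one_smul]
  case JF μ i =>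
    simp only [tauGen, MulOpposite.unop_mul, MulOpposite.unop_smul, MulOpposite.unop_op,
      smul_mul_assoc, mul_smul_comm]
    rw [smul_comm]
    congr 1
    rw [← mul_assoc, gen_rel D (.JK _ _), mul_assoc, mul_assoc, gen_rel D (.JE _ _),
      mul_smul_comm, smul_smul, ← Units.val_mul, ← zpow_add, neg_add_cancel, zpow_zero,
      Units.val_one, one_smul]
  case KE μ i =>
    simp only [tauGen, MulOpposite.unop_mul, MulOpposite.unop_smul, MulOpposite.unop_op,
      smul_mul_assoc, mul_smul_comm]
    rw [smul_comm]
    congr 1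
    rw [← mul_assoc, K_mul_comm D μ, mul_assoc, mul_assoc, F_mul_K, mul_smul_comm]
  case KF μ i =>
    simp only [tauGen, MulOpposite.unop_mul, MulOpposite.unop_smul, MulOpposite.unop_op,
      smul_mul_assoc, mul_smul_comm]
    rw [smul_comm]
    congr 1
    rw [← mul_assoc, K_mul_comm D μ, mul_assoc, mul_assoc, E_mul_K, mul_smul_comm]
  case EF_self i =>
    have hs : ((((vi C i)⁻¹ : Qvpiˣ) : Qvpi) * (((vi C i)⁻¹ : Qvpiˣ) : Qvpi)) *
        ((vU ^ C.dot i i : Qvpiˣ) : Qvpi) = 1 := by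
      rw [← Units.val_mul, ← Units.val_mul, C.dot_self, vi, two_mul, zpow_add, zpow_natCast]
      simp
    have h0 := gen_rel D (.EF_self i)
    simp only [tauGen, MulOpposite.unop_mul, MulOpposite.unop_smul, MulOpposite.unop_op,
      MulOpposite.unop_sub, smul_mul_assoc, mul_smul_comm, smul_smul]
    rw [tau_EF, tau_FE, smul_smul, smul_smul, add_neg_cancel, gen_rel D .K_zero, one_mul, one_mul,
      hs, mul_assoc, hs, mul_one, one_smul, h0, gen_rel D (.JK _ _)]
  case EF_ne i j hij =>
    have h0 := gen_rel D (.EF_ne j i (Ne.symm hij))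
    simp only [tauGen, MulOpposite.unop_mul, MulOpposite.unop_smul, MulOpposite.unop_op,
      MulOpposite.unop_sub, smul_mul_assoc, mul_smul_comm, smul_smul, MulOpposite.unop_zero]
    rw [tau_EF, tau_FE, sub_eq_zero.1 h0, mul_comm (C.p j)]
    simp only [mul_smul_comm, smul_smul]
    rw [sub_eq_zero]
    congr 1
    ring
  case serreE i j hij =>
    refine congrArg MulOpposite.unop (serre_op_eq_zero (C := C) (fun i => gen D (.F i))
      (fun i => gen D (.K (-(C.d i • D.coroot i)))) (fun i => (((vi C i)⁻¹ : Qvpiˣ) : Qvpi))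
      (fun i j => ((vU ^ (-C.dot i j) : Qvpiˣ) : Qvpi)) ?_ ?_ ?_ hij
      (gen_rel D (.serreF i j hij)))
    · intro i j; rw [C.dot_symm]
    · intro i j
      rw [F_mul_K, map_neg, LinearMap.neg_apply, dot_eq_pairing]
    · intro i j
      exact K_mul_comm D _ _
  case serreF i j hij =>
    refine congrArg MulOpposite.unop (serre_op_eq_zero (C := C) (fun i => gen D (.E i))
      (fun i => gen D (.K (C.d i • D.coroot i))) (fun i => (((vi C i)⁻¹ : Qvpiˣ) : Qvpi))
      (fun i j => ((vU ^ (-C.dot i j) : Qvpiˣ) : Qvpi)) ?_ ?_ ?_ hij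
      (gen_rel D (.serreE i j hij)))
    · intro i j; rw [C.dot_symm]
    · intro i j
      rw [E_mul_K, dot_eq_pairing]
    · intro i j
      exact K_mul_comm D _ _

/-- The anti-automorphism `τ₁`, as a homomorphism to the opposite algebra. -/
def tauOp : U D →ₐ[Qvpi] (U D)ᵐᵒᵖ := U.lift D (tauGen D) fun _ _ => tauGen_rel D

/-- The anti-automorphism `τ₁` of `𝐔`. -/
def tau : U D →ₗ[Qvpi] U D :=
  (MulOpposite.opLinearEquiv Qvpi).symm.toLinearMap.comp (tauOp D).toLinearMap

theorem tau_mul (x y : U D) : tau D (x * y) = tau D y * tau D x := by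
  simp [tau]

theorem tau_E (i : I) : tau D (gen D (.E i)) = (((vi C i)⁻¹ : Qvpiˣ) : Qvpi) •
    (gen D (.K (-(C.d i • D.coroot i))) * gen D (.F i)) :=
  congrArg MulOpposite.unop (U.lift_gen D _ _ (.E i))

theorem tau_F (i : I) : tau D (gen D (.F i)) = (((vi C i)⁻¹ : Qvpiˣ) : Qvpi) •
    (gen D (.K (C.d i • D.coroot i)) * gen D (.E i)) :=
  congrArg MulOpposite.unop (U.lift_gen D _ _ (.F i))

theorem tau_K (μ : Y) : tau D (gen D (.K μ)) = gen D (.K μ) :=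
  congrArg MulOpposite.unop (U.lift_gen D _ _ (.K μ))

theorem tau_J (μ : Y) : tau D (gen D (.J μ)) = gen D (.J μ) :=
  congrArg MulOpposite.unop (U.lift_gen D _ _ (.J μ))

/-! ### The `X`-grading of `𝐔` -/

/-- The weights in `X` of the generators. -/
def wt : UGen I Y → X
  | .E i => D.root i
  | .F i => -D.root i
  | .K _ => 0
  | .J _ => 0

theorem serre_single {A : Type*} [Ring A] [Algebra Qvpi A] (w : I → X) (x : I → A) (i j : I) :
    serre C (fun i => AddMonoidAlgebra.single (w i) (x i)) i j =
      AddMonoidAlgebra.single (bexp C i j • w i + w j) (serre C x i j) := by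
  unfold serre
  rw [← AddMonoidAlgebra.singleAddHom_apply, map_sum]
  refine Finset.sum_congr rfl fun k hk => ?_
  have hk' : k ≤ bexp C i j := by have := Finset.mem_range.1 hk; omega
  rw [AddMonoidAlgebra.singleAddHom_apply, AddMonoidAlgebra.single_pow,
    AddMonoidAlgebra.single_pow, AddMonoidAlgebra.single_mul_single,
    AddMonoidAlgebra.single_mul_single, AddMonoidAlgebra.smul_single]
  congr 1
  nth_rewrite 2 [← Nat.sub_add_cancel hk']
  rw [add_smul]
  abel

theorem single_gen_rel {x y : AddMonoidAlgebra (U D) X}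
    (h : Rel D (fun s => AddMonoidAlgebra.single (wt D s) (gen D s)) x y) : x = y := by
  cases h
  case serreE i j hij =>
    refine (serre_single (C := C) D.root (fun i => gen D (.E i)) i j).trans ?_
    rw [gen_rel D (.serreE i j hij), AddMonoidAlgebra.single_zero]
  case serreF i j hij =>
    refine (serre_single (C := C) (fun i => -D.root i) (fun i => gen D (.F i)) i j).trans ?_
    rw [gen_rel D (.serreF i j hij), AddMonoidAlgebra.single_zero]
  case EF_self i =>
    simp only [AddMonoidAlgebra.single_mul_single, AddMonoidAlgebra.smul_single, wt,
      add_neg_cancel, neg_add_cancel, add_zero, ← AddMonoidAlgebra.single_sub]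
    rw [gen_rel D (.EF_self i)]
  case EF_ne i j hij =>
    simp only [AddMonoidAlgebra.single_mul_single, AddMonoidAlgebra.smul_single, wt,
      add_comm (D.root i), ← AddMonoidAlgebra.single_sub]
    rw [gen_rel D (.EF_ne i j hij), AddMonoidAlgebra.single_zero]
  case JJ μ ν =>
    simp only [AddMonoidAlgebra.single_mul_single, wt, add_zero, gen_rel D (.JJ μ ν)]
  case KK μ ν =>
    simp only [AddMonoidAlgebra.single_mul_single, wt, add_zero, gen_rel D (.KK μ ν)]
  case K_zero => rw [AddMonoidAlgebra.one_def, gen_rel D .K_zero]; rfl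
  case J_zero => rw [AddMonoidAlgebra.one_def, gen_rel D .J_zero]; rfl
  case J_sq ν =>
    rw [AddMonoidAlgebra.single_pow, gen_rel D (.J_sq ν), AddMonoidAlgebra.one_def, wt, smul_zero]
  case JK μ ν =>
    simp only [AddMonoidAlgebra.single_mul_single, wt, add_zero, gen_rel D (.JK μ ν)]
  case JE μ i =>
    simp only [AddMonoidAlgebra.single_mul_single, AddMonoidAlgebra.smul_single, wt, add_zero,
      zero_add, gen_rel D (.JE μ i)]
  case JF μ i =>
    simp only [AddMonoidAlgebra.single_mul_single, AddMonoidAlgebra.smul_single, wt, add_zero,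
      zero_add, gen_rel D (.JF μ i)]
  case KE μ i =>
    simp only [AddMonoidAlgebra.single_mul_single, AddMonoidAlgebra.smul_single, wt, add_zero,
      zero_add, gen_rel D (.KE μ i)]
  case KF μ i =>
    simp only [AddMonoidAlgebra.single_mul_single, AddMonoidAlgebra.smul_single, wt, add_zero,
      zero_add, gen_rel D (.KF μ i)]

/-- The decomposition of an element of `𝐔` into its components of weights in `X`. -/
def decomp : U D →ₐ[Qvpi] AddMonoidAlgebra (U D) X :=
  U.lift D (fun s => AddMonoidAlgebra.single (wt D s) (gen D s)) fun _ _ => single_gen_rel D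

theorem decomp_gen (s : UGen I Y) :
    decomp D (gen D s) = AddMonoidAlgebra.single (wt D s) (gen D s) := U.lift_gen D _ _ s

/-- The component of weight `ζ` of an element of `𝐔`. -/
def comp (ζ : X) : U D →ₗ[Qvpi] U D where
  toFun u := (decomp D u).coeff ζ
  map_add' x y := by simp
  map_smul' r x := by simp

/-- `u` has weight `ζ`. -/
structure HasWeight (ζ : X) (u : U D) : Prop where
  decomp_eq : decomp D u = AddMonoidAlgebra.single ζ u
  K_comm : ∀ ν, gen D (.K ν) * u =
    ((vU ^ D.pairing ν ζ : Qvpiˣ) : Qvpi) • (u * gen D (.K ν))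
  J_comm : ∀ ν, gen D (.J ν) * u =
    ((piU ^ D.pairing ν ζ : Qvpiˣ) : Qvpi) • (u * gen D (.J ν))

variable {D}

theorem HasWeight.zero (ζ : X) : HasWeight D ζ 0 := ⟨by simp, by simp, by simp⟩

theorem HasWeight.add {ζ : X} {u w : U D} (hu : HasWeight D ζ u) (hw : HasWeight D ζ w) :
    HasWeight D ζ (u + w) :=
  ⟨by rw [map_add, hu.decomp_eq, hw.decomp_eq, AddMonoidAlgebra.single_add],
    fun ν => by rw [mul_add, hu.K_comm, hw.K_comm, add_mul, smul_add],
    fun ν => by rw [mul_add, hu.J_comm, hw.J_comm, add_mul, smul_add]⟩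

theorem HasWeight.mul {ζ η : X} {u w : U D} (hu : HasWeight D ζ u) (hw : HasWeight D η w) :
    HasWeight D (ζ + η) (u * w) :=
  ⟨by rw [map_mul, hu.decomp_eq, hw.decomp_eq, AddMonoidAlgebra.single_mul_single],
    fun ν => by
      rw [← mul_assoc, hu.K_comm, smul_mul_assoc, mul_assoc, hw.K_comm, mul_smul_comm, smul_smul,
        ← mul_assoc, map_add, zpow_add, Units.val_mul],
    fun ν => by
      rw [← mul_assoc, hu.J_comm, smul_mul_assoc, mul_assoc, hw.J_comm, mul_smul_comm, smul_smul,
        ← mul_assoc, map_add, zpow_add, Units.val_mul]⟩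

theorem HasWeight.algebraMap (r : Qvpi) : HasWeight D 0 (algebraMap Qvpi (U D) r) :=
  ⟨by rw [AlgHom.commutes]; rfl,
    fun ν => by rw [map_zero, zpow_zero, Units.val_one, one_smul, Algebra.commutes],
    fun ν => by rw [map_zero, zpow_zero, Units.val_one, one_smul, Algebra.commutes]⟩

theorem HasWeight.gen (s : UGen I Y) : HasWeight D (wt D s) (gen D s) := by
  refine ⟨decomp_gen D s, fun ν => ?_, fun ν => ?_⟩
  · cases s with
    | E i => exact gen_rel D (.KE ν i)
    | F i => rw [wt, map_neg]; exact gen_rel D (.KF ν i)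
    | K μ => rw [wt, map_zero, zpow_zero, Units.val_one, one_smul, K_mul_comm]
    | J μ => rw [wt, map_zero, zpow_zero, Units.val_one, one_smul, gen_rel D (.JK μ ν)]
  · cases s with
    | E i => exact gen_rel D (.JE ν i)
    | F i => rw [wt, map_neg]; exact gen_rel D (.JF ν i)
    | K μ => rw [wt, map_zero, zpow_zero, Units.val_one, one_smul, gen_rel D (.JK ν μ)]
    | J μ => rw [wt, map_zero, zpow_zero, Units.val_one, one_smul, gen_rel D (.JJ ν μ), add_comm,
        ← gen_rel D (.JJ μ ν)]

theorem comp_of_decomp_eq {ζ : X} {u : U D} (h : decomp D u = AddMonoidAlgebra.single ζ u) (η : X)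
    [Decidable (ζ = η)] : comp D η u = if ζ = η then u else 0 := by
  classical
  change (decomp D u).coeff η = _
  rw [h, AddMonoidAlgebra.coeff_single, Finsupp.single_apply]

variable (D)

theorem hasWeight_comp (ζ : X) (u : U D) : HasWeight D ζ (comp D ζ u) := by
  classical
  induction u using U.induction generalizing ζ with
  | hgen s =>
    rw [comp_of_decomp_eq (HasWeight.gen s).decomp_eq]
    split_ifs with h
    · exact h ▸ HasWeight.gen s
    · exact HasWeight.zero ζ
  | halg r =>
    rw [comp_of_decomp_eq (HasWeight.algebraMap r).decomp_eq]
    split_ifs with h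
    · exact h ▸ HasWeight.algebraMap r
    · exact HasWeight.zero ζ
  | hadd x y hx hy => rw [map_add]; exact (hx ζ).add (hy ζ)
  | hmul x y hx hy =>
    change HasWeight D ζ ((decomp D (x * y)).coeff ζ)
    rw [map_mul, AddMonoidAlgebra.coeff_mul_apply_left]
    refine Finset.sum_induction _ (HasWeight D ζ) (fun _ _ => HasWeight.add) (HasWeight.zero ζ) ?_
    intro a _
    have := (hx a).mul (hy (-a + ζ))
    rwa [add_neg_cancel_left] at this

theorem comp_mul_of_hasWeight {η : X} {w : U D} (hw : HasWeight D η w) (ζ : X) (u : U D) :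
    comp D ζ (u * w) = comp D (ζ - η) u * w := by
  change (decomp D (u * w)).coeff ζ = _
  rw [map_mul, hw.decomp_eq, AddMonoidAlgebra.coeff_mul_single_apply, sub_eq_add_neg]
  rfl

/-! ### The modified form -/

/-- The left ideal of `𝐔` generated by the `K_ν - v^{⟨ν,λ⟩}` and `J_ν - π^{⟨ν,λ⟩}`, `ν ∈ Y`. -/
def wtIdeal (lam : X) : Submodule (U D) (U D) :=
  Submodule.span (U D)
    (Set.range (fun ν : Y => gen D (.K ν) -
        algebraMap Qvpi (U D) ((vU ^ D.pairing ν lam : Qvpiˣ) : Qvpi)) ∪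
      Set.range (fun ν : Y => gen D (.J ν) -
        algebraMap Qvpi (U D) ((piU ^ D.pairing ν lam : Qvpiˣ) : Qvpi)))

theorem hasWeight_K_sub (ν : Y) (r : Qvpi) :
    HasWeight D 0 (gen D (.K ν) - algebraMap Qvpi (U D) r) := by
  rw [sub_eq_add_neg, ← map_neg]
  exact (HasWeight.gen (.K ν)).add (HasWeight.algebraMap _)

theorem hasWeight_J_sub (ν : Y) (r : Qvpi) :
    HasWeight D 0 (gen D (.J ν) - algebraMap Qvpi (U D) r) := by
  rw [sub_eq_add_neg, ← map_neg]
  exact (HasWeight.gen (.J ν)).add (HasWeight.algebraMap _)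

theorem comp_mem_wtIdeal (ζ lam : X) {u : U D} (hu : u ∈ wtIdeal D lam) :
    comp D ζ u ∈ wtIdeal D lam := by
  induction hu using Submodule.span_induction generalizing ζ with
  | zero => rw [map_zero]; exact zero_mem _
  | add x y _ _ hx hy => rw [map_add]; exact add_mem (hx ζ) (hy ζ)
  | mem x hx =>
    have hx0 : HasWeight D 0 x := by
      rcases hx with ⟨ν, rfl⟩ | ⟨ν, rfl⟩
      · exact hasWeight_K_sub D ν _
      · exact hasWeight_J_sub D ν _
    have := comp_mul_of_hasWeight D hx0 ζ 1
    rw [one_mul, sub_zero] at this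
    rw [this]
    exact Submodule.smul_mem _ _ (Submodule.subset_span hx)
  | smul a x _ hx =>
    change (decomp D (a * x)).coeff ζ ∈ _
    rw [map_mul, AddMonoidAlgebra.coeff_mul_apply_left]
    refine Submodule.sum_mem _ fun b _ => Submodule.smul_mem _ _ (hx _)

theorem mul_comp_mem_wtIdeal (lam η : X) {x : U D} (hx : x ∈ wtIdeal D lam) (u : U D) :
    x * comp D (lam - η) u ∈ wtIdeal D η := by
  have hw := hasWeight_comp D (lam - η) u
  induction hx using Submodule.span_induction with
  | zero => rw [zero_mul]; exact zero_mem _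
  | add x y _ _ hx hy => rw [add_mul]; exact add_mem hx hy
  | smul a x _ hx => rw [smul_eq_mul, mul_assoc]; exact Submodule.smul_mem _ a hx
  | mem x hx =>
    rcases hx with ⟨ν, rfl⟩ | ⟨ν, rfl⟩
    · have e : (gen D (.K ν) - algebraMap Qvpi (U D) ((vU ^ D.pairing ν lam : Qvpiˣ) : Qvpi)) *
          comp D (lam - η) u =
          (((vU ^ D.pairing ν (lam - η) : Qvpiˣ) : Qvpi) • comp D (lam - η) u) *
          (gen D (.K ν) - algebraMap Qvpi (U D) ((vU ^ D.pairing ν η : Qvpiˣ) : Qvpi)) := by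
        rw [sub_mul, hw.K_comm, mul_sub, smul_mul_assoc, smul_mul_assoc, ← Algebra.commutes,
          ← Algebra.smul_def, ← Algebra.smul_def, smul_smul, ← Units.val_mul, ← zpow_add,
          ← map_add, sub_add_cancel]
      rw [e]
      exact Submodule.smul_mem _ _ (Submodule.subset_span (Or.inl ⟨ν, rfl⟩))
    · have e : (gen D (.J ν) - algebraMap Qvpi (U D) ((piU ^ D.pairing ν lam : Qvpiˣ) : Qvpi)) *
          comp D (lam - η) u =
          (((piU ^ D.pairing ν (lam - η) : Qvpiˣ) : Qvpi) • comp D (lam - η) u) *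
          (gen D (.J ν) - algebraMap Qvpi (U D) ((piU ^ D.pairing ν η : Qvpiˣ) : Qvpi)) := by
        rw [sub_mul, hw.J_comm, mul_sub, smul_mul_assoc, smul_mul_assoc, ← Algebra.commutes,
          ← Algebra.smul_def, ← Algebra.smul_def, smul_smul, ← Units.val_mul, ← zpow_add,
          ← map_add, sub_add_cancel]
      rw [e]
      exact Submodule.smul_mem _ _ (Submodule.subset_span (Or.inr ⟨ν, rfl⟩))

/-- The modified form `𝐔̇ = ⨁_{λ ∈ X} 𝐔 1_λ`, where `𝐔 1_λ` is the quotient of `𝐔` by the left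
ideal `wtIdeal D λ`. -/
def Udot : Type _ := DirectSum X fun lam => U D ⧸ wtIdeal D lam

instance : AddCommGroup (Udot D) :=
  inferInstanceAs (AddCommGroup (DirectSum X fun lam => U D ⧸ wtIdeal D lam))

instance : Module (U D) (Udot D) :=
  inferInstanceAs (Module (U D) (DirectSum X fun lam => U D ⧸ wtIdeal D lam))

instance : Module Qvpi (Udot D) :=
  inferInstanceAs (Module Qvpi (DirectSum X fun lam => U D ⧸ wtIdeal D lam))

instance : IsScalarTower Qvpi (U D) (Udot D) :=
  inferInstanceAs (IsScalarTower Qvpi (U D) (DirectSum X fun lam => U D ⧸ wtIdeal D lam))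

open scoped Classical in
/-- The element `x 1_λ` of `𝐔̇`. -/
def sym (lam : X) : U D →ₗ[U D] Udot D :=
  (DirectSum.lof (U D) X (fun lam => U D ⧸ wtIdeal D lam) lam).comp (wtIdeal D lam).mkQ

theorem sym_eq_zero {lam : X} {x : U D} (hx : x ∈ wtIdeal D lam) : sym D lam x = 0 := by
  classical
  have h : (wtIdeal D lam).mkQ x = 0 := (Submodule.Quotient.mk_eq_zero _).2 hx
  exact (congrArg (DirectSum.lof (U D) X (fun lam => U D ⧸ wtIdeal D lam) lam) h).trans
    (map_zero _)

theorem Udot.induction {P : Udot D → Prop} (h0 : P 0) (hsym : ∀ lam x, P (sym D lam x))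
    (hadd : ∀ a b, P a → P b → P (a + b)) (a : Udot D) : P a := by
  classical
  refine DirectSum.induction_on a h0 (fun lam x => ?_) hadd
  obtain ⟨x, rfl⟩ := (wtIdeal D lam).mkQ_surjective x
  exact hsym lam x

open scoped Classical in
/-- The `ℚ(v)^π`-linear map out of `𝐔̇` with given values on the elements `x 1_λ`. -/
def Udot.lift {M : Type*} [AddCommGroup M] [Module Qvpi M] (f : X → U D →ₗ[Qvpi] M)
    (hf : ∀ lam, ∀ x ∈ wtIdeal D lam, f lam x = 0) : Udot D →ₗ[Qvpi] M :=
  DirectSum.toModule Qvpi X M fun lam =>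
    (((wtIdeal D lam).restrictScalars Qvpi).liftQ (f lam) (hf lam)).comp
      (Submodule.Quotient.restrictScalarsEquiv Qvpi (wtIdeal D lam)).symm.toLinearMap

theorem Udot.lift_sym {M : Type*} [AddCommGroup M] [Module Qvpi M] (f : X → U D →ₗ[Qvpi] M)
    (hf : ∀ lam, ∀ x ∈ wtIdeal D lam, f lam x = 0) (lam : X) (x : U D) :
    Udot.lift D f hf (sym D lam x) = f lam x := by
  classical
  exact DirectSum.toModule_lof Qvpi lam _

/-- Left multiplication by `1_λ` on `𝐔̇`: it sends `y 1_η` to `y' 1_η`, where `y'` is the component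
of `y` of weight `λ - η`. -/
def idemMul (lam : X) : Udot D →ₗ[Qvpi] Udot D :=
  Udot.lift D (fun η => ((sym D η).restrictScalars Qvpi).comp (comp D (lam - η)))
    fun η _ hx => sym_eq_zero D (comp_mem_wtIdeal D _ η hx)

theorem idemMul_sym (lam η : X) (y : U D) :
    idemMul D lam (sym D η y) = sym D η (comp D (lam - η) y) := Udot.lift_sym D _ _ η y

/-- The product of `𝐔̇`: `(x 1_λ) m = x (1_λ m)`. -/
def mulHom : Udot D →ₗ[Qvpi] Udot D →ₗ[Qvpi] Udot D :=
  Udot.lift D (fun lam => (LinearMap.lcomp Qvpi (Udot D) (idemMul D lam)).comp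
      (Algebra.lsmul Qvpi Qvpi (Udot D)).toLinearMap) (by
    intro lam x hx
    ext m
    change x • idemMul D lam m = 0
    induction m using Udot.induction with
    | h0 => rw [map_zero, smul_zero]
    | hadd a b ha hb => rw [map_add, smul_add, ha, hb, add_zero]
    | hsym η y =>
      rw [idemMul_sym, ← map_smul]
      exact sym_eq_zero D (mul_comp_mem_wtIdeal D lam η hx y))

theorem mulHom_sym_sym (lam η : X) (x y : U D) :
    mulHom D (sym D lam x) (sym D η y) = sym D η (x * comp D (lam - η) y) := by
  rw [mulHom, Udot.lift_sym]
  change x • idemMul D lam (sym D η y) = _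
  rw [idemMul_sym, ← map_smul]
  rfl

theorem mulHom_assoc (a b c : Udot D) :
    mulHom D (mulHom D a b) c = mulHom D a (mulHom D b c) := by
  induction a using Udot.induction with
  | h0 => simp
  | hadd a a' ha ha' => simp only [map_add, LinearMap.add_apply, ha, ha']
  | hsym lam x =>
    induction b using Udot.induction with
    | h0 => simp
    | hadd a a' ha ha' => simp only [map_add, LinearMap.add_apply, ha, ha']
    | hsym mu y =>
      induction c using Udot.induction with
      | h0 => simp
      | hadd a a' ha ha' => simp only [map_add, LinearMap.add_apply, ha, ha']
      | hsym eta z =>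
        rw [mulHom_sym_sym, mulHom_sym_sym, mulHom_sym_sym, mulHom_sym_sym,
          comp_mul_of_hasWeight D (hasWeight_comp D _ _), mul_assoc, sub_sub_sub_cancel_right]

instance : NonUnitalRing (Udot D) :=
  { (inferInstance : AddCommGroup (Udot D)) with
    mul := fun a b => mulHom D a b
    left_distrib := fun a b c => map_add (mulHom D a) b c
    right_distrib := fun a b c => by
      change mulHom D (a + b) c = mulHom D a c + mulHom D b c
      rw [map_add, LinearMap.add_apply]
    zero_mul := fun a => by
      change mulHom D 0 a = 0
      rw [map_zero, LinearMap.zero_apply]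
    mul_zero := fun a => map_zero (mulHom D a)
    mul_assoc := mulHom_assoc D }

instance : IsScalarTower Qvpi (Udot D) (Udot D) :=
  ⟨fun r a b => by
    change mulHom D (r • a) b = r • mulHom D a b
    rw [map_smul, LinearMap.smul_apply]⟩

instance : SMulCommClass Qvpi (Udot D) (Udot D) :=
  ⟨fun r a b => (map_smul (mulHom D a) r b).symm⟩

/-- The idempotent `1_λ` of `𝐔̇`. -/
def idem (lam : X) : Udot D := sym D lam 1

/-- `(x 1_λ)(y 1_η) = (x y) 1_η` if `y` has weight `λ - η`. -/
theorem sym_mul_sym {lam η : X} (x y : U D) (hy : HasWeight D (lam - η) y) :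
    sym D lam x * sym D η y = sym D η (x * y) := by
  classical
  refine (mulHom_sym_sym D lam η x y).trans ?_
  rw [comp_of_decomp_eq hy.decomp_eq, if_pos rfl]

/-- `(x 1_λ)(y 1_η) = 0` if `y` has a weight different from `λ - η`. -/
theorem sym_mul_sym_of_ne {lam η ζ : X} (x y : U D) (hy : HasWeight D ζ y) (h : ζ ≠ lam - η) :
    sym D lam x * sym D η y = 0 := by
  classical
  refine (mulHom_sym_sym D lam η x y).trans ?_
  rw [comp_of_decomp_eq hy.decomp_eq, if_neg h, mul_zero, map_zero]

theorem K_smul_idem (ν : Y) (lam : X) :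
    gen D (.K ν) • idem D lam = ((vU ^ D.pairing ν lam : Qvpiˣ) : Qvpi) • idem D lam := by
  rw [idem, ← algebraMap_smul (U D) ((vU ^ D.pairing ν lam : Qvpiˣ) : Qvpi), ← map_smul,
    ← map_smul, ← sub_eq_zero, ← map_sub, ← sub_smul]
  refine sym_eq_zero D ?_
  rw [smul_eq_mul, mul_one]
  exact Submodule.subset_span (Or.inl ⟨ν, rfl⟩)

theorem J_smul_idem (ν : Y) (lam : X) :
    gen D (.J ν) • idem D lam = ((piU ^ D.pairing ν lam : Qvpiˣ) : Qvpi) • idem D lam := by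
  rw [idem, ← algebraMap_smul (U D) ((piU ^ D.pairing ν lam : Qvpiˣ) : Qvpi), ← map_smul,
    ← map_smul, ← sub_eq_zero, ← map_sub, ← sub_smul]
  refine sym_eq_zero D ?_
  rw [smul_eq_mul, mul_one]
  exact Submodule.subset_span (Or.inr ⟨ν, rfl⟩)

end Covering

end

end QCov

/-!
The standard form on `𝐟` is built by recursion on the first variable: `(1, y) = ε(y)` and
`(θ_i x, y) = (θ_i, θ_i) (x, _i r(y))`, where `_i r` is the left skew derivation defined by
`r(y) = θ_i ⊗ _i r(y) + ⋯`. It lives on `𝐟` in the second variable because the skew derivations `_k r`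
and `r_k` kill the Serre elements (`freeDer_left_serre`, `freeDer_right_serre`). This is a
computation with `π`-quantum binomials: the two-term recursion `serreCoeff_succ` for the Serre
coefficients, and the vanishing of an alternating sum, obtained by telescoping
(`sum_serreCoeff_mul_tw`). The form is symmetric (`preForm_symm`), so that it lives on `𝐟` in the
first variable, too. Uniqueness holds because the axioms force `(1, θ_i) = 2 (1, θ_i)`, hence
`(1, θ_i) = 0`, and `r` reduces all other values to those on generators.

A pairing on `𝐔̇` with the required properties is block diagonal, and on the block `𝐔 1_λ` it is
`(x 1_λ, y 1_λ) = φ_λ(τ₁(x) y)` with `φ_λ(u) = (1_λ, u 1_λ)`. As `𝐔 1_λ` is spanned by the elements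
`τ₁(x⁻) y⁻ 1_λ` with `x, y ∈ 𝐟` (`mem_stdSpan`), and `φ_λ(τ₁(x⁻) y⁻) = (x, y)`, the functional `φ_λ`
and the pairing are unique. For existence it remains to see that this prescription defines `φ_λ`.
For this purpose `𝐔` is made to act on `𝐟 ⊗ 𝐟`, with `x ⊗ y` in the role of `τ₁(x⁻) y⁻ 1_λ`
(`rep`): then `φ_λ(u)` is the value of the standard form on `u (1 ⊗ 1)`. In this action
`τ₁(F_i) = v_i⁻¹ K̃_i E_i` is right multiplication by `θ_i` on the first factor, and `F_j` is given by
an explicit formula in terms of `_j r` and `r_j` (`lowerOp`), dictated by the relation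
`τ₁(F_i) F_j - π^{p(i) p(j)} v^{- i · j} F_j τ₁(F_i) = δ_{ij} (θ_i, θ_i) (1 - J̃_i K̃_i²)`.
The Serre relations for the `F_j` hold since the Serre elements commute with all `τ₁(F_i)` up to
scalars, again because the skew derivations kill them, and annihilate `1 ⊗ 𝐟` (`serre_lowerOp`).
Finally `φ_λ ∘ τ₁ = φ_λ`, because this holds on the spanning set by the symmetry of the standard form
(`phi_tau`); this gives the symmetry of the pairing and its independence of the choice of `x`.
-/

namespace QCov

noncomputable section

/-! ### Skew derivations of the free algebra -/

section Free

variable {I : Type*}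

/-- The automorphism `θ_j ↦ c_j θ_j` of the free algebra. -/
def freeScale (c : I → Qvpiˣ) : FreeAlgebra Qvpi I →ₐ[Qvpi] FreeAlgebra Qvpi I :=
  FreeAlgebra.lift Qvpi fun j => ((c j : Qvpiˣ) : Qvpi) • FreeAlgebra.ι Qvpi j

@[simp]
theorem freeScale_ι (c : I → Qvpiˣ) (j : I) :
    freeScale c (FreeAlgebra.ι Qvpi j) = ((c j : Qvpiˣ) : Qvpi) • FreeAlgebra.ι Qvpi j := by
  simp [freeScale]

open scoped Classical in
/-- The matrix of the generator `θ_i` in an algebra with elements `x i`: the algebra homomorphism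
with these values on generators has the entries `c(y)`, `∂(y)`, `0`, `c'(y)`, where `∂` is the
skew derivation with `∂(x_i) = δ_{ik}` and `∂(y z) = c(y) ∂(z) + ∂(y) c'(z)`. -/
def derGen {A : Type*} [Ring A] [Algebra Qvpi A] (x : I → A) (c c' : I → Qvpiˣ) (k i : I) :
    Matrix (Fin 2) (Fin 2) A :=
  !![((c i : Qvpiˣ) : Qvpi) • x i, if i = k then 1 else 0; 0, ((c' i : Qvpiˣ) : Qvpi) • x i]

/-- The homomorphism to upper triangular matrices which encodes a skew derivation of the free
algebra. -/
def freeDerMat (c c' : I → Qvpiˣ) (k : I) :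
    FreeAlgebra Qvpi I →ₐ[Qvpi] Matrix (Fin 2) (Fin 2) (FreeAlgebra Qvpi I) :=
  FreeAlgebra.lift Qvpi (derGen (FreeAlgebra.ι Qvpi) c c' k)

/-- The skew derivation `∂` of the free algebra with `∂(θ_i) = δ_{ik}` and
`∂(y z) = c(y) ∂(z) + ∂(y) c'(z)`. -/
def freeDer (c c' : I → Qvpiˣ) (k : I) : FreeAlgebra Qvpi I →ₗ[Qvpi] FreeAlgebra Qvpi I :=
  (Matrix.entryLinearMap Qvpi (FreeAlgebra Qvpi I) 0 1).comp (freeDerMat c c' k).toLinearMap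

theorem freeDerMat_ι (c c' : I → Qvpiˣ) (k i : I) :
    freeDerMat c c' k (FreeAlgebra.ι Qvpi i) = derGen (FreeAlgebra.ι Qvpi) c c' k i := by
  simp [freeDerMat]

theorem freeDerMat_eq (c c' : I → Qvpiˣ) (k : I) (x : FreeAlgebra Qvpi I) :
    freeDerMat c c' k x = !![freeScale c x, freeDer c c' k x; 0, freeScale c' x] := by
  suffices H : freeDerMat c c' k x 0 0 = freeScale c x ∧ freeDerMat c c' k x 1 0 = 0 ∧
      freeDerMat c c' k x 1 1 = freeScale c' x by
    ext a b
    fin_cases a <;> fin_cases b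
    exacts [H.1, rfl, H.2.1, H.2.2]
  induction x using FreeAlgebra.induction with
  | grade0 r => simp [Matrix.algebraMap_matrix_apply]
  | grade1 i => simp [freeDerMat_ι, derGen]
  | mul a b ha hb =>
    simp only [map_mul, Matrix.mul_apply, Fin.sum_univ_two, ha.1, ha.2.1, ha.2.2, hb.1, hb.2.1,
      hb.2.2]
    simp
  | add a b ha hb => simp [ha.1, ha.2.1, ha.2.2, hb.1, hb.2.1, hb.2.2]

theorem freeDer_mul (c c' : I → Qvpiˣ) (k : I) (x y : FreeAlgebra Qvpi I) :
    freeDer c c' k (x * y) = freeScale c x * freeDer c c' k y + freeDer c c' k x * freeScale c' y := by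
  have h := congrFun (congrFun (map_mul (freeDerMat c c' k) x y) 0) 1
  rw [freeDerMat_eq, freeDerMat_eq c c' k x, freeDerMat_eq c c' k y] at h
  simpa [Matrix.mul_apply, Fin.sum_univ_two] using h

@[simp]
theorem freeDer_ι_self (c c' : I → Qvpiˣ) (k : I) :
    freeDer c c' k (FreeAlgebra.ι Qvpi k) = 1 := by
  simp [freeDer, freeDerMat_ι, derGen]

theorem freeDer_ι_ne (c c' : I → Qvpiˣ) {k i : I} (h : i ≠ k) :
    freeDer c c' k (FreeAlgebra.ι Qvpi i) = 0 := by
  simp [freeDer, freeDerMat_ι, derGen, h]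

@[simp]
theorem freeDer_one (c c' : I → Qvpiˣ) (k : I) : freeDer c c' k 1 = 0 := by
  simp [freeDer]

theorem freeDer_algebraMap (c c' : I → Qvpiˣ) (k : I) (r : Qvpi) :
    freeDer c c' k (algebraMap Qvpi _ r) = 0 := by
  rw [Algebra.algebraMap_eq_smul_one, map_smul, freeDer_one, smul_zero]

theorem freeScale_freeScale (c c' : I → Qvpiˣ) (x : FreeAlgebra Qvpi I) :
    freeScale c (freeScale c' x) = freeScale (c * c') x := by
  suffices H : (freeScale c).comp (freeScale c') = freeScale (c * c') from
    DFunLike.congr_fun H x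
  ext i
  simp [smul_smul, mul_comm]

@[simp]
theorem freeScale_one (x : FreeAlgebra Qvpi I) : freeScale 1 x = x := by
  suffices H : freeScale (1 : I → Qvpiˣ) = AlgHom.id Qvpi _ from DFunLike.congr_fun H x
  ext i
  simp

theorem freeDer_freeScale (s c c' : I → Qvpiˣ) (k : I) (x : FreeAlgebra Qvpi I) :
    freeDer c c' k (freeScale s x) =
      ((s k : Qvpiˣ) : Qvpi) • freeScale s (freeDer c c' k x) := by
  induction x using FreeAlgebra.induction with
  | grade0 r => rw [AlgHom.commutes, freeDer_algebraMap, map_zero, smul_zero]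
  | grade1 i =>
    by_cases h : i = k
    · subst h; simp
    · simp [freeDer_ι_ne c c' h]
  | mul a b ha hb =>
    simp only [map_mul, freeDer_mul, ha, hb, map_add, smul_add, mul_smul_comm, smul_mul_assoc,
      freeScale_freeScale, mul_comm]
  | add a b ha hb => simp [ha, hb]

theorem freeDer_pow_self (c c' : I → Qvpiˣ) (k : I) (n : ℕ) :
    freeDer c c' k (FreeAlgebra.ι Qvpi k ^ n) =
      (∑ l ∈ Finset.range n, ((c k : Qvpiˣ) : Qvpi) ^ l * ((c' k : Qvpiˣ) : Qvpi) ^ (n - 1 - l)) •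
        FreeAlgebra.ι Qvpi k ^ (n - 1) := by
  induction n with
  | zero => simp
  | succ n ih =>
    rw [pow_succ, freeDer_mul, freeDer_ι_self, ih, map_pow, freeScale_ι, freeScale_ι, smul_pow,
      mul_one, smul_mul_assoc, mul_smul_comm, smul_smul, Finset.sum_range_succ, add_comm, add_smul,
      Finset.sum_mul]
    congr 1
    · rcases n with _ | n
      · simp
      · rw [Nat.add_sub_cancel, Nat.add_sub_cancel, ← pow_succ]
        congr 1
        refine Finset.sum_congr rfl fun l hl => ?_
        have : l ≤ n := by have := Finset.mem_range.1 hl; omega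
        rw [mul_assoc, ← pow_succ, Nat.succ_sub this]
    · simp

theorem freeDer_pow_ne (c c' : I → Qvpiˣ) {k i : I} (h : i ≠ k) (n : ℕ) :
    freeDer c c' k (FreeAlgebra.ι Qvpi i ^ n) = 0 := by
  induction n with
  | zero => simp
  | succ n ih => rw [pow_succ, freeDer_mul, ih, freeDer_ι_ne c c' h, mul_zero, zero_mul, add_zero]

end Free

/-! ### Monomials in `π` and `v` -/

/-- The unit `π^a v^b`. -/
def piv (a b : ℤ) : Qvpiˣ := piU ^ a * vU ^ b

theorem piv_mul (a b a' b' : ℤ) : piv a b * piv a' b' = piv (a + a') (b + b') := by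
  rw [piv, piv, piv, zpow_add, zpow_add, mul_mul_mul_comm]

theorem piv_inv (a b : ℤ) : (piv a b)⁻¹ = piv (-a) (-b) := by
  rw [piv, piv, mul_inv, zpow_neg, zpow_neg]

theorem piv_pow (a b : ℤ) (n : ℕ) : piv a b ^ n = piv (n * a) (n * b) := by
  rw [piv, piv, mul_pow, ← zpow_natCast, ← zpow_natCast, ← zpow_mul, ← zpow_mul, mul_comm a,
    mul_comm b]

theorem one_eq_piv : (1 : Qvpiˣ) = piv 0 0 := by simp [piv]

theorem piU_zpow_eq_one {m : ℤ} (h : Even m) : piU ^ m = 1 := by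
  obtain ⟨r, rfl⟩ := h
  rw [zpow_add, ← mul_zpow, piU_mul_self, one_zpow]

theorem piv_congr {a a' b b' : ℤ} (ha : Even (a - a')) (hb : b = b') : piv a b = piv a' b' := by
  rw [piv, piv, hb, ← sub_add_cancel a a', zpow_add, piU_zpow_eq_one ha, one_mul]

section Datum

variable {I : Type*} (C : CartanDatum I)

/-- The coefficient `π^{p(i) p(j)} v^{- i · j}` of the twisted product. -/
def tw (i j : I) : Qvpiˣ := piU ^ (C.p i * C.p j) * vU ^ (-C.dot i j)

theorem tw_symm (i j : I) : tw C i j = tw C j i := by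
  rw [tw, tw, mul_comm (C.p i), C.dot_symm]

theorem twist_eq_freeScale (i : I) : twist C i = freeScale (tw C i) := rfl

theorem piU_pow_eq_piv (n : ℕ) : piU ^ n = piv n 0 := by simp [piv]

theorem tw_eq_piv (i j : I) : tw C i j = piv (C.p i * C.p j) (-C.dot i j) := by
  rw [tw, piv]; norm_cast

theorem vi_eq_piv (i : I) : vi C i = piv 0 (C.d i) := by simp [piv, vi]

theorem pii_eq_piv (i : I) : pii C i = piv (C.d i) 0 := by simp [piv, pii]

theorem even_dot (i j : I) : Even (C.dot i j) := by
  rw [← C.d_mul_a]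
  have h1 := C.bar_consistent i
  have h2 := C.p_lt_two i
  by_cases hp : C.p i = 1
  · exact (C.a_even_of_odd i j hp).mul_left _
  · have : Even (C.d i) := by rw [Nat.even_iff]; omega
    exact Even.mul_right (by exact_mod_cast this) _

theorem even_d_sub_p_mul_p (i : I) : Even ((C.d i : ℤ) - C.p i * C.p i) := by
  have h1 := C.bar_consistent i
  have h2 := C.p_lt_two i
  have h3 : C.p i = 0 ∨ C.p i = 1 := by omega
  rcases h3 with h | h <;> rw [h] at h1 ⊢ <;> rw [Int.even_iff] <;> omega

theorem even_d_sub_p (i : I) : Even ((C.d i : ℤ) - C.p i) := by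
  have h1 := C.bar_consistent i
  rw [Int.even_iff]; omega

theorem even_p_mul_bexp_sub {i j : I} (hij : i ≠ j) :
    Even ((C.p i : ℤ) * ((bexp C i j : ℤ) - 1)) := by
  have h2 := C.p_lt_two i
  by_cases hp : C.p i = 1
  · have := bexp_odd C hij hp
    refine Even.mul_left ?_ _
    rw [Int.even_iff]; omega
  · have : C.p i = 0 := by omega
    simp [this]

theorem bexp_cast {i j : I} (hij : i ≠ j) : (bexp C i j : ℤ) = 1 - C.a i j := by
  have := C.a_nonpos i j hij
  rw [bexp]; omega

theorem dot_eq_bexp {i j : I} (hij : i ≠ j) : C.dot i j = C.d i * (1 - (bexp C i j : ℤ)) := by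
  rw [bexp_cast C hij, ← C.d_mul_a]; ring

theorem tw_self_eq (i : I) : tw C i i = (pii C i * vi C i)⁻¹ * (vi C i)⁻¹ := by
  rw [tw_eq_piv, vi_eq_piv, pii_eq_piv, piv_mul, piv_inv, piv_inv, piv_mul, C.dot_self]
  refine piv_congr ?_ (by ring)
  obtain ⟨r, hr⟩ := even_d_sub_p_mul_p C i
  exact ⟨(C.d i : ℤ) - r, by linarith⟩

/-- With `t = π^{p(i) p(j)} v^{- i · j}` and `q = π_i v_i^{-2}`, the exponent `b` of the Serre relation
satisfies `t² q^{b-1} = 1`. -/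
theorem tw_sq_mul {i j : I} (hij : i ≠ j) {m : ℕ} (hm : bexp C i j = m + 1) :
    tw C i j ^ 2 * tw C i i ^ m = 1 := by
  rw [tw_eq_piv, tw_eq_piv, piv_pow, piv_pow, piv_mul, one_eq_piv]
  have h1 := dot_eq_bexp C hij
  have h2 := even_p_mul_bexp_sub C hij
  rw [hm] at h1 h2
  push_cast at h1 h2
  rw [add_sub_cancel_right] at h2
  refine piv_congr ?_ ?_
  · obtain ⟨r, hr⟩ := h2
    exact ⟨C.p i * C.p j + r * C.p i, by push_cast; linear_combination (C.p i : ℤ) * hr⟩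
  · rw [h1, C.dot_self]; push_cast; ring

/-- The `q`-integer `1 + q + ⋯ + q^{n-1}` for `q = π_i v_i^{-2}`. -/
def qint (i : I) (n : ℕ) : Qvpi := ∑ l ∈ Finset.range n, ((tw C i i : Qvpiˣ) : Qvpi) ^ l

theorem one_sub_tw_pow (i : I) (n : ℕ) : 1 - ((tw C i i : Qvpiˣ) : Qvpi) ^ n =
    (((pii C i * vi C i)⁻¹ ^ n : Qvpiˣ) : Qvpi) * qnum C i n := by
  rw [qnum, mul_sub, ← Units.val_mul, ← Units.val_mul, ← mul_pow, ← mul_pow, ← tw_self_eq]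
  simp

theorem qint_mul (i : I) (n : ℕ) : (1 - ((tw C i i : Qvpiˣ) : Qvpi)) * qint C i n =
    (((pii C i * vi C i)⁻¹ ^ n : Qvpiˣ) : Qvpi) * qnum C i n := by
  rw [qint, mul_neg_geom_sum, one_sub_tw_pow]

theorem isUnit_one_sub_tw (i : I) : IsUnit (1 - ((tw C i i : Qvpiˣ) : Qvpi)) := by
  have h := one_sub_tw_pow C i 1
  rw [pow_one] at h
  rw [h]
  exact (Units.isUnit _).mul (isUnit_qnum C i one_pos)

theorem isUnit_qint (i : I) {n : ℕ} (hn : 0 < n) : IsUnit (qint C i n) := by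
  have h : IsUnit ((1 - ((tw C i i : Qvpiˣ) : Qvpi)) * qint C i n) := by
    rw [qint_mul]
    exact (Units.isUnit _).mul (isUnit_qnum C i hn)
  exact isUnit_of_mul_isUnit_right h

theorem qbinom_succ_mul (i : I) {n k : ℕ} (hk : k < n) :
    qbinom C i n (k + 1) * qnum C i (k + 1) = qbinom C i n k * qnum C i (n - k) := by
  obtain ⟨m, rfl⟩ : ∃ m, n = m + 1 + k := ⟨n - k - 1, by omega⟩
  have h1 := qbinom_mul C i (n := m + 1 + k) (k := k) (by omega)
  have h2 := qbinom_mul C i (n := m + 1 + k) (k := k + 1) (by omega)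
  rw [show m + 1 + k - k = m + 1 by omega] at h1 ⊢
  rw [show m + 1 + k - (k + 1) = m by omega] at h2
  rw [Finset.prod_Icc_succ_top (by omega)] at h1 h2
  have hu : ∀ k, IsUnit (∏ m ∈ Finset.Icc 1 k, qnum C i m) := fun k =>
    (Finset.prod_induction _ IsUnit (fun _ _ => IsUnit.mul) isUnit_one
      fun m hm => isUnit_qnum C i (Finset.mem_Icc.1 hm).1)
  refine ((hu k).mul (hu m)).mul_right_cancel ?_
  linear_combination h2 - h1

/-- The ratio of two consecutive coefficients of the Serre relation, in terms of `q`-integers for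
`q = π_i v_i^{-2}`. -/
theorem serreCoeff_succ {i j : I} (hij : i ≠ j) {k : ℕ} (hk : k < bexp C i j) :
    serreCoeff C i j (k + 1) * qint C i (k + 1) =
      -(serreCoeff C i j k * qint C i (bexp C i j - k) *
        (((tw C i j : Qvpiˣ) : Qvpi) * ((tw C i i : Qvpiˣ) : Qvpi) ^ k)) := by
  have hq := qbinom_succ_mul C i hk
  refine (isUnit_one_sub_tw C i).mul_left_cancel ?_
  obtain ⟨m, hm⟩ : ∃ m, bexp C i j = m + 1 + k := ⟨bexp C i j - k - 1, by omega⟩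
  have h1 := dot_eq_bexp C hij
  have h2 := even_p_mul_bexp_sub C hij
  have hd := even_d_sub_p C i
  unfold serreCoeff
  rw [hm] at hq h1 h2 ⊢
  rw [show m + 1 + k - k = m + 1 by omega] at hq ⊢
  push_cast at h1 h2
  have hunit : piU ^ ((k + 1).choose 2 * C.p i + (k + 1) * C.p i * C.p j) *
      (pii C i * vi C i)⁻¹ ^ (k + 1) =
      piU ^ (k.choose 2 * C.p i + k * C.p i * C.p j) * (pii C i * vi C i)⁻¹ ^ (m + 1) *
        (tw C i j * tw C i i ^ k) := by
    rw [tw_self_eq, tw_eq_piv, vi_eq_piv, pii_eq_piv, piU_pow_eq_piv, piU_pow_eq_piv, h1]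
    simp only [piv_mul, piv_inv, piv_pow]
    refine piv_congr ?_ ?_
    · obtain ⟨r, hr⟩ := h2
      obtain ⟨s, hs⟩ := hd
      rw [Nat.choose_succ_succ' k 1, Nat.choose_one_right]
      refine ⟨r - k * s + (m + k) * s, ?_⟩
      have hs' : (C.d i : ℤ) = C.p i + (s + s) := by linarith
      push_cast
      rw [hs']
      linear_combination hr + 0 * hs
    · push_cast; ring
  have hunit' := congrArg (Units.val) hunit
  simp only [Units.val_mul, Units.val_pow_eq_pow_val] at hunit'
  have e1 := qint_mul C i (k + 1)
  have e2 := qint_mul C i (m + 1)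
  simp only [Units.val_mul, Units.val_pow_eq_pow_val] at e1 e2 ⊢
  generalize qint C i (k + 1) = a at *
  generalize qint C i (m + 1) = b at *
  generalize qbinom C i (m + 1 + k) (k + 1) = c at *
  generalize qbinom C i (m + 1 + k) k = c' at *
  linear_combination (-1) ^ (k + 1) * (piU : Qvpi) ^ ((k + 1).choose 2 * C.p i +
    (k + 1) * C.p i * C.p j) * c * e1 + (-1) ^ k * (piU : Qvpi) ^ (k.choose 2 * C.p i +
    k * C.p i * C.p j) * c' * ((tw C i j : Qvpiˣ) : Qvpi) * ((tw C i i : Qvpiˣ) : Qvpi) ^ k * e2 +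
    (-1) ^ (k + 1) * (piU : Qvpi) ^ ((k + 1).choose 2 * C.p i + (k + 1) * C.p i * C.p j) *
      (((pii C i * vi C i)⁻¹ : Qvpiˣ) : Qvpi) ^ (k + 1) * hq +
    (-1) ^ (k + 1) * c' * qnum C i (m + 1) * hunit'

end Datum

/-! ### The skew derivations kill the Serre relations -/

section Datum

variable {I : Type*} (C : CartanDatum I)

/-- The alternating sum `∑ (-1)^k π_i^{k(k-1)/2} v_i^{k(b-1)} [b choose k] = 0`, in the form in which
it occurs in the Serre relation. -/
theorem sum_serreCoeff_mul_tw {i j : I} (hij : i ≠ j) :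
    ∑ k ∈ Finset.range (bexp C i j + 1), serreCoeff C i j k * ((tw C i j : Qvpiˣ) : Qvpi) ^ k = 0 := by
  have hb : 0 < bexp C i j := by have := C.a_nonpos i j hij; rw [bexp]; omega
  obtain ⟨n, hn⟩ : ∃ n, bexp C i j = n + 1 := ⟨bexp C i j - 1, by omega⟩
  have htw := congrArg Units.val (tw_sq_mul C hij hn)
  simp only [Units.val_mul, Units.val_pow_eq_pow_val, Units.val_one] at htw
  -- Telescoping: `(b)_q a_k = H_{k+1} - H_k` with `H_m = -a_m (m)_q q^{b-m}`.
  have key : ∀ m ≤ n + 1, qint C i (n + 1) * ∑ k ∈ Finset.range m,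
      serreCoeff C i j k * ((tw C i j : Qvpiˣ) : Qvpi) ^ k =
      -(serreCoeff C i j m * ((tw C i j : Qvpiˣ) : Qvpi) ^ m * qint C i m *
        ((tw C i i : Qvpiˣ) : Qvpi) ^ (n + 1 - m)) := by
    intro m hm
    induction m with
    | zero => simp [qint]
    | succ m ih =>
      obtain ⟨l, rfl⟩ : ∃ l, n = m + l := ⟨n - m, by omega⟩
      have hs := serreCoeff_succ C hij (k := m) (by omega)
      rw [hn, show m + l + 1 - m = l + 1 by omega] at hs
      have hsplit : qint C i (m + l + 1) =
          qint C i (l + 1) + ((tw C i i : Qvpiˣ) : Qvpi) ^ (l + 1) * qint C i m := by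
        rw [qint, show m + l + 1 = (l + 1) + m by omega, Finset.sum_range_add, qint, qint,
          Finset.mul_sum]
        simp only [pow_add]
      rw [Finset.sum_range_succ, mul_add, ih (by omega), show m + l + 1 - m = l + 1 by omega,
        show m + l + 1 - (m + 1) = l by omega, hsplit]
      generalize qint C i (m + 1) = a at *
      generalize serreCoeff C i j (m + 1) = c at *
      generalize ((tw C i j : Qvpiˣ) : Qvpi) = t at *
      generalize ((tw C i i : Qvpiˣ) : Qvpi) = q at *
      linear_combination t ^ (m + 1) * q ^ l * hs -
        t ^ m * serreCoeff C i j m * qint C i (l + 1) * htw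
  refine (isUnit_qint C i (Nat.succ_pos n)).mul_left_cancel ?_
  rw [hn, Finset.sum_range_succ, mul_add, key _ le_rfl]
  simp only [Nat.succ_eq_add_one, Nat.sub_self, pow_zero]
  ring

theorem sum_serreCoeff_mul_tw_reverse {i j : I} (hij : i ≠ j) :
    ∑ k ∈ Finset.range (bexp C i j + 1),
      serreCoeff C i j k * ((tw C i j : Qvpiˣ) : Qvpi) ^ (bexp C i j - k) = 0 := by
  obtain ⟨c, hc⟩ := serreCoeff_symm C hij
  rw [← Finset.sum_range_reflect, ← mul_zero (c : Qvpi), ← sum_serreCoeff_mul_tw C hij,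
    Finset.mul_sum]
  refine Finset.sum_congr rfl fun k hk => ?_
  have hk' : k ≤ bexp C i j := by have := Finset.mem_range.1 hk; omega
  rw [Nat.add_sub_cancel, hc k hk', Nat.sub_sub_self hk', mul_assoc]

/-- The skew derivation with respect to `θ_i` maps the `k`-th term of the Serre element to a
combination of two words, which also arise from the neighbouring terms; `hpair` says that these
contributions cancel. -/
theorem freeDer_serre_of_pair (c c' : I → Qvpiˣ) {i j : I} (hij : i ≠ j)
    (hq : ∀ n, ∑ l ∈ Finset.range n,
      ((c i : Qvpiˣ) : Qvpi) ^ l * ((c' i : Qvpiˣ) : Qvpi) ^ (n - 1 - l) = qint C i n)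
    (hpair : ∀ k < bexp C i j,
      serreCoeff C i j (k + 1) * (((c i : Qvpiˣ) : Qvpi) ^ (bexp C i j - 1 - k) * (c j : Qvpi) *
        qint C i (k + 1)) +
      serreCoeff C i j k * (qint C i (bexp C i j - k) * ((c' j : Qvpi) *
        ((c' i : Qvpiˣ) : Qvpi) ^ k)) = 0) :
    freeDer c c' i (serre C (FreeAlgebra.ι Qvpi) i j) = 0 := by
  have hterm : ∀ k, freeDer c c' i (FreeAlgebra.ι Qvpi i ^ (bexp C i j - k) *
      FreeAlgebra.ι Qvpi j * FreeAlgebra.ι Qvpi i ^ k) =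
      (((c i : Qvpiˣ) : Qvpi) ^ (bexp C i j - k) * (c j : Qvpi) * qint C i k) •
        (FreeAlgebra.ι Qvpi i ^ (bexp C i j - k) * FreeAlgebra.ι Qvpi j *
          FreeAlgebra.ι Qvpi i ^ (k - 1)) +
      (qint C i (bexp C i j - k) * ((c' j : Qvpi) * ((c' i : Qvpiˣ) : Qvpi) ^ k)) •
        (FreeAlgebra.ι Qvpi i ^ (bexp C i j - k - 1) * FreeAlgebra.ι Qvpi j *
          FreeAlgebra.ι Qvpi i ^ k) := by
    intro k
    rw [freeDer_mul, freeDer_mul, freeDer_pow_self, freeDer_pow_self, freeDer_ι_ne _ _ hij.symm,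
      hq, hq, mul_zero, zero_add, map_mul, map_pow, map_pow, freeScale_ι, freeScale_ι, freeScale_ι,
      freeScale_ι]
    simp only [smul_pow, smul_mul_assoc, mul_smul_comm, smul_smul]
    congr 2 <;> ring
  rw [serre, map_sum]
  simp only [map_smul, hterm, smul_add, smul_smul]
  rw [Finset.sum_add_distrib, Finset.sum_range_succ', Finset.sum_range_succ]
  simp only [qint, Finset.range_zero, Finset.sum_empty, Nat.sub_self, mul_zero, zero_mul, zero_smul,
    add_zero]
  rw [← Finset.sum_add_distrib]
  refine Finset.sum_eq_zero fun k hk => ?_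
  have := hpair k (Finset.mem_range.1 hk)
  simp only [qint] at this
  rw [Nat.add_sub_cancel, Nat.sub_right_comm, ← Nat.sub_sub, Nat.sub_right_comm, ← add_smul, this,
    zero_smul]

theorem freeDer_left_serre_self {i j : I} (hij : i ≠ j) :
    freeDer (tw C i) 1 i (serre C (FreeAlgebra.ι Qvpi) i j) = 0 := by
  refine freeDer_serre_of_pair C _ _ hij (fun n => by simp [qint]) fun k hk => ?_
  have hs := serreCoeff_succ C hij hk
  obtain ⟨m, hm⟩ : ∃ m, bexp C i j = k + m + 1 := ⟨bexp C i j - k - 1, by omega⟩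
  have htw := congrArg Units.val (tw_sq_mul C hij hm)
  simp only [Units.val_mul, Units.val_pow_eq_pow_val, Units.val_one] at htw
  simp only [Pi.one_apply, Units.val_one, one_pow, mul_one]
  rw [show bexp C i j - k = m + 1 by omega] at hs ⊢
  rw [show bexp C i j - 1 - k = m by omega]
  linear_combination ((tw C i i : Qvpiˣ) : Qvpi) ^ m * ((tw C i j : Qvpiˣ) : Qvpi) * hs -
    serreCoeff C i j k * qint C i (m + 1) * htw

theorem freeDer_right_serre_self {i j : I} (hij : i ≠ j) :
    freeDer 1 (tw C i) i (serre C (FreeAlgebra.ι Qvpi) i j) = 0 := by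
  refine freeDer_serre_of_pair C _ _ hij (fun n => ?_) fun k hk => ?_
  · rw [qint, ← Finset.sum_range_reflect]
    refine Finset.sum_congr rfl fun l hl => ?_
    have hl' : l ≤ n - 1 := by have := Finset.mem_range.1 hl; omega
    simp [Nat.sub_sub_self hl']
  · have hs := serreCoeff_succ C hij hk
    simp only [Pi.one_apply, Units.val_one, one_pow, one_mul]
    linear_combination hs

theorem freeDer_serre_snd (c c' : I → Qvpiˣ) {i j : I} (hij : i ≠ j)
    (hsum : ∑ k ∈ Finset.range (bexp C i j + 1), serreCoeff C i j k *
      (((c i : Qvpiˣ) : Qvpi) ^ (bexp C i j - k) * ((c' i : Qvpiˣ) : Qvpi) ^ k) = 0) :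
    freeDer c c' j (serre C (FreeAlgebra.ι Qvpi) i j) = 0 := by
  have hterm : ∀ k ∈ Finset.range (bexp C i j + 1),
      freeDer c c' j (serreCoeff C i j k • (FreeAlgebra.ι Qvpi i ^ (bexp C i j - k) *
      FreeAlgebra.ι Qvpi j * FreeAlgebra.ι Qvpi i ^ k)) =
      (serreCoeff C i j k * (((c i : Qvpiˣ) : Qvpi) ^ (bexp C i j - k) *
        ((c' i : Qvpiˣ) : Qvpi) ^ k)) • FreeAlgebra.ι Qvpi i ^ bexp C i j := by
    intro k hk
    have hk' : k ≤ bexp C i j := by have := Finset.mem_range.1 hk; omega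
    rw [map_smul, freeDer_mul, freeDer_mul, freeDer_pow_ne _ _ hij, freeDer_pow_ne _ _ hij,
      freeDer_ι_self, mul_zero, zero_add, zero_mul, add_zero, mul_one, map_pow, map_pow,
      freeScale_ι, freeScale_ι]
    simp only [smul_pow, smul_mul_assoc, mul_smul_comm, smul_smul, ← pow_add,
      Nat.sub_add_cancel hk']
    congr 1; ring
  rw [serre, map_sum, Finset.sum_congr rfl hterm, ← Finset.sum_smul, hsum, zero_smul]

theorem freeDer_serre_ne (c c' : I → Qvpiˣ) {k i j : I} (hi : i ≠ k) (hj : j ≠ k) :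
    freeDer c c' k (serre C (FreeAlgebra.ι Qvpi) i j) = 0 := by
  rw [serre, map_sum]
  refine Finset.sum_eq_zero fun l _ => ?_
  rw [map_smul, freeDer_mul, freeDer_mul, freeDer_pow_ne _ _ hi, freeDer_pow_ne _ _ hi,
    freeDer_ι_ne _ _ hj]
  simp

theorem freeDer_left_serre (k : I) {i j : I} (hij : i ≠ j) :
    freeDer (tw C k) 1 k (serre C (FreeAlgebra.ι Qvpi) i j) = 0 := by
  by_cases hi : i = k
  · subst hi
    exact freeDer_left_serre_self C hij
  by_cases hj : j = k
  · subst hj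
    refine freeDer_serre_snd C _ _ hij ?_
    simpa [tw_symm C j i] using sum_serreCoeff_mul_tw_reverse C hij
  exact freeDer_serre_ne C _ _ hi hj

theorem freeDer_right_serre (k : I) {i j : I} (hij : i ≠ j) :
    freeDer 1 (tw C k) k (serre C (FreeAlgebra.ι Qvpi) i j) = 0 := by
  by_cases hi : i = k
  · subst hi
    exact freeDer_right_serre_self C hij
  by_cases hj : j = k
  · subst hj
    refine freeDer_serre_snd C _ _ hij ?_
    simpa [tw_symm C j i] using sum_serreCoeff_mul_tw C hij
  exact freeDer_serre_ne C _ _ hi hj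

theorem freeScale_serre (c : I → Qvpiˣ) (i j : I) :
    freeScale c (serre C (FreeAlgebra.ι Qvpi) i j) =
      ((c i ^ bexp C i j * c j : Qvpiˣ) : Qvpi) • serre C (FreeAlgebra.ι Qvpi) i j := by
  rw [map_serre, serre, serre, Finset.smul_sum]
  refine Finset.sum_congr rfl fun k hk => ?_
  have hk' : k ≤ bexp C i j := by have := Finset.mem_range.1 hk; omega
  simp only [freeScale_ι, smul_pow, smul_mul_assoc, mul_smul_comm, smul_smul]
  congr 1
  obtain ⟨m, hm⟩ : ∃ m, bexp C i j = m + k := ⟨bexp C i j - k, by omega⟩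
  rw [hm, Nat.add_sub_cancel]
  push_cast
  ring

end Datum

/-! ### Skew derivations of `𝐟` -/

section Datum

variable {I : Type*} (C : CartanDatum I)

theorem Half.mk_surjective : Function.Surjective (Half.mk C) :=
  RingQuot.mkAlgHom_surjective Qvpi (FRel C)

@[simp]
theorem Half.mk_ι (i : I) : Half.mk C (FreeAlgebra.ι Qvpi i) = Half.θ C i := rfl

theorem Half.mk_serre {i j : I} (h : i ≠ j) :
    Half.mk C (serre C (FreeAlgebra.ι Qvpi) i j) = 0 := by
  rw [map_serre]
  exact Half.serre_eq_zero C h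

/-- Induction on words, with letters added on the left. -/
theorem freeAlgebra_induction_left {P : FreeAlgebra Qvpi I → Prop} (h1 : P 1)
    (hsmul : ∀ (r : Qvpi) x, P x → P (r • x)) (hadd : ∀ x y, P x → P y → P (x + y))
    (hmul : ∀ i x, P x → P (FreeAlgebra.ι Qvpi i * x)) (x : FreeAlgebra Qvpi I) : P x := by
  suffices H : ∀ w, P w → P (x * w) by simpa using H 1 h1
  induction x using FreeAlgebra.induction with
  | grade0 r => intro w hw; rw [← Algebra.smul_def]; exact hsmul r w hw
  | grade1 i => exact hmul i
  | mul a b ha hb => intro w hw; rw [mul_assoc]; exact ha _ (hb _ hw)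
  | add a b ha hb => intro w hw; rw [add_mul]; exact hadd _ _ (ha _ hw) (hb _ hw)

variable {C} in
/-- Induction on words, with letters added on the right. -/
theorem Half.induction_right {P : Half C → Prop} (h1 : P 1)
    (hsmul : ∀ (r : Qvpi) x, P x → P (r • x)) (hadd : ∀ x y, P x → P y → P (x + y))
    (hmul : ∀ i x, P x → P (x * Half.θ C i)) (x : Half C) : P x := by
  obtain ⟨x, rfl⟩ := Half.mk_surjective C x
  suffices H : ∀ w, P w → P (w * Half.mk C x) by simpa using H 1 h1
  induction x using FreeAlgebra.induction with
  | grade0 r =>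
    intro w hw
    rw [AlgHom.commutes, ← Algebra.commutes, ← Algebra.smul_def]
    exact hsmul r w hw
  | grade1 i => exact hmul i
  | mul a b ha hb => intro w hw; rw [map_mul, ← mul_assoc]; exact hb _ (ha _ hw)
  | add a b ha hb => intro w hw; rw [map_add, mul_add]; exact hadd _ _ (ha _ hw) (hb _ hw)

theorem serre_smul_θ (c : I → Qvpiˣ) {i j : I} (h : i ≠ j) :
    serre C (fun i => ((c i : Qvpiˣ) : Qvpi) • Half.θ C i) i j = 0 := by
  have e : (fun i => ((c i : Qvpiˣ) : Qvpi) • Half.θ C i) =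
      fun i => (Half.mk C).comp (freeScale c) (FreeAlgebra.ι Qvpi i) := by
    funext i
    simp
  rw [e, ← map_serre, AlgHom.comp_apply, freeScale_serre, map_smul, Half.mk_serre C h, smul_zero]

/-- The automorphism `θ_j ↦ c_j θ_j` of `𝐟`. -/
def Half.scale (c : I → Qvpiˣ) : Half C →ₐ[Qvpi] Half C :=
  Half.lift C (fun j => ((c j : Qvpiˣ) : Qvpi) • Half.θ C j) fun _ _ => serre_smul_θ C c

variable {C}

@[simp]
theorem Half.scale_θ (c : I → Qvpiˣ) (i : I) :
    Half.scale C c (Half.θ C i) = ((c i : Qvpiˣ) : Qvpi) • Half.θ C i := Half.lift_θ C _ _ i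

theorem Half.scale_mk (c : I → Qvpiˣ) (x : FreeAlgebra Qvpi I) :
    Half.scale C c (Half.mk C x) = Half.mk C (freeScale c x) := by
  suffices H : (Half.scale C c).comp (Half.mk C) = (Half.mk C).comp (freeScale c) from
    DFunLike.congr_fun H x
  ext i
  simp

theorem Half.scale_scale (c c' : I → Qvpiˣ) (x : Half C) :
    Half.scale C c (Half.scale C c' x) = Half.scale C (c * c') x := by
  obtain ⟨x, rfl⟩ := Half.mk_surjective C x
  simp only [Half.scale_mk, freeScale_freeScale]

@[simp]
theorem Half.scale_one (x : Half C) : Half.scale C 1 x = x := by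
  obtain ⟨x, rfl⟩ := Half.mk_surjective C x
  rw [Half.scale_mk, freeScale_one]

theorem map_derGen {A B : Type*} [Ring A] [Algebra Qvpi A] [Ring B] [Algebra Qvpi B]
    (φ : A →ₐ[Qvpi] B) (x : I → A) (c c' : I → Qvpiˣ) (k i : I) :
    φ.mapMatrix (derGen x c c' k i) = derGen (fun i => φ (x i)) c c' k i := by
  ext a b
  fin_cases a <;> fin_cases b <;> simp [derGen, apply_ite φ]

theorem serre_derGen_θ {c c' : I → Qvpiˣ} {k : I}
    (hS : ∀ i j, i ≠ j → freeDer c c' k (serre C (FreeAlgebra.ι Qvpi) i j) = 0) {i j : I}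
    (h : i ≠ j) : serre C (derGen (Half.θ C) c c' k) i j = 0 := by
  have e : derGen (Half.θ C) c c' k =
      fun i => ((Half.mk C).mapMatrix.comp (freeDerMat c c' k)) (FreeAlgebra.ι Qvpi i) := by
    funext i
    rw [AlgHom.comp_apply, freeDerMat_ι, map_derGen]
    rfl
  rw [e, ← map_serre, AlgHom.comp_apply, freeDerMat_eq, hS i j h, freeScale_serre,
    freeScale_serre]
  ext a b
  fin_cases a <;> fin_cases b <;> simp [Half.mk_serre C h]

/-- The skew derivation of `𝐟` induced by a skew derivation of the free algebra which kills the
Serre relations. -/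
def Half.der {c c' : I → Qvpiˣ} {k : I}
    (hS : ∀ i j, i ≠ j → freeDer c c' k (serre C (FreeAlgebra.ι Qvpi) i j) = 0) :
    Half C →ₗ[Qvpi] Half C :=
  (Matrix.entryLinearMap Qvpi (Half C) 0 1).comp
    (Half.lift C (derGen (Half.θ C) c c' k) fun _ _ => serre_derGen_θ hS).toLinearMap

theorem Half.der_mk {c c' : I → Qvpiˣ} {k : I}
    (hS : ∀ i j, i ≠ j → freeDer c c' k (serre C (FreeAlgebra.ι Qvpi) i j) = 0)
    (x : FreeAlgebra Qvpi I) : Half.der hS (Half.mk C x) = Half.mk C (freeDer c c' k x) := by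
  have H : (Half.lift C (derGen (Half.θ C) c c' k) fun _ _ => serre_derGen_θ hS).comp (Half.mk C) =
      (Half.mk C).mapMatrix.comp (freeDerMat c c' k) := by
    apply FreeAlgebra.hom_ext
    funext i
    simp only [Function.comp_apply, AlgHom.comp_apply, freeDerMat_ι, map_derGen, Half.mk_ι]
    exact Half.lift_θ C _ _ i
  exact congrFun (congrFun (DFunLike.congr_fun H x) 0) 1

variable (C)

/-- The skew derivation `_k r` of `𝐟`: `r(x) = θ_k ⊗ _k r(x) + ⋯`. -/
def derL (k : I) : Half C →ₗ[Qvpi] Half C :=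
  Half.der (c := tw C k) (c' := 1) (k := k) fun _ _ => freeDer_left_serre C k

/-- The skew derivation `r_k` of `𝐟`: `r(x) = r_k(x) ⊗ θ_k + ⋯`. -/
def derR (k : I) : Half C →ₗ[Qvpi] Half C :=
  Half.der (c := 1) (c' := tw C k) (k := k) fun _ _ => freeDer_right_serre C k

theorem derL_mk (k : I) (x : FreeAlgebra Qvpi I) :
    derL C k (Half.mk C x) = Half.mk C (freeDer (tw C k) 1 k x) := Half.der_mk _ x

theorem derR_mk (k : I) (x : FreeAlgebra Qvpi I) :
    derR C k (Half.mk C x) = Half.mk C (freeDer 1 (tw C k) k x) := Half.der_mk _ x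

theorem derL_mul (k : I) (x y : Half C) :
    derL C k (x * y) = Half.scale C (tw C k) x * derL C k y + derL C k x * y := by
  obtain ⟨x, rfl⟩ := Half.mk_surjective C x
  obtain ⟨y, rfl⟩ := Half.mk_surjective C y
  rw [← map_mul, derL_mk, freeDer_mul, map_add, map_mul, map_mul, ← Half.scale_mk, ← Half.scale_mk,
    Half.scale_one, ← derL_mk, ← derL_mk]

theorem derR_mul (k : I) (x y : Half C) :
    derR C k (x * y) = x * derR C k y + derR C k x * Half.scale C (tw C k) y := by
  obtain ⟨x, rfl⟩ := Half.mk_surjective C x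
  obtain ⟨y, rfl⟩ := Half.mk_surjective C y
  rw [← map_mul, derR_mk, freeDer_mul, map_add, map_mul, map_mul, ← Half.scale_mk, ← Half.scale_mk,
    Half.scale_one, ← derR_mk, ← derR_mk]

@[simp]
theorem derL_one (k : I) : derL C k 1 = 0 := by
  rw [← map_one (Half.mk C), derL_mk, freeDer_one, map_zero]

@[simp]
theorem derR_one (k : I) : derR C k 1 = 0 := by
  rw [← map_one (Half.mk C), derR_mk, freeDer_one, map_zero]

open scoped Classical in
theorem derL_θ (k i : I) : derL C k (Half.θ C i) = if i = k then 1 else 0 := by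
  rw [← Half.mk_ι, derL_mk]
  split_ifs with h
  · subst h; simp
  · rw [freeDer_ι_ne _ _ h, map_zero]

open scoped Classical in
theorem derR_θ (k i : I) : derR C k (Half.θ C i) = if i = k then 1 else 0 := by
  rw [← Half.mk_ι, derR_mk]
  split_ifs with h
  · subst h; simp
  · rw [freeDer_ι_ne _ _ h, map_zero]

theorem derL_scale (s : I → Qvpiˣ) (k : I) (x : Half C) :
    derL C k (Half.scale C s x) = ((s k : Qvpiˣ) : Qvpi) • Half.scale C s (derL C k x) := by
  obtain ⟨x, rfl⟩ := Half.mk_surjective C x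
  rw [Half.scale_mk, derL_mk, freeDer_freeScale, map_smul, derL_mk, Half.scale_mk]

theorem derR_scale (s : I → Qvpiˣ) (k : I) (x : Half C) :
    derR C k (Half.scale C s x) = ((s k : Qvpiˣ) : Qvpi) • Half.scale C s (derR C k x) := by
  obtain ⟨x, rfl⟩ := Half.mk_surjective C x
  rw [Half.scale_mk, derR_mk, freeDer_freeScale, map_smul, derR_mk, Half.scale_mk]

end Datum

/-! ### The standard form on `𝐟` -/

section Datum

variable {I : Type*} (C : CartanDatum I)

/-- The norm `(θ_i, θ_i) = (1 - π_i v_i²)⁻¹`. -/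
def normθ (i : I) : Qvpi := Ring.inverse (1 - ((pii C i * vi C i ^ 2 : Qvpiˣ) : Qvpi))

theorem serre_zero (i j : I) : serre C (fun _ => (0 : Qvpi)) i j = 0 := by
  simp [serre]

/-- The counit `θ_i ↦ 0` of `𝐟`. -/
def Half.counit : Half C →ₐ[Qvpi] Qvpi := Half.lift C (fun _ => 0) fun i j _ => serre_zero C i j

@[simp]
theorem Half.counit_θ (i : I) : Half.counit C (Half.θ C i) = 0 := Half.lift_θ C _ _ i

/-- The anti-homomorphism `θ_i ↦ (θ_i, θ_i) _i r`: it sends `x` to the adjoint of left multiplication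
by `x`. -/
def formOp : FreeAlgebra Qvpi I →ₐ[Qvpi] (Module.End Qvpi (Half C))ᵐᵒᵖ :=
  FreeAlgebra.lift Qvpi fun i => MulOpposite.op (normθ C i • derL C i)

/-- The standard form, with the first variable in the free algebra. -/
def preForm : FreeAlgebra Qvpi I →ₗ[Qvpi] Half C →ₗ[Qvpi] Qvpi :=
  LinearMap.mk₂ Qvpi (fun x y => Half.counit C ((formOp C x).unop y)) (by simp) (by simp) (by simp)
    (by simp)

theorem preForm_one (y : Half C) : preForm C 1 y = Half.counit C y := by
  simp [preForm]

theorem preForm_ι_mul (i : I) (x : FreeAlgebra Qvpi I) (y : Half C) :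
    preForm C (FreeAlgebra.ι Qvpi i * x) y = normθ C i * preForm C x (derL C i y) := by
  simp [preForm, formOp]

theorem derL_θ_mul (k i : I) (x : Half C) [Decidable (i = k)] :
    derL C k (Half.θ C i * x) = ((tw C k i : Qvpiˣ) : Qvpi) • (Half.θ C i * derL C k x) +
      if i = k then x else 0 := by
  rw [derL_mul, Half.scale_θ, derL_θ, smul_mul_assoc]
  split_ifs <;> simp

theorem freeDer_ι_mul (k i : I) (x : FreeAlgebra Qvpi I) [Decidable (i = k)] :
    freeDer (tw C k) 1 k (FreeAlgebra.ι Qvpi i * x) =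
      ((tw C k i : Qvpiˣ) : Qvpi) • (FreeAlgebra.ι Qvpi i * freeDer (tw C k) 1 k x) +
      if i = k then x else 0 := by
  rw [freeDer_mul, freeScale_ι, smul_mul_assoc, freeScale_one]
  split_ifs with h
  · subst h; simp
  · simp [freeDer_ι_ne _ _ h]

/-- Left multiplication by `θ_i` is adjoint to `(θ_i, θ_i) _i r` in the second variable, too. -/
theorem preForm_θ_mul (i : I) (x : FreeAlgebra Qvpi I) (y : Half C) :
    preForm C x (Half.θ C i * y) = normθ C i * preForm C (freeDer (tw C i) 1 i x) y := by
  classical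
  induction x using freeAlgebra_induction_left generalizing y with
  | h1 => simp [preForm_one]
  | hsmul r x hx => simp only [map_smul, LinearMap.smul_apply, hx, smul_eq_mul]; ring
  | hadd x x' hx hx' => simp only [map_add, LinearMap.add_apply, hx, hx', mul_add]
  | hmul j x hx =>
    rw [preForm_ι_mul, derL_θ_mul, freeDer_ι_mul, map_add, map_add, map_smul, map_smul, hx,
      LinearMap.add_apply, LinearMap.smul_apply, preForm_ι_mul, tw_symm C i j]
    by_cases h : i = j
    · subst h; simp only [if_true, smul_eq_mul]
    · rw [if_neg h, if_neg (Ne.symm h), map_zero, map_zero]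
      simp only [LinearMap.zero_apply, smul_eq_mul]; ring

theorem preForm_one_right (x : FreeAlgebra Qvpi I) :
    preForm C x 1 = Half.counit C (Half.mk C x) := by
  induction x using freeAlgebra_induction_left with
  | h1 => simp [preForm_one]
  | hsmul r x hx => simp [hx]
  | hadd x x' hx hx' => simp [hx, hx']
  | hmul j x hx => simp [preForm_ι_mul]

theorem preForm_symm (x y : FreeAlgebra Qvpi I) :
    preForm C x (Half.mk C y) = preForm C y (Half.mk C x) := by
  induction x using freeAlgebra_induction_left generalizing y with
  | h1 => rw [preForm_one, map_one, preForm_one_right]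
  | hsmul r x hx => simp [hx]
  | hadd x x' hx hx' => simp [hx, hx']
  | hmul j x hx => rw [preForm_ι_mul, derL_mk, hx, map_mul, Half.mk_ι, preForm_θ_mul]

theorem preForm_eq_zero {x : FreeAlgebra Qvpi I} (hx : Half.mk C x = 0) : preForm C x = 0 := by
  ext y
  obtain ⟨y, rfl⟩ := Half.mk_surjective C y
  rw [preForm_symm, hx, map_zero, LinearMap.zero_apply]

/-- The standard form on `𝐟`. -/
def stdForm : Half C →ₗ[Qvpi] Half C →ₗ[Qvpi] Qvpi :=
  ((LinearMap.ker (Half.mk C).toLinearMap).liftQ (preForm C) fun _ hx => preForm_eq_zero C hx).comp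
    ((Half.mk C).toLinearMap.quotKerEquivOfSurjective (Half.mk_surjective C)).symm.toLinearMap

theorem stdForm_mk (x : FreeAlgebra Qvpi I) (y : Half C) :
    stdForm C (Half.mk C x) y = preForm C x y := by
  have h : ((Half.mk C).toLinearMap.quotKerEquivOfSurjective (Half.mk_surjective C)).symm
      (Half.mk C x) = (LinearMap.ker (Half.mk C).toLinearMap).mkQ x := by
    rw [LinearEquiv.symm_apply_eq]
    rfl
  rw [stdForm, LinearMap.comp_apply, LinearEquiv.coe_coe, h]
  rfl

theorem stdForm_symm (x y : Half C) : stdForm C x y = stdForm C y x := by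
  obtain ⟨x, rfl⟩ := Half.mk_surjective C x
  obtain ⟨y, rfl⟩ := Half.mk_surjective C y
  rw [stdForm_mk, stdForm_mk, preForm_symm]

theorem stdForm_one (y : Half C) : stdForm C 1 y = Half.counit C y := by
  rw [← map_one (Half.mk C), stdForm_mk, preForm_one]

theorem stdForm_θ_mul (i : I) (x y : Half C) :
    stdForm C (Half.θ C i * x) y = normθ C i * stdForm C x (derL C i y) := by
  obtain ⟨x, rfl⟩ := Half.mk_surjective C x
  rw [← Half.mk_ι, ← map_mul, stdForm_mk, stdForm_mk, preForm_ι_mul]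

theorem Half.counit_scale (s : I → Qvpiˣ) (x : Half C) :
    Half.counit C (Half.scale C s x) = Half.counit C x := by
  induction x using Half.induction_right with
  | h1 => simp
  | hsmul r x hx => simp [hx]
  | hadd x x' hx hx' => simp [hx, hx']
  | hmul j x hx => simp

theorem stdForm_scale (s : I → Qvpiˣ) (x y : Half C) :
    stdForm C (Half.scale C s x) y = stdForm C x (Half.scale C s y) := by
  obtain ⟨x, rfl⟩ := Half.mk_surjective C x
  induction x using freeAlgebra_induction_left generalizing y with
  | h1 => rw [map_one, map_one, stdForm_one, stdForm_one, Half.counit_scale]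
  | hsmul r x hx => simp [hx]
  | hadd x x' hx hx' => simp [hx, hx']
  | hmul j x hx =>
    rw [map_mul, map_mul, Half.mk_ι, Half.scale_θ, smul_mul_assoc, map_smul, LinearMap.smul_apply,
      stdForm_θ_mul, hx, stdForm_θ_mul, derL_scale, map_smul, smul_eq_mul, smul_eq_mul]
    ring

theorem coprod_ι_mul (i : I) (x : FreeAlgebra Qvpi I) :
    coprod C (FreeAlgebra.ι Qvpi i * x) = coprodGen C i (coprod C x) := by
  simp [coprod]

theorem coprod_one : coprod C 1 = 1 ⊗ₜ 1 := by
  simp [coprod]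

theorem coprodHalf_one : coprodHalf C 1 = 1 ⊗ₜ 1 := by
  simp [coprodHalf, coprod_one]

theorem coprodHalf_ι_mul (i : I) (x : FreeAlgebra Qvpi I) :
    coprodHalf C (FreeAlgebra.ι Qvpi i * x) =
      TensorProduct.map (LinearMap.mulLeft Qvpi (Half.θ C i)) LinearMap.id (coprodHalf C x) +
      TensorProduct.map (Half.scale C (tw C i)).toLinearMap
        (LinearMap.mulLeft Qvpi (Half.θ C i)) (coprodHalf C x) := by
  rw [coprodHalf, LinearMap.comp_apply, LinearMap.comp_apply, coprod_ι_mul]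
  induction coprod C x using TensorProduct.induction_on with
  | zero => simp
  | add a b ha hb => simp only [map_add, ha, hb]; abel
  | tmul a b => simp [coprodGen, twist_eq_freeScale, Half.scale_mk]

/-- The skew derivation `_i r` acts on `r(x)` through the first factor. -/
theorem coprodHalf_freeDer (i : I) (x : FreeAlgebra Qvpi I) :
    coprodHalf C (freeDer (tw C i) 1 i x) =
      TensorProduct.map (derL C i) LinearMap.id (coprodHalf C x) := by
  classical
  induction x using freeAlgebra_induction_left with
  | h1 => simp [coprodHalf_one]
  | hsmul r x hx => simp [hx]
  | hadd x x' hx hx' => simp [hx, hx']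
  | hmul j x hx =>
    have h1 : coprodHalf C (if j = i then x else 0) = if j = i then coprodHalf C x else 0 := by
      split_ifs <;> simp
    rw [freeDer_ι_mul, map_add, map_smul, coprodHalf_ι_mul, hx, coprodHalf_ι_mul, h1]
    by_cases h : j = i
    all_goals
      simp only [h, if_true, if_false]
      induction coprodHalf C x using TensorProduct.induction_on with
      | zero => simp
      | add a b ha hb =>
        simp only [map_add, smul_add] at ha hb ⊢
        rw [add_add_add_comm, add_add_add_comm _ _ (TensorProduct.map _ _ _), ← ha, ← hb]
        abel
      | tmul a b =>
        simp only [TensorProduct.map_tmul, LinearMap.mulLeft_apply, LinearMap.id_apply, map_add,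
          AlgHom.toLinearMap_apply, derL_θ_mul, derL_scale, TensorProduct.add_tmul, h, if_true,
          if_false, tw_symm C j i, smul_add, TensorProduct.smul_tmul', add_zero] <;>
        abel

/-- The counit property of the coproduct. -/
theorem lid_counit_coprodHalf (z : FreeAlgebra Qvpi I) :
    TensorProduct.lid Qvpi (Half C) (TensorProduct.map (Half.counit C).toLinearMap LinearMap.id
      (coprodHalf C z)) = Half.mk C z := by
  induction z using freeAlgebra_induction_left with
  | h1 => simp [coprodHalf_one]
  | hsmul r x hx => simp only [map_smul, hx]
  | hadd x x' hx hx' => simp only [map_add, hx, hx']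
  | hmul j x hx =>
    rw [coprodHalf_ι_mul, map_mul, ← hx]
    induction coprodHalf C x using TensorProduct.induction_on with
    | zero => simp
    | add a b ha hb =>
      simp only [map_add, mul_add] at ha hb ⊢
      rw [add_add_add_comm, ha, hb]
    | tmul a b => simp [Half.counit_scale]

theorem stdForm_mul_left (x y : Half C) (z : FreeAlgebra Qvpi I) :
    stdForm C (x * y) (Half.mk C z) = LinearMap.mul' Qvpi Qvpi
      (TensorProduct.map (stdForm C x) (stdForm C y) (coprodHalf C z)) := by
  obtain ⟨x, rfl⟩ := Half.mk_surjective C x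
  induction x using freeAlgebra_induction_left generalizing z with
  | h1 =>
    rw [map_one, one_mul, ← lid_counit_coprodHalf]
    induction coprodHalf C z using TensorProduct.induction_on with
    | zero => simp
    | add a b ha hb => simp only [map_add, ha, hb]
    | tmul a b => simp [stdForm_one]
  | hsmul r x hx =>
    simp only [map_smul, LinearMap.smul_apply, smul_mul_assoc, hx, TensorProduct.map_smul_left]
  | hadd x x' hx hx' =>
    simp only [map_add, LinearMap.add_apply, add_mul, hx, hx', TensorProduct.map_add_left]
  | hmul j x hx =>
    rw [map_mul (Half.mk C), Half.mk_ι, mul_assoc, stdForm_θ_mul, derL_mk, hx, coprodHalf_freeDer]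
    induction coprodHalf C z using TensorProduct.induction_on with
    | zero => simp
    | add a b ha hb => simp only [map_add, mul_add, ha, hb]
    | tmul a b =>
      simp only [TensorProduct.map_tmul, LinearMap.mul'_apply, LinearMap.id_apply, stdForm_θ_mul]
      ring

theorem stdForm_mul_right (x : FreeAlgebra Qvpi I) (y z : Half C) :
    stdForm C (Half.mk C x) (y * z) = LinearMap.mul' Qvpi Qvpi
      (TensorProduct.map ((stdForm C).flip y) ((stdForm C).flip z) (coprodHalf C x)) := by
  have h : (stdForm C).flip = stdForm C := by
    ext x y
    exact stdForm_symm C y x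
  rw [h, stdForm_symm, stdForm_mul_left]

theorem stdForm_θ_self (i : I) : stdForm C (Half.θ C i) (Half.θ C i) = normθ C i := by
  classical
  rw [← mul_one (Half.θ C i), stdForm_θ_mul, mul_one, derL_θ, if_pos rfl, stdForm_one, map_one,
    mul_one]

theorem stdForm_θ_ne {i j : I} (h : i ≠ j) : stdForm C (Half.θ C i) (Half.θ C j) = 0 := by
  classical
  rw [← mul_one (Half.θ C i), stdForm_θ_mul, derL_θ, if_neg h.symm, map_zero, mul_zero]

theorem isStandardForm_stdForm : IsStandardForm C (stdForm C) where
  one_one := by rw [stdForm_one, map_one]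
  gen_self := stdForm_θ_self C
  gen_ne _ _ := stdForm_θ_ne C
  mul_right := stdForm_mul_right C
  mul_left := stdForm_mul_left C

theorem coprodHalf_ι (i : I) :
    coprodHalf C (FreeAlgebra.ι Qvpi i) = Half.θ C i ⊗ₜ 1 + 1 ⊗ₜ Half.θ C i := by
  rw [← mul_one (FreeAlgebra.ι Qvpi i), coprodHalf_ι_mul, coprodHalf_one]
  simp

variable {C}

/-- The axioms give `(1 · 1, θ_i) = 2 (1, θ_i)`. -/
theorem IsStandardForm.one_θ {B : Half C →ₗ[Qvpi] Half C →ₗ[Qvpi] Qvpi} (hB : IsStandardForm C B)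
    (i : I) : B 1 (Half.θ C i) = 0 := by
  have h := hB.mul_left 1 1 (FreeAlgebra.ι Qvpi i)
  rw [coprodHalf_ι] at h
  simpa [hB.one_one] using h

theorem IsStandardForm.θ_one {B : Half C →ₗ[Qvpi] Half C →ₗ[Qvpi] Qvpi} (hB : IsStandardForm C B)
    (i : I) : B (Half.θ C i) 1 = 0 := by
  have h := hB.mul_right (FreeAlgebra.ι Qvpi i) 1 1
  rw [coprodHalf_ι] at h
  simpa [hB.one_one] using h

theorem IsStandardForm.one_mul_right {B : Half C →ₗ[Qvpi] Half C →ₗ[Qvpi] Qvpi}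
    (hB : IsStandardForm C B) (y z : Half C) : B 1 (y * z) = B 1 y * B 1 z := by
  have h := hB.mul_right 1 y z
  rw [coprodHalf_one] at h
  simpa using h

theorem IsStandardForm.θ_mul_right {B : Half C →ₗ[Qvpi] Half C →ₗ[Qvpi] Qvpi}
    (hB : IsStandardForm C B) (i : I) (y z : Half C) :
    B (Half.θ C i) (y * z) = B (Half.θ C i) y * B 1 z + B 1 y * B (Half.θ C i) z := by
  have h := hB.mul_right (FreeAlgebra.ι Qvpi i) y z
  rw [coprodHalf_ι] at h
  simpa using h

theorem IsStandardForm.unique {B B' : Half C →ₗ[Qvpi] Half C →ₗ[Qvpi] Qvpi}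
    (hB : IsStandardForm C B) (hB' : IsStandardForm C B') : B' = B := by
  have h1 : B' 1 = B 1 := by
    ext z
    induction z using Half.induction_right with
    | h1 => rw [hB.one_one, hB'.one_one]
    | hsmul r x hx => rw [map_smul, map_smul, hx]
    | hadd x y hx hy => rw [map_add, map_add, hx, hy]
    | hmul i x _ => rw [hB.one_mul_right, hB'.one_mul_right, hB.one_θ, hB'.one_θ, mul_zero, mul_zero]
  have hθ : ∀ i, B' (Half.θ C i) = B (Half.θ C i) := by
    intro i
    ext z
    induction z using Half.induction_right with
    | h1 => rw [hB.θ_one, hB'.θ_one]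
    | hsmul r x hx => rw [map_smul, map_smul, hx]
    | hadd x y hx hy => rw [map_add, map_add, hx, hy]
    | hmul j x hx =>
      rw [hB.θ_mul_right, hB'.θ_mul_right, hx, h1]
      congr 2
      by_cases h : i = j
      · subst h; rw [hB.gen_self, hB'.gen_self]
      · rw [hB.gen_ne i j h, hB'.gen_ne i j h]
  ext x z
  obtain ⟨z, rfl⟩ := Half.mk_surjective C z
  induction x using Half.induction_right generalizing z with
  | h1 => rw [h1]
  | hsmul r x hx => simp only [map_smul, LinearMap.smul_apply, hx]
  | hadd x y hx hy => simp only [map_add, LinearMap.add_apply, hx, hy]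
  | hmul i x hx =>
    have hx' : B' x = B x := by
      ext z
      obtain ⟨z, rfl⟩ := Half.mk_surjective C z
      exact hx z
    rw [hB.mul_left, hB'.mul_left, hx', hθ]

end Datum

/-! ### The action on `𝐟 ⊗ 𝐟` -/

section Datum

variable {I : Type*} (C : CartanDatum I)

/-- The diagonal operator `x ⊗ y ↦ s c(x) ⊗ c⁻¹(y)` on `𝐟 ⊗ 𝐟`. -/
def diagOp (s : Qvpiˣ) (c : I → Qvpiˣ) : Module.End Qvpi (Half C ⊗[Qvpi] Half C) :=
  (s : Qvpi) • TensorProduct.map (Half.scale C c).toLinearMap (Half.scale C c⁻¹).toLinearMap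

/-- The operator `x ⊗ y ↦ x θ_i ⊗ y` by which `τ₁(F_i)` acts. -/
def raiseOp (i : I) : Module.End Qvpi (Half C ⊗[Qvpi] Half C) :=
  TensorProduct.map (LinearMap.mulRight Qvpi (Half.θ C i)) LinearMap.id

/-- The operator by which `F_j` acts; `κ j` is the eigenvalue of `J̃_j K̃_j²` on `1 ⊗ 1`. -/
def lowerOp (κ : I → Qvpiˣ) (j : I) : Module.End Qvpi (Half C ⊗[Qvpi] Half C) :=
  TensorProduct.map (Half.scale C (tw C j)⁻¹).toLinearMap (LinearMap.mulLeft Qvpi (Half.θ C j)) -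
    (normθ C j * ((tw C j j)⁻¹ : Qvpiˣ)) •
      TensorProduct.map ((Half.scale C (tw C j)⁻¹).toLinearMap.comp (derL C j)) LinearMap.id +
    (normθ C j * ((tw C j j)⁻¹ : Qvpiˣ) * (κ j : Qvpi)) •
      TensorProduct.map ((Half.scale C ((tw C j)⁻¹ * (tw C j)⁻¹)).toLinearMap.comp (derR C j))
        (Half.scale C (tw C j * tw C j)).toLinearMap

/-- The operator by which `J̃_j K̃_j²` acts. -/
def cartanOp (κ : I → Qvpiˣ) (j : I) : Module.End Qvpi (Half C ⊗[Qvpi] Half C) :=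
  diagOp C (κ j) ((tw C j)⁻¹ * (tw C j)⁻¹)

theorem diagOp_tmul (s : Qvpiˣ) (c : I → Qvpiˣ) (x y : Half C) :
    diagOp C s c (x ⊗ₜ y) = (s : Qvpi) • (Half.scale C c x ⊗ₜ Half.scale C c⁻¹ y) := rfl

theorem raiseOp_tmul (i : I) (x y : Half C) :
    raiseOp C i (x ⊗ₜ y) = (x * Half.θ C i) ⊗ₜ y := rfl

theorem lowerOp_tmul (κ : I → Qvpiˣ) (j : I) (x y : Half C) :
    lowerOp C κ j (x ⊗ₜ y) = Half.scale C (tw C j)⁻¹ x ⊗ₜ (Half.θ C j * y) -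
      (normθ C j * ((tw C j j)⁻¹ : Qvpiˣ)) • (Half.scale C (tw C j)⁻¹ (derL C j x) ⊗ₜ y) +
      (normθ C j * ((tw C j j)⁻¹ : Qvpiˣ) * (κ j : Qvpi)) •
        (Half.scale C ((tw C j)⁻¹ * (tw C j)⁻¹) (derR C j x) ⊗ₜ
          Half.scale C (tw C j * tw C j) y) := rfl

theorem diagOp_mul_diagOp (s s' : Qvpiˣ) (c c' : I → Qvpiˣ) :
    diagOp C s c * diagOp C s' c' = diagOp C (s * s') (c * c') := by
  refine TensorProduct.ext' fun x y => ?_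
  rw [Module.End.mul_apply, diagOp_tmul, diagOp_tmul, map_smul, diagOp_tmul, smul_smul,
    Half.scale_scale, Half.scale_scale, mul_inv, mul_comm (s' : Qvpi), Units.val_mul]

theorem diagOp_one : diagOp C 1 1 = 1 := by
  refine TensorProduct.ext' fun x y => ?_
  rw [diagOp_tmul, inv_one, Half.scale_one, Half.scale_one, Units.val_one, one_smul]
  rfl

theorem diagOp_mul_raiseOp (s : Qvpiˣ) (c : I → Qvpiˣ) (i : I) :
    diagOp C s c * raiseOp C i = ((c i : Qvpiˣ) : Qvpi) • (raiseOp C i * diagOp C s c) := by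
  refine TensorProduct.ext' fun x y => ?_
  simp only [Module.End.mul_apply, LinearMap.smul_apply, raiseOp_tmul, diagOp_tmul, map_mul,
    Half.scale_θ, mul_smul_comm, smul_mul_assoc, ← TensorProduct.smul_tmul', map_smul, smul_smul]
  rw [mul_comm]

theorem diagOp_mul_lowerOp (s : Qvpiˣ) (c κ : I → Qvpiˣ) (j : I) :
    diagOp C s c * lowerOp C κ j =
      (((c j)⁻¹ : Qvpiˣ) : Qvpi) • (lowerOp C κ j * diagOp C s c) := by
  refine TensorProduct.ext' fun x y => ?_
  have hc : (((c j)⁻¹ : Qvpiˣ) : Qvpi) * ((c j : Qvpiˣ) : Qvpi) = 1 := by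
    rw [← Units.val_mul, inv_mul_cancel, Units.val_one]
  simp only [Module.End.mul_apply, LinearMap.smul_apply, lowerOp_tmul, diagOp_tmul, map_mul,
    map_add, map_sub, Half.scale_θ, smul_mul_assoc, TensorProduct.tmul_smul, map_smul, derL_scale,
    derR_scale, Half.scale_scale, smul_add, smul_sub, ← TensorProduct.smul_tmul', smul_smul,
    Pi.inv_apply, mul_comm c, mul_comm c⁻¹]
  match_scalars
  · ring
  · linear_combination ((s : Qvpi) * normθ C j * (((tw C j j)⁻¹ : Qvpiˣ) : Qvpi)) * hc
  · linear_combination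
      (-(s : Qvpi) * normθ C j * (((tw C j j)⁻¹ : Qvpiˣ) : Qvpi) * (κ j : Qvpi)) * hc

theorem derL_mul_θ (k i : I) (x : Half C) [Decidable (i = k)] :
    derL C k (x * Half.θ C i) = derL C k x * Half.θ C i +
      if i = k then Half.scale C (tw C k) x else 0 := by
  rw [derL_mul, derL_θ, add_comm]
  split_ifs <;> simp

theorem derR_mul_θ (k i : I) (x : Half C) [Decidable (i = k)] :
    derR C k (x * Half.θ C i) = ((tw C k i : Qvpiˣ) : Qvpi) • (derR C k x * Half.θ C i) +
      if i = k then x else 0 := by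
  rw [derR_mul, derR_θ, Half.scale_θ, mul_smul_comm, add_comm]
  split_ifs <;> simp

/-- The commutation relation of `τ₁(F_i)` and `F_j`. -/
theorem raiseOp_mul_lowerOp (κ : I → Qvpiˣ) (i j : I) [Decidable (i = j)] :
    raiseOp C i * lowerOp C κ j = ((tw C i j : Qvpiˣ) : Qvpi) • (lowerOp C κ j * raiseOp C i) +
      if i = j then normθ C i • (1 - cartanOp C κ i) else 0 := by
  refine TensorProduct.ext' fun x y => ?_
  have hc : ((tw C i j : Qvpiˣ) : Qvpi) * (((tw C j i)⁻¹ : Qvpiˣ) : Qvpi) = 1 := by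
    rw [tw_symm, ← Units.val_mul, mul_inv_cancel, Units.val_one]
  have hc' : ((tw C i j : Qvpiˣ) : Qvpi) * (((tw C j i) : Qvpiˣ) : Qvpi) *
      ((((tw C j i)⁻¹ : Qvpiˣ) : Qvpi) * (((tw C j i)⁻¹ : Qvpiˣ) : Qvpi)) = 1 := by
    have hc'' : ((tw C j i : Qvpiˣ) : Qvpi) * (((tw C j i)⁻¹ : Qvpiˣ) : Qvpi) = 1 := by
      rw [← Units.val_mul, mul_inv_cancel, Units.val_one]
    linear_combination ((tw C j i : Qvpiˣ) : Qvpi) * (((tw C j i)⁻¹ : Qvpiˣ) : Qvpi) * hc + hc''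
  simp only [Module.End.mul_apply, LinearMap.smul_apply, LinearMap.add_apply, raiseOp_tmul,
    lowerOp_tmul, map_add, map_sub, map_smul, map_mul, derL_mul_θ, derR_mul_θ, Half.scale_θ,
    mul_smul_comm, ← TensorProduct.smul_tmul', smul_add, smul_sub, smul_smul, Pi.inv_apply,
    Pi.mul_apply, Units.val_mul, TensorProduct.add_tmul]
  by_cases h : i = j
  · subst h
    simp only [if_true, LinearMap.smul_apply, LinearMap.sub_apply, Module.End.one_apply, cartanOp,
      diagOp_tmul, Half.scale_scale, inv_mul_cancel, Half.scale_one]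
    match_scalars
    · linear_combination -hc
    · linear_combination (normθ C i * (((tw C i i)⁻¹ : Qvpiˣ) : Qvpi)) * hc
    · linear_combination
        (-(normθ C i) * (((tw C i i)⁻¹ : Qvpiˣ) : Qvpi) * (κ i : Qvpi)) * hc'
    · linear_combination normθ C i * hc
    · linear_combination (-(normθ C i) * (κ i : Qvpi)) * hc
  · simp only [if_neg h, map_zero, TensorProduct.zero_tmul, smul_zero, add_zero,
      LinearMap.zero_apply]
    match_scalars
    · linear_combination -hc
    · linear_combination (normθ C j * (((tw C j j)⁻¹ : Qvpiˣ) : Qvpi)) * hc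
    · linear_combination
        (-(normθ C j) * (((tw C j j)⁻¹ : Qvpiˣ) : Qvpi) * (κ j : Qvpi)) * hc'

end Datum

/-! ### The Serre relations on `𝐟 ⊗ 𝐟` -/

section Datum

variable {I : Type*} (C : CartanDatum I)

/-- The action of words in the `F_j`. -/
def lowerHom (κ : I → Qvpiˣ) :
    FreeAlgebra Qvpi I →ₐ[Qvpi] Module.End Qvpi (Half C ⊗[Qvpi] Half C) :=
  FreeAlgebra.lift Qvpi (lowerOp C κ)

@[simp]
theorem lowerHom_ι (κ : I → Qvpiˣ) (j : I) :
    lowerHom C κ (FreeAlgebra.ι Qvpi j) = lowerOp C κ j := by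
  simp [lowerHom]

theorem lowerOp_one_tmul (κ : I → Qvpiˣ) (j : I) (y : Half C) :
    lowerOp C κ j (1 ⊗ₜ y) = 1 ⊗ₜ (Half.θ C j * y) := by
  simp [lowerOp_tmul]

theorem lowerHom_one_tmul (κ : I → Qvpiˣ) (z : FreeAlgebra Qvpi I) (y : Half C) :
    lowerHom C κ z (1 ⊗ₜ y) = 1 ⊗ₜ (Half.mk C z * y) := by
  induction z using FreeAlgebra.induction generalizing y with
  | grade0 r =>
    rw [AlgHom.commutes, AlgHom.commutes, ← Algebra.smul_def, TensorProduct.tmul_smul]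
    rfl
  | grade1 i => rw [lowerHom_ι, lowerOp_one_tmul, Half.mk_ι]
  | mul a b ha hb => rw [map_mul, map_mul, Module.End.mul_apply, hb, ha, mul_assoc]
  | add a b ha hb =>
    rw [map_add, map_add, LinearMap.add_apply, ha, hb, add_mul, TensorProduct.tmul_add]

theorem cartanOp_mul_lowerHom (κ : I → Qvpiˣ) (i : I) (z : FreeAlgebra Qvpi I) :
    cartanOp C κ i * lowerHom C κ z =
      lowerHom C κ (freeScale (tw C i * tw C i) z) * cartanOp C κ i := by
  induction z using FreeAlgebra.induction with
  | grade0 r => rw [AlgHom.commutes, AlgHom.commutes, AlgHom.commutes, Algebra.commutes]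
  | grade1 j =>
    rw [freeScale_ι, map_smul, lowerHom_ι, cartanOp, diagOp_mul_lowerOp, smul_mul_assoc]
    simp
  | mul a b ha hb =>
    rw [map_mul, ← mul_assoc, ha, mul_assoc, hb, map_mul, map_mul, mul_assoc]
  | add a b ha hb => rw [map_add, mul_add, ha, hb, map_add, map_add, add_mul]

/-- The commutation relation of `τ₁(F_i)` with words in the `F_j`; it measures the failure to
commute by the two skew derivations. -/
theorem raiseOp_mul_lowerHom (κ : I → Qvpiˣ) (i : I) (z : FreeAlgebra Qvpi I) :
    raiseOp C i * lowerHom C κ z = lowerHom C κ (freeScale (tw C i) z) * raiseOp C i +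
      normθ C i • (lowerHom C κ (freeDer (tw C i) 1 i z) -
        lowerHom C κ (freeScale (tw C i) (freeDer 1 (tw C i) i z)) * cartanOp C κ i) := by
  classical
  induction z using FreeAlgebra.induction with
  | grade0 r =>
    simp only [AlgHom.commutes, freeDer_algebraMap, map_zero, zero_mul, sub_zero, smul_zero,
      add_zero, Algebra.commutes]
  | grade1 j =>
    rw [freeScale_ι, map_smul, lowerHom_ι, raiseOp_mul_lowerOp, smul_mul_assoc]
    congr 1
    split_ifs with h
    · subst h; simp
    · simp [freeDer_ι_ne _ _ (Ne.symm h)]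
  | mul a b ha hb =>
    have hN := cartanOp_mul_lowerHom C κ i b
    rw [map_mul, ← mul_assoc, ha, add_mul, mul_assoc, hb, smul_mul_assoc, sub_mul, mul_assoc _ _
      (lowerHom C κ b), hN, freeDer_mul, freeDer_mul, freeScale_one,
      freeScale_one]
    simp only [map_mul, map_add, freeScale_freeScale, mul_add, add_mul, mul_sub, smul_sub, smul_add,
      mul_smul_comm, mul_assoc]
    abel
  | add a b ha hb =>
    simp only [map_add, mul_add, add_mul, ha, hb, smul_sub, smul_add]
    abel

/-- The Serre elements act by zero: they commute with the `τ₁(F_i)` up to scalars because the skew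
derivations kill them, and they annihilate `1 ⊗ 𝐟`. -/
theorem serre_lowerOp (κ : I → Qvpiˣ) {i j : I} (h : i ≠ j) : serre C (lowerOp C κ) i j = 0 := by
  have e : serre C (lowerOp C κ) i j = lowerHom C κ (serre C (FreeAlgebra.ι Qvpi) i j) := by
    rw [map_serre]; simp
  rw [e]
  refine TensorProduct.ext' fun x y => ?_
  rw [LinearMap.zero_apply]
  induction x using Half.induction_right with
  | h1 => rw [lowerHom_one_tmul, Half.mk_serre C h, zero_mul, TensorProduct.tmul_zero]
  | hsmul r x hx => rw [← TensorProduct.smul_tmul', map_smul, hx, smul_zero]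
  | hadd x x' hx hx' => rw [TensorProduct.add_tmul, map_add, hx, hx', add_zero]
  | hmul k x hx =>
    have hk := raiseOp_mul_lowerHom C κ k (serre C (FreeAlgebra.ι Qvpi) i j)
    rw [freeDer_left_serre C k h, freeDer_right_serre C k h, freeScale_serre] at hk
    simp only [map_zero, zero_mul, sub_zero, smul_zero, add_zero, map_smul, smul_mul_assoc] at hk
    have hk' := DFunLike.congr_fun hk (x ⊗ₜ y)
    rw [Module.End.mul_apply, hx, map_zero, LinearMap.smul_apply, Module.End.mul_apply,
      raiseOp_tmul] at hk'
    exact ((Units.isUnit _).smul_eq_zero).1 hk'.symm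

/-- The Serre relations hold in the opposite algebra because `x ↦ (right multiplication by x)` is an
anti-homomorphism. -/
theorem serre_raiseOp {i j : I} (h : i ≠ j) :
    serre C (fun i => MulOpposite.op (raiseOp C i)) i j = 0 := by
  have hr : ∀ x y : Half C, (TensorProduct.map (LinearMap.mulRight Qvpi (x * y)) LinearMap.id :
      Module.End Qvpi (Half C ⊗[Qvpi] Half C)) =
      TensorProduct.map (LinearMap.mulRight Qvpi y) LinearMap.id *
        TensorProduct.map (LinearMap.mulRight Qvpi x) LinearMap.id := by
    intro x y
    refine TensorProduct.ext' fun a b => ?_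
    simp [mul_assoc]
  let φ : Half C →ₐ[Qvpi] (Module.End Qvpi (Half C ⊗[Qvpi] Half C))ᵐᵒᵖ :=
    AlgHom.ofLinearMap
      { toFun := fun x => MulOpposite.op
          (TensorProduct.map (LinearMap.mulRight Qvpi x) LinearMap.id)
        map_add' := fun x y => by
          rw [← MulOpposite.op_add]
          congr 1
          refine TensorProduct.ext' fun a b => ?_
          simp [mul_add, TensorProduct.add_tmul]
        map_smul' := fun r x => by
          rw [RingHom.id_apply, ← MulOpposite.op_smul]
          congr 1
          refine TensorProduct.ext' fun a b => ?_
          simp [TensorProduct.smul_tmul'] }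
      (congrArg MulOpposite.op (by
        refine TensorProduct.ext' fun a b => ?_
        simp))
      fun x y => congrArg MulOpposite.op (hr x y)
  have := map_serre C φ (Half.θ C) i j
  rw [Half.serre_eq_zero C h, map_zero] at this
  exact this.symm

end Datum

/-! ### The representation of `𝐔` on `𝐟 ⊗ 𝐟` -/

section Covering

variable {I Y X : Type*} [AddCommGroup Y] [AddCommGroup X] {C : CartanDatum I}
  (D : RootDatum C Y X) (lam : X)

/-- The operator by which `K_μ` acts. -/
def KOp (μ : Y) : Module.End Qvpi (Half C ⊗[Qvpi] Half C) :=
  diagOp C (vU ^ D.pairing μ lam) fun i => vU ^ D.pairing μ (D.root i)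

/-- The operator by which `J_μ` acts. -/
def JOp (μ : Y) : Module.End Qvpi (Half C ⊗[Qvpi] Half C) :=
  diagOp C (piU ^ D.pairing μ lam) fun i => piU ^ D.pairing μ (D.root i)

/-- The eigenvalue of `J̃_j K̃_j²` on a vector of weight `lam`. -/
def cartanVal (j : I) : Qvpiˣ :=
  piU ^ D.pairing (C.d j • D.coroot j) lam *
    (vU ^ D.pairing (C.d j • D.coroot j) lam * vU ^ D.pairing (C.d j • D.coroot j) lam)

theorem KOp_mul (μ ν : Y) : KOp D lam μ * KOp D lam ν = KOp D lam (μ + ν) := by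
  rw [KOp, KOp, KOp, diagOp_mul_diagOp, map_add, LinearMap.add_apply, zpow_add]
  congr 1
  funext i
  rw [Pi.mul_apply, LinearMap.add_apply, zpow_add]

theorem JOp_mul (μ ν : Y) : JOp D lam μ * JOp D lam ν = JOp D lam (μ + ν) := by
  rw [JOp, JOp, JOp, diagOp_mul_diagOp, map_add, LinearMap.add_apply, zpow_add]
  congr 1
  funext i
  rw [Pi.mul_apply, LinearMap.add_apply, zpow_add]

theorem KOp_zero : KOp D lam 0 = 1 := by
  rw [KOp, ← diagOp_one]
  simp only [map_zero, LinearMap.zero_apply, zpow_zero]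
  rfl

theorem JOp_zero : JOp D lam 0 = 1 := by
  rw [JOp, ← diagOp_one]
  simp only [map_zero, LinearMap.zero_apply, zpow_zero]
  rfl

theorem JOp_mul_self (μ : Y) : JOp D lam μ * JOp D lam μ = 1 := by
  rw [JOp, diagOp_mul_diagOp, ← diagOp_one, ← mul_zpow, piU_mul_self, one_zpow]
  congr 1
  funext i
  rw [Pi.mul_apply, ← mul_zpow, piU_mul_self, one_zpow, Pi.one_apply]

theorem JOp_mul_KOp (μ ν : Y) : JOp D lam μ * KOp D lam ν = KOp D lam ν * JOp D lam μ := by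
  rw [JOp, KOp, diagOp_mul_diagOp, diagOp_mul_diagOp, mul_comm]
  congr 1
  rw [mul_comm]

theorem KOp_mul_raiseOp (μ : Y) (i : I) : KOp D lam μ * raiseOp C i =
    ((vU ^ D.pairing μ (D.root i) : Qvpiˣ) : Qvpi) • (raiseOp C i * KOp D lam μ) :=
  diagOp_mul_raiseOp C _ _ i

theorem JOp_mul_raiseOp (μ : Y) (i : I) : JOp D lam μ * raiseOp C i =
    ((piU ^ D.pairing μ (D.root i) : Qvpiˣ) : Qvpi) • (raiseOp C i * JOp D lam μ) :=
  diagOp_mul_raiseOp C _ _ i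

theorem KOp_mul_lowerOp (κ : I → Qvpiˣ) (μ : Y) (i : I) : KOp D lam μ * lowerOp C κ i =
    ((vU ^ (-D.pairing μ (D.root i)) : Qvpiˣ) : Qvpi) • (lowerOp C κ i * KOp D lam μ) := by
  rw [zpow_neg]
  exact diagOp_mul_lowerOp C _ _ κ i

theorem JOp_mul_lowerOp (κ : I → Qvpiˣ) (μ : Y) (i : I) : JOp D lam μ * lowerOp C κ i =
    ((piU ^ (-D.pairing μ (D.root i)) : Qvpiˣ) : Qvpi) • (lowerOp C κ i * JOp D lam μ) := by
  rw [zpow_neg]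
  exact diagOp_mul_lowerOp C _ _ κ i

/-- Here the evenness of `i · j` enters: `J̃_i` acts by a scalar. -/
theorem cartanOp_eq (j : I) : cartanOp C (cartanVal D lam) j =
    JOp D lam (C.d j • D.coroot j) *
      (KOp D lam (C.d j • D.coroot j) * KOp D lam (C.d j • D.coroot j)) := by
  rw [cartanOp, JOp, KOp, diagOp_mul_diagOp, diagOp_mul_diagOp, cartanVal]
  congr 1
  funext i
  simp only [Pi.mul_apply, Pi.inv_apply, dot_eq_pairing, tw_eq_piv]
  rw [piU_zpow_eq_one (even_dot C i j), one_mul, piv_inv, piv_mul, C.dot_symm j i]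
  refine (piv_congr (a' := 0) ⟨-(C.p j * C.p i), by ring⟩ rfl).trans ?_
  rw [piv, zpow_zero, one_mul, neg_neg, zpow_add]

/-- The images of the generators of `𝐔` in the representation on `𝐟 ⊗ 𝐟`. -/
def repGen : UGen I Y → Module.End Qvpi (Half C ⊗[Qvpi] Half C)
  | .E i => (((vi C i)⁻¹ : Qvpiˣ) : Qvpi) • (raiseOp C i * KOp D lam (-(C.d i • D.coroot i)))
  | .F i => lowerOp C (cartanVal D lam) i
  | .K μ => KOp D lam μ
  | .J μ => JOp D lam μ

theorem KOp_mul_comm (μ ν : Y) : KOp D lam μ * KOp D lam ν = KOp D lam ν * KOp D lam μ := by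
  rw [KOp_mul, KOp_mul, add_comm]

theorem repGen_EF (i j : I) [Decidable (i = j)] :
    repGen D lam (.E i) * repGen D lam (.F j) -
      ((piU ^ (C.p i * C.p j) : Qvpiˣ) : Qvpi) • (repGen D lam (.F j) * repGen D lam (.E i)) =
    if i = j then ((((vi C i)⁻¹ * vU ^ C.dot i i : Qvpiˣ) : Qvpi) * normθ C i) •
      (KOp D lam (-(C.d i • D.coroot i)) -
        JOp D lam (C.d i • D.coroot i) * KOp D lam (C.d i • D.coroot i)) else 0 := by
  have hK : KOp D lam (-(C.d i • D.coroot i)) * lowerOp C (cartanVal D lam) j =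
      ((vU ^ C.dot i j : Qvpiˣ) : Qvpi) •
        (lowerOp C (cartanVal D lam) j * KOp D lam (-(C.d i • D.coroot i))) := by
    rw [KOp_mul_lowerOp, map_neg, LinearMap.neg_apply, neg_neg, dot_eq_pairing, C.dot_symm]
  have htw : ((vU ^ C.dot i j : Qvpiˣ) : Qvpi) * ((tw C i j : Qvpiˣ) : Qvpi) =
      ((piU ^ (C.p i * C.p j) : Qvpiˣ) : Qvpi) := by
    rw [← Units.val_mul, tw, mul_left_comm, ← zpow_add, add_neg_cancel, zpow_zero, mul_one]
  have hN : cartanOp C (cartanVal D lam) i * KOp D lam (-(C.d i • D.coroot i)) =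
      JOp D lam (C.d i • D.coroot i) * KOp D lam (C.d i • D.coroot i) := by
    rw [cartanOp_eq, mul_assoc, mul_assoc, KOp_mul, add_neg_cancel, KOp_zero, mul_one]
  simp only [repGen, smul_mul_assoc, mul_smul_comm]
  rw [mul_assoc, hK, mul_smul_comm, ← mul_assoc, raiseOp_mul_lowerOp, ← htw]
  split_ifs with h
  · subst h
    simp only [add_mul, smul_mul_assoc, sub_mul, hN, one_mul, smul_add, smul_sub, smul_smul,
      mul_assoc, Units.val_mul]
    match_scalars <;> ring
  · simp only [add_zero, smul_mul_assoc, smul_smul, mul_assoc]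
    match_scalars
    ring

/-- Compares the denominator of the relation for `E_i F_i` with the norm of `θ_i`. -/
theorem ring_inverse_qden (i : I) :
    Ring.inverse (((pii C i * vi C i : Qvpiˣ) : Qvpi) - (((vi C i)⁻¹ : Qvpiˣ) : Qvpi)) =
      -((((vi C i)⁻¹ * vU ^ C.dot i i : Qvpiˣ) : Qvpi) * normθ C i) := by
  have hv : (vi C i)⁻¹ * vU ^ C.dot i i = vi C i := by
    rw [vi_eq_piv, piv_inv, C.dot_self]
    rw [show vU ^ (2 * (C.d i : ℤ)) = piv 0 (2 * (C.d i : ℤ)) by simp [piv], piv_mul]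
    congr 1; ring
  have hb := isUnit_qnum C i one_pos
  rw [qnum, pow_one, pow_one] at hb
  have hab : (1 - ((pii C i * vi C i ^ 2 : Qvpiˣ) : Qvpi)) = -((vi C i : Qvpiˣ) : Qvpi) *
      (((pii C i * vi C i : Qvpiˣ) : Qvpi) - (((vi C i)⁻¹ : Qvpiˣ) : Qvpi)) := by
    have h1 : ((vi C i : Qvpiˣ) : Qvpi) * (((vi C i)⁻¹ : Qvpiˣ) : Qvpi) = 1 := by
      rw [← Units.val_mul, mul_inv_cancel, Units.val_one]
    rw [Units.val_mul, Units.val_mul, Units.val_pow_eq_pow_val]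
    linear_combination -h1
  have ha : IsUnit (1 - ((pii C i * vi C i ^ 2 : Qvpiˣ) : Qvpi)) := by
    rw [hab]
    exact (Units.isUnit _).neg.mul hb
  refine hb.mul_left_cancel ?_
  rw [Ring.mul_inverse_cancel _ hb, hv, normθ]
  have h2 := Ring.mul_inverse_cancel _ ha
  nth_rewrite 1 [hab] at h2
  linear_combination -h2

/-- Multiplying the operators `τ₁(F_i)` by the `K̃_{-i}` reverses the order in the Serre relation, so
that the relation in the opposite algebra becomes the one for the `E_i`. -/
theorem serre_repGen_E {i j : I} (h : i ≠ j) :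
    serre C (fun i => repGen D lam (.E i)) i j = 0 := by
  apply (AlgEquiv.opOp Qvpi (Module.End Qvpi (Half C ⊗[Qvpi] Half C))).injective
  rw [map_zero]
  refine (map_serre C (AlgEquiv.opOp Qvpi
    (Module.End Qvpi (Half C ⊗[Qvpi] Half C))).toAlgHom _ i j).trans ?_
  refine serre_op_eq_zero (C := C) (fun i => MulOpposite.op (raiseOp C i))
    (fun i => MulOpposite.op (KOp D lam (-(C.d i • D.coroot i))))
    (fun i => (((vi C i)⁻¹ : Qvpiˣ) : Qvpi))
    (fun i j => ((vU ^ (-C.dot i j) : Qvpiˣ) : Qvpi)) ?_ ?_ ?_ h (serre_raiseOp C h)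
  · intro i j; rw [C.dot_symm]
  · intro i j
    rw [← MulOpposite.op_mul, ← MulOpposite.op_mul, ← MulOpposite.op_smul, KOp_mul_raiseOp, map_neg,
      LinearMap.neg_apply, dot_eq_pairing]
  · intro i j
    rw [← MulOpposite.op_mul, ← MulOpposite.op_mul, KOp_mul_comm]

theorem repGen_rel {x y : Module.End Qvpi (Half C ⊗[Qvpi] Half C)}
    (h : Rel D (repGen D lam) x y) : x = y := by
  classical
  cases h
  case JJ μ ν => exact JOp_mul D lam μ ν
  case KK μ ν => exact KOp_mul D lam μ ν
  case K_zero => exact KOp_zero D lam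
  case J_zero => exact JOp_zero D lam
  case J_sq ν => exact (pow_two _).trans (JOp_mul_self D lam ν)
  case JK μ ν => exact JOp_mul_KOp D lam μ ν
  case JE μ i =>
    simp only [repGen, mul_smul_comm, smul_mul_assoc]
    rw [← mul_assoc, JOp_mul_raiseOp, smul_mul_assoc, mul_assoc, JOp_mul_KOp, smul_comm, mul_assoc]
  case JF μ i => exact JOp_mul_lowerOp D lam _ μ i
  case KE μ i =>
    simp only [repGen, mul_smul_comm, smul_mul_assoc]
    rw [← mul_assoc, KOp_mul_raiseOp, smul_mul_assoc, mul_assoc, KOp_mul_comm, smul_comm, mul_assoc]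
  case KF μ i => exact KOp_mul_lowerOp D lam _ μ i
  case EF_self i =>
    refine ((repGen_EF D lam i i).trans (if_pos rfl)).trans ?_
    rw [ring_inverse_qden, neg_smul]
    exact (congrArg _ (neg_sub _ _).symm).trans (smul_neg _ _)
  case EF_ne i j hij => exact (repGen_EF D lam i j).trans (if_neg hij)
  case serreE i j hij => exact serre_repGen_E D lam hij
  case serreF i j hij => exact serre_lowerOp C _ hij

/-- The representation of `𝐔` on `𝐟 ⊗ 𝐟`, in which `x ⊗ y` is the class of `τ₁(x⁻) y⁻ 1_λ`. -/
def rep : U D →ₐ[Qvpi] Module.End Qvpi (Half C ⊗[Qvpi] Half C) :=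
  U.lift D (repGen D lam) fun _ _ => repGen_rel D lam

theorem rep_gen (s : UGen I Y) : rep D lam (gen D s) = repGen D lam s := U.lift_gen D _ _ s

end Covering

/-! ### The functional `u ↦ (1_λ, u 1_λ)` -/

section Covering

variable {I Y X : Type*} [AddCommGroup Y] [AddCommGroup X] {C : CartanDatum I}
  (D : RootDatum C Y X) (lam : X)

theorem tau_one : tau D 1 = 1 := by simp [tau]

theorem tau_algebraMap (r : Qvpi) : tau D (algebraMap Qvpi (U D) r) = algebraMap Qvpi (U D) r := by
  rw [Algebra.algebraMap_eq_smul_one, map_smul, tau_one]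

theorem vi_inv_sq_mul (i : I) : (((vi C i)⁻¹ : Qvpiˣ) : Qvpi) * ((((vi C i)⁻¹ : Qvpiˣ) : Qvpi) *
    ((vU ^ C.dot i i : Qvpiˣ) : Qvpi)) = 1 := by
  rw [← Units.val_mul, ← Units.val_mul, C.dot_self, vi, two_mul, zpow_add, zpow_natCast]
  simp

theorem tau_tau (u : U D) : tau D (tau D u) = u := by
  induction u using U.induction with
  | halg r => rw [tau_algebraMap, tau_algebraMap]
  | hadd x y hx hy => rw [map_add, map_add, hx, hy]
  | hmul x y hx hy => rw [tau_mul, tau_mul, hx, hy]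
  | hgen s =>
    cases s with
    | E i =>
      rw [tau_E, map_smul, tau_mul, tau_K, tau_F, smul_mul_assoc, mul_assoc, E_mul_K, map_neg,
        LinearMap.neg_apply, neg_neg, dot_eq_pairing, mul_smul_comm, ← mul_assoc,
        gen_rel D (.KK _ _), add_neg_cancel, gen_rel D .K_zero, one_mul, smul_smul, smul_smul,
        mul_assoc, vi_inv_sq_mul, one_smul]
    | F i =>
      rw [tau_F, map_smul, tau_mul, tau_K, tau_E, smul_mul_assoc, mul_assoc, F_mul_K,
        dot_eq_pairing, mul_smul_comm, ← mul_assoc, gen_rel D (.KK _ _), neg_add_cancel,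
        gen_rel D .K_zero, one_mul, smul_smul, smul_smul, mul_assoc, vi_inv_sq_mul,
        one_smul]
    | K μ => rw [tau_K, tau_K]
    | J μ => rw [tau_J, tau_J]

@[simp]
theorem minus_θ (i : I) : minus D (Half.θ C i) = gen D (.F i) := Half.lift_θ C _ _ i

theorem rep_tau_F (i : I) : rep D lam (tau D (gen D (.F i))) = raiseOp C i := by
  rw [tau_F, map_smul, map_mul, rep_gen, rep_gen, repGen, repGen, mul_smul_comm, ← mul_assoc,
    KOp_mul_raiseOp, dot_eq_pairing, smul_mul_assoc, mul_assoc, KOp_mul, add_neg_cancel, KOp_zero,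
    mul_one, smul_smul, smul_smul, mul_assoc, vi_inv_sq_mul, one_smul]

theorem rep_minus (x y : Half C) :
    rep D lam (minus D x) (1 ⊗ₜ y) = 1 ⊗ₜ (x * y) := by
  obtain ⟨x, rfl⟩ := Half.mk_surjective C x
  have h : ((rep D lam).comp (minus D)).comp (Half.mk C) = lowerHom C (cartanVal D lam) := by
    apply FreeAlgebra.hom_ext
    funext i
    simp only [Function.comp_apply, AlgHom.comp_apply, Half.mk_ι, minus_θ, rep_gen, lowerHom_ι]
    rfl
  exact (DFunLike.congr_fun (DFunLike.congr_fun h x) (1 ⊗ₜ y)).trans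
    (lowerHom_one_tmul C _ x y)

theorem rep_tau_minus (x a b : Half C) :
    rep D lam (tau D (minus D x)) (a ⊗ₜ b) = (a * x) ⊗ₜ b := by
  induction x using Half.induction_right with
  | h1 => simp [tau_one]
  | hsmul r x hx =>
    rw [map_smul, map_smul, map_smul, LinearMap.smul_apply, hx, mul_smul_comm,
      TensorProduct.smul_tmul']
  | hadd x y hx hy =>
    rw [map_add, map_add, map_add, LinearMap.add_apply, hx, hy, mul_add, TensorProduct.add_tmul]
  | hmul i x hx =>
    rw [map_mul, minus_θ, tau_mul, map_mul, Module.End.mul_apply, hx, rep_tau_F, raiseOp_tmul,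
      mul_assoc]

/-- The functional `u ↦ (1_λ, u 1_λ)` on `𝐔`. -/
def phi : U D →ₗ[Qvpi] Qvpi :=
  (TensorProduct.lift (stdForm C)).comp
    ((LinearMap.applyₗ (1 ⊗ₜ[Qvpi] 1)).comp (rep D lam).toLinearMap)

theorem phi_apply (u : U D) :
    phi D lam u = TensorProduct.lift (stdForm C) (rep D lam u (1 ⊗ₜ 1)) := rfl

theorem phi_tau_minus_mul_minus (x y : Half C) :
    phi D lam (tau D (minus D x) * minus D y) = stdForm C x y := by
  rw [phi_apply, map_mul, Module.End.mul_apply, rep_minus, rep_tau_minus, mul_one, one_mul,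
    TensorProduct.lift.tmul]

theorem rep_K_one (ν : Y) : rep D lam (gen D (.K ν)) (1 ⊗ₜ 1) =
    ((vU ^ D.pairing ν lam : Qvpiˣ) : Qvpi) • ((1 : Half C) ⊗ₜ[Qvpi] (1 : Half C)) := by
  rw [rep_gen, repGen, KOp, diagOp_tmul, map_one, map_one]

theorem rep_J_one (ν : Y) : rep D lam (gen D (.J ν)) (1 ⊗ₜ 1) =
    ((piU ^ D.pairing ν lam : Qvpiˣ) : Qvpi) • ((1 : Half C) ⊗ₜ[Qvpi] (1 : Half C)) := by
  rw [rep_gen, repGen, JOp, diagOp_tmul, map_one, map_one]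

theorem rep_of_mem_wtIdeal {u : U D} (hu : u ∈ wtIdeal D lam) : rep D lam u (1 ⊗ₜ 1) = 0 := by
  induction hu using Submodule.span_induction with
  | zero => rw [map_zero, LinearMap.zero_apply]
  | add x y _ _ hx hy => rw [map_add, LinearMap.add_apply, hx, hy, add_zero]
  | smul a x _ hx => rw [smul_eq_mul, map_mul, Module.End.mul_apply, hx, map_zero]
  | mem x hx =>
    rcases hx with ⟨ν, rfl⟩ | ⟨ν, rfl⟩
    · rw [map_sub, LinearMap.sub_apply, rep_K_one, AlgHom.commutes, Module.algebraMap_end_apply,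
        sub_self]
    · rw [map_sub, LinearMap.sub_apply, rep_J_one, AlgHom.commutes, Module.algebraMap_end_apply,
        sub_self]

theorem phi_of_mem_wtIdeal {u : U D} (hu : u ∈ wtIdeal D lam) : phi D lam u = 0 := by
  rw [phi_apply, rep_of_mem_wtIdeal D lam hu, map_zero]

/-- The diagonal operators act on the functional through the weight of `1 ⊗ 1`, as `c` on the first
factor is adjoint to `c` on the second one, where `c⁻¹` acts. -/
theorem lift_stdForm_diagOp (s : Qvpiˣ) (c : I → Qvpiˣ) (m : Half C ⊗[Qvpi] Half C) :
    TensorProduct.lift (stdForm C) (diagOp C s c m) =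
      (s : Qvpi) * TensorProduct.lift (stdForm C) m := by
  induction m using TensorProduct.induction_on with
  | zero => simp
  | add a b ha hb => rw [map_add, map_add, map_add, ha, hb, mul_add]
  | tmul x y =>
    rw [diagOp_tmul, map_smul, TensorProduct.lift.tmul, TensorProduct.lift.tmul, stdForm_scale,
      Half.scale_scale, mul_inv_cancel, Half.scale_one, smul_eq_mul]

theorem phi_K_mul (ν : Y) (u : U D) : phi D lam (gen D (.K ν) * u) =
    ((vU ^ D.pairing ν lam : Qvpiˣ) : Qvpi) * phi D lam u := by
  rw [phi_apply, map_mul, Module.End.mul_apply, rep_gen, repGen, KOp, lift_stdForm_diagOp,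
    phi_apply]

theorem phi_J_mul (ν : Y) (u : U D) : phi D lam (gen D (.J ν) * u) =
    ((piU ^ D.pairing ν lam : Qvpiˣ) : Qvpi) * phi D lam u := by
  rw [phi_apply, map_mul, Module.End.mul_apply, rep_gen, repGen, JOp, lift_stdForm_diagOp,
    phi_apply]

theorem phi_tau_of_mem_wtIdeal {u : U D} (hu : u ∈ wtIdeal D lam) : phi D lam (tau D u) = 0 := by
  suffices H : ∀ w, phi D lam (tau D u * w) = 0 by simpa using H 1
  induction hu using Submodule.span_induction with
  | zero => intro w; simp
  | add x y _ _ hx hy => intro w; rw [map_add, add_mul, map_add, hx, hy, add_zero]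
  | smul a x _ hx => intro w; rw [smul_eq_mul, tau_mul, mul_assoc, hx]
  | mem x hx =>
    intro w
    rcases hx with ⟨ν, rfl⟩ | ⟨ν, rfl⟩
    · rw [map_sub, tau_K, tau_algebraMap, sub_mul, map_sub, phi_K_mul, ← Algebra.smul_def, map_smul,
        smul_eq_mul, sub_self]
    · rw [map_sub, tau_J, tau_algebraMap, sub_mul, map_sub, phi_J_mul, ← Algebra.smul_def, map_smul,
        smul_eq_mul, sub_self]

/-! ### The elements `τ₁(x⁻) y⁻ 1_λ` span `𝐔 1_λ` -/

theorem mul_minus_of_comm {k : U D} {c : I → Qvpiˣ}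
    (hk : ∀ i, k * gen D (.F i) = ((c i : Qvpiˣ) : Qvpi) • (gen D (.F i) * k)) (x : Half C) :
    k * minus D x = minus D (Half.scale C c x) * k := by
  induction x using Half.induction_right with
  | h1 => simp
  | hsmul r x hx => rw [map_smul, map_smul, map_smul, mul_smul_comm, hx, smul_mul_assoc]
  | hadd x y hx hy => rw [map_add, map_add, map_add, mul_add, hx, hy, add_mul]
  | hmul i x hx =>
    rw [map_mul, ← mul_assoc, hx, minus_θ, mul_assoc, hk, map_mul, Half.scale_θ, mul_smul_comm,
      mul_smul_comm, map_smul, map_mul, minus_θ, smul_mul_assoc, mul_assoc]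

theorem mul_tau_minus_of_comm {k : U D} {c : I → Qvpiˣ} (hτ : tau D k = k)
    (hk : ∀ i, k * gen D (.F i) = ((c i : Qvpiˣ) : Qvpi) • (gen D (.F i) * k)) (x : Half C) :
    k * tau D (minus D x) = tau D (minus D (Half.scale C c⁻¹ x)) * k := by
  have h := congrArg (tau D) (mul_minus_of_comm D hk (Half.scale C c⁻¹ x))
  rw [Half.scale_scale, mul_inv_cancel, Half.scale_one, tau_mul, tau_mul, hτ] at h
  exact h.symm

/-- The subspace spanned by the `τ₁(x⁻) y⁻` together with the left ideal defining `𝐔 1_λ`. -/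
def stdSpan : Submodule Qvpi (U D) :=
  Submodule.span Qvpi (Set.range fun p : Half C × Half C => tau D (minus D p.1) * minus D p.2) ⊔
    (wtIdeal D lam).restrictScalars Qvpi

theorem tau_minus_mul_minus_mem (x y : Half C) :
    tau D (minus D x) * minus D y ∈ stdSpan D lam :=
  Submodule.mem_sup_left (Submodule.subset_span ⟨(x, y), rfl⟩)

theorem wtIdeal_le_stdSpan {u : U D} (hu : u ∈ wtIdeal D lam) : u ∈ stdSpan D lam :=
  Submodule.mem_sup_right hu

theorem mul_mem_stdSpan {k : U D}
    (hk : ∀ x y, k * (tau D (minus D x) * minus D y) ∈ stdSpan D lam) {u : U D}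
    (hu : u ∈ stdSpan D lam) : k * u ∈ stdSpan D lam := by
  obtain ⟨a, ha, b, hb, rfl⟩ := Submodule.mem_sup.1 hu
  rw [mul_add]
  refine add_mem ?_ (wtIdeal_le_stdSpan D lam ((wtIdeal D lam).smul_mem k hb))
  clear hu
  induction ha using Submodule.span_induction with
  | zero => rw [mul_zero]; exact zero_mem _
  | add x y _ _ hx hy => rw [mul_add]; exact add_mem hx hy
  | smul r x _ hx => rw [mul_smul_comm]; exact Submodule.smul_mem _ r hx
  | mem x hx =>
    obtain ⟨p, rfl⟩ := hx
    exact hk p.1 p.2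

theorem cartan_mul_mem_stdSpan {k : U D} {c : I → Qvpiˣ} {r : Qvpi} (hτ : tau D k = k)
    (hk : ∀ i, k * gen D (.F i) = ((c i : Qvpiˣ) : Qvpi) • (gen D (.F i) * k))
    (hr : k - algebraMap Qvpi (U D) r ∈ wtIdeal D lam) {u : U D} (hu : u ∈ stdSpan D lam) :
    k * u ∈ stdSpan D lam := by
  refine mul_mem_stdSpan D lam (fun x y => ?_) hu
  rw [← mul_assoc, mul_tau_minus_of_comm D hτ hk, mul_assoc, mul_minus_of_comm D hk, ← mul_assoc]
  set z := tau D (minus D (Half.scale C c⁻¹ x)) * minus D (Half.scale C c y)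
  have e : z * k = r • z + z * (k - algebraMap Qvpi (U D) r) := by
    rw [mul_sub, ← Algebra.commutes, ← Algebra.smul_def, add_sub_cancel]
  rw [e]
  exact add_mem (Submodule.smul_mem _ r (tau_minus_mul_minus_mem D lam _ _))
    (wtIdeal_le_stdSpan D lam ((wtIdeal D lam).smul_mem z hr))

theorem K_mul_mem_stdSpan (ν : Y) {u : U D} (hu : u ∈ stdSpan D lam) :
    gen D (.K ν) * u ∈ stdSpan D lam :=
  cartan_mul_mem_stdSpan D lam (c := fun i => vU ^ (-D.pairing ν (D.root i))) (tau_K D ν)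
    (fun i => gen_rel D (.KF ν i)) (Submodule.subset_span (Or.inl ⟨ν, rfl⟩)) hu

theorem J_mul_mem_stdSpan (ν : Y) {u : U D} (hu : u ∈ stdSpan D lam) :
    gen D (.J ν) * u ∈ stdSpan D lam :=
  cartan_mul_mem_stdSpan D lam (c := fun i => piU ^ (-D.pairing ν (D.root i))) (tau_J D ν)
    (fun i => gen_rel D (.JF ν i)) (Submodule.subset_span (Or.inr ⟨ν, rfl⟩)) hu

theorem tau_F_mul_mem_stdSpan (i : I) {u : U D} (hu : u ∈ stdSpan D lam) :
    tau D (gen D (.F i)) * u ∈ stdSpan D lam := by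
  refine mul_mem_stdSpan D lam (fun x y => ?_) hu
  rw [← mul_assoc, ← tau_mul, ← minus_θ, ← map_mul]
  exact tau_minus_mul_minus_mem D lam _ _

theorem E_mul_mem_stdSpan (i : I) {u : U D} (hu : u ∈ stdSpan D lam) :
    gen D (.E i) * u ∈ stdSpan D lam := by
  have e : gen D (.E i) = ((vi C i : Qvpiˣ) : Qvpi) •
      (gen D (.K (-(C.d i • D.coroot i))) * tau D (gen D (.F i))) := by
    rw [tau_F, mul_smul_comm, smul_smul, ← Units.val_mul, mul_inv_cancel, Units.val_one, one_smul,
      ← mul_assoc, gen_rel D (.KK _ _), neg_add_cancel, gen_rel D .K_zero, one_mul]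
  rw [e, smul_mul_assoc, mul_assoc]
  exact Submodule.smul_mem _ _ (K_mul_mem_stdSpan D lam _ (tau_F_mul_mem_stdSpan D lam i hu))

/-- `F_j` commutes with `K̃_i E_i`, a multiple of `τ₁(F_i)`, up to a scalar and Cartan elements. -/
theorem KE_mul_F (i j : I) : ∃ r : Qvpi,
    gen D (.F j) * (gen D (.K (C.d i • D.coroot i)) * gen D (.E i)) =
      (((tw C i j)⁻¹ : Qvpiˣ) : Qvpi) •
        (gen D (.K (C.d i • D.coroot i)) * gen D (.E i) * gen D (.F j)) +
      r • (gen D (.K (C.d i • D.coroot i)) *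
        (gen D (.J (C.d i • D.coroot i)) * gen D (.K (C.d i • D.coroot i)) -
          gen D (.K (-(C.d i • D.coroot i))))) := by
  have hFK : gen D (.F j) * (gen D (.K (C.d i • D.coroot i)) * gen D (.E i)) =
      ((vU ^ C.dot i j : Qvpiˣ) : Qvpi) •
        (gen D (.K (C.d i • D.coroot i)) * (gen D (.F j) * gen D (.E i))) := by
    rw [← mul_assoc, F_mul_K, dot_eq_pairing, C.dot_symm, smul_mul_assoc, mul_assoc]
  have htw : (((tw C i j)⁻¹ : Qvpiˣ) : Qvpi) * ((piU ^ (C.p i * C.p j) : Qvpiˣ) : Qvpi) =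
      ((vU ^ C.dot i j : Qvpiˣ) : Qvpi) := by
    rw [← Units.val_mul, tw, mul_inv, mul_right_comm, inv_mul_cancel, one_mul, zpow_neg, inv_inv]
  by_cases h : i = j
  · subst h
    have h0 := sub_eq_iff_eq_add.1 (gen_rel D (.EF_self i))
    refine ⟨-((((tw C i i)⁻¹ : Qvpiˣ) : Qvpi) *
      Ring.inverse (((pii C i * vi C i : Qvpiˣ) : Qvpi) - (((vi C i)⁻¹ : Qvpiˣ) : Qvpi))), ?_⟩
    rw [hFK, mul_assoc, h0, mul_add, mul_smul_comm, mul_smul_comm, smul_add, smul_smul, smul_smul,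
      htw, neg_smul]
    abel
  · have h0 := sub_eq_zero.1 (gen_rel D (.EF_ne i j h))
    refine ⟨0, ?_⟩
    rw [hFK, mul_assoc, h0, mul_smul_comm, smul_smul, htw, zero_smul, add_zero]

/-- The `F_j` are moved past the letters of `τ₁(x⁻)` one by one. -/
theorem F_mul_mem_stdSpan (j : I) {u : U D} (hu : u ∈ stdSpan D lam) :
    gen D (.F j) * u ∈ stdSpan D lam := by
  refine mul_mem_stdSpan D lam (fun x y => ?_) hu
  induction x using Half.induction_right generalizing y with
  | h1 =>
    rw [map_one, tau_one, one_mul, ← minus_θ, ← map_mul]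
    simpa [tau_one] using tau_minus_mul_minus_mem D lam 1 (Half.θ C j * y)
  | hsmul r x hx =>
    rw [map_smul, map_smul, smul_mul_assoc, mul_smul_comm]
    exact Submodule.smul_mem _ r (hx y)
  | hadd x x' hx hx' => rw [map_add, map_add, add_mul, mul_add]; exact add_mem (hx y) (hx' y)
  | hmul i x hx =>
    obtain ⟨r, hr⟩ := KE_mul_F D i j
    have e : gen D (.F j) * (tau D (minus D (x * Half.θ C i)) * minus D y) =
        (((tw C i j)⁻¹ : Qvpiˣ) : Qvpi) • (tau D (gen D (.F i)) *
          (gen D (.F j) * (tau D (minus D x) * minus D y))) +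
        ((((vi C i)⁻¹ : Qvpiˣ) : Qvpi) * r) • (gen D (.K (C.d i • D.coroot i)) *
          (gen D (.J (C.d i • D.coroot i)) *
            (gen D (.K (C.d i • D.coroot i)) * (tau D (minus D x) * minus D y)) -
          gen D (.K (-(C.d i • D.coroot i))) * (tau D (minus D x) * minus D y))) := by
      rw [map_mul, tau_mul, minus_θ, mul_assoc, ← mul_assoc (gen D (.F j)), tau_F, mul_smul_comm,
        hr]
      simp only [smul_add, smul_mul_assoc, add_mul, sub_mul, mul_sub, smul_sub, mul_assoc,
        smul_smul, mul_comm]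
    rw [e]
    have hm := tau_minus_mul_minus_mem D lam x y
    exact add_mem (Submodule.smul_mem _ _ (tau_F_mul_mem_stdSpan D lam i (hx y)))
      (Submodule.smul_mem _ _ (K_mul_mem_stdSpan D lam _ (sub_mem
        (J_mul_mem_stdSpan D lam _ (K_mul_mem_stdSpan D lam _ hm)) (K_mul_mem_stdSpan D lam _ hm))))

theorem mem_stdSpan (u : U D) : u ∈ stdSpan D lam := by
  suffices H : ∀ w ∈ stdSpan D lam, u * w ∈ stdSpan D lam by
    have h1 := tau_minus_mul_minus_mem D lam 1 1
    rw [map_one, tau_one, one_mul] at h1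
    simpa using H 1 h1
  induction u using U.induction with
  | halg r => intro w hw; rw [← Algebra.smul_def]; exact Submodule.smul_mem _ r hw
  | hadd x y hx hy => intro w hw; rw [add_mul]; exact add_mem (hx w hw) (hy w hw)
  | hmul x y hx hy => intro w hw; rw [mul_assoc]; exact hx _ (hy w hw)
  | hgen s =>
    intro w hw
    cases s with
    | E i => exact E_mul_mem_stdSpan D lam i hw
    | F i => exact F_mul_mem_stdSpan D lam i hw
    | K μ => exact K_mul_mem_stdSpan D lam μ hw
    | J μ => exact J_mul_mem_stdSpan D lam μ hw

/-- A functional on `𝐔 1_λ` is determined by its values on the `τ₁(x⁻) y⁻ 1_λ`. -/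
theorem functional_ext {f g : U D →ₗ[Qvpi] Qvpi}
    (hideal : ∀ u ∈ wtIdeal D lam, f u = g u)
    (hstd : ∀ x y, f (tau D (minus D x) * minus D y) = g (tau D (minus D x) * minus D y)) :
    f = g := by
  ext u
  obtain ⟨a, ha, b, hb, rfl⟩ := Submodule.mem_sup.1 (mem_stdSpan D lam u)
  rw [map_add, map_add, hideal b hb]
  congr 1
  induction ha using Submodule.span_induction with
  | zero => rw [map_zero, map_zero]
  | add x y _ _ hx hy => rw [map_add, map_add, hx, hy]
  | smul r x _ hx => rw [map_smul, map_smul, hx]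
  | mem x hx =>
    obtain ⟨p, rfl⟩ := hx
    exact hstd p.1 p.2

theorem phi_tau (u : U D) : phi D lam (tau D u) = phi D lam u := by
  suffices H : (phi D lam).comp (tau D) = phi D lam from DFunLike.congr_fun H u
  refine functional_ext D lam (fun u hu => ?_) fun x y => ?_
  · rw [LinearMap.comp_apply, phi_tau_of_mem_wtIdeal D lam hu, phi_of_mem_wtIdeal D lam hu]
  · rw [LinearMap.comp_apply, tau_mul, tau_tau, phi_tau_minus_mul_minus, phi_tau_minus_mul_minus,
      stdForm_symm]

end Covering

/-! ### The pairing on `𝐔̇` -/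

section Covering

variable {I Y X : Type*} [AddCommGroup Y] [AddCommGroup X] {C : CartanDatum I}
  (D : RootDatum C Y X)

/-- The pairing `(x, y) ↦ (x 1_λ, y 1_λ)` on `𝐔`. -/
def blockForm (lam : X) : U D →ₗ[Qvpi] U D →ₗ[Qvpi] Qvpi :=
  LinearMap.mk₂ Qvpi (fun x y => phi D lam (tau D x * y)) (by simp [add_mul]) (by simp)
    (by simp [mul_add]) (by simp)

theorem blockForm_apply (lam : X) (x y : U D) :
    blockForm D lam x y = phi D lam (tau D x * y) := rfl

theorem blockForm_symm (lam : X) (x y : U D) : blockForm D lam x y = blockForm D lam y x := by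
  rw [blockForm_apply, blockForm_apply, ← phi_tau, tau_mul, tau_tau]

theorem blockForm_right_eq_zero (lam : X) (x : U D) {y : U D} (hy : y ∈ wtIdeal D lam) :
    blockForm D lam x y = 0 :=
  phi_of_mem_wtIdeal D lam ((wtIdeal D lam).smul_mem (tau D x) hy)

open scoped Classical in
/-- The pairing of `𝐔 1_λ` with `𝐔̇`, with the first variable lifted to `𝐔`. -/
def halfPairing (lam : X) : U D →ₗ[Qvpi] Udot D →ₗ[Qvpi] Qvpi :=
  (Udot.lift D (fun mu => if lam = mu then (blockForm D lam).flip else 0) (by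
    intro mu y hy
    split_ifs with h
    · subst h
      ext x
      exact blockForm_right_eq_zero D lam x hy
    · rfl)).flip

open scoped Classical in
theorem halfPairing_sym (lam mu : X) (x y : U D) :
    halfPairing D lam x (sym D mu y) = if lam = mu then blockForm D lam x y else 0 := by
  rw [halfPairing, LinearMap.flip_apply, Udot.lift_sym]
  split_ifs <;> rfl

/-- The bilinear pairing on `𝐔̇`. -/
def pairing : Udot D →ₗ[Qvpi] Udot D →ₗ[Qvpi] Qvpi :=
  Udot.lift D (halfPairing D) (by
    classical
    intro lam x hx
    ext m
    induction m using Udot.induction with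
    | h0 => simp
    | hadd a b ha hb => rw [map_add, ha, hb, map_add]
    | hsym mu y =>
      rw [halfPairing_sym, LinearMap.zero_apply]
      split_ifs with h
      · rw [blockForm_symm, blockForm_right_eq_zero D lam y hx]
      · rfl)

open scoped Classical in
theorem pairing_sym_sym (lam mu : X) (x y : U D) :
    pairing D (sym D lam x) (sym D mu y) = if lam = mu then phi D lam (tau D x * y) else 0 := by
  rw [pairing, Udot.lift_sym, halfPairing_sym]
  rfl

theorem pairing_symm (x y : Udot D) : pairing D x y = pairing D y x := by
  classical
  induction x using Udot.induction with
  | h0 => simp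
  | hadd a b ha hb => simp only [map_add, LinearMap.add_apply, ha, hb]
  | hsym lam x =>
    induction y using Udot.induction with
    | h0 => simp
    | hadd a b ha hb => simp only [map_add, LinearMap.add_apply, ha, hb]
    | hsym mu y =>
      rw [pairing_sym_sym, pairing_sym_sym]
      by_cases h : lam = mu
      · subst h
        rw [if_pos rfl, if_pos rfl]
        exact blockForm_symm D lam x y
      · rw [if_neg h, if_neg (Ne.symm h)]

theorem pairing_smul_left (u : U D) (x y : Udot D) :
    pairing D (u • x) y = pairing D x (tau D u • y) := by
  classical
  induction x using Udot.induction with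
  | h0 => simp
  | hadd a b ha hb => simp only [smul_add, map_add, LinearMap.add_apply, ha, hb]
  | hsym lam x =>
    induction y using Udot.induction with
    | h0 => simp
    | hadd a b ha hb => simp only [smul_add, map_add, ha, hb]
    | hsym mu y =>
      rw [← map_smul, ← map_smul, pairing_sym_sym, pairing_sym_sym, smul_eq_mul, smul_eq_mul,
        tau_mul, mul_assoc]

theorem smul_idem_eq_sym (lam : X) (u : U D) : u • idem D lam = sym D lam u := by
  rw [idem, ← map_smul, smul_eq_mul, mul_one]

theorem pairing_minus (lam : X) (x x' : Half C) :
    pairing D (minus D x • idem D lam) (minus D x' • idem D lam) = stdForm C x x' := by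
  classical
  rw [smul_idem_eq_sym, smul_idem_eq_sym, pairing_sym_sym, if_pos rfl, phi_tau_minus_mul_minus]

theorem exists_mul_idem_eq_sym (lam : X) (a : Udot D) : ∃ u, a * idem D lam = sym D lam u := by
  induction a using Udot.induction with
  | h0 => exact ⟨0, by rw [zero_mul, map_zero]⟩
  | hadd a b ha hb =>
    obtain ⟨u, hu⟩ := ha
    obtain ⟨w, hw⟩ := hb
    exact ⟨u + w, by rw [add_mul, hu, hw, map_add]⟩
  | hsym mu x => exact ⟨_, mulHom_sym_sym D mu lam x 1⟩

theorem smul_mul_eq (u : U D) (a b : Udot D) : (u • a) * b = u • (a * b) := by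
  induction a using Udot.induction with
  | h0 => rw [smul_zero, zero_mul, smul_zero]
  | hadd a a' ha ha' => rw [smul_add, add_mul, ha, ha', add_mul, smul_add]
  | hsym lam x =>
    induction b using Udot.induction with
    | h0 => rw [mul_zero, mul_zero, smul_zero]
    | hadd b b' hb hb' => rw [mul_add, hb, hb', mul_add, smul_add]
    | hsym mu y =>
      have h := mulHom_sym_sym D lam mu
      change ∀ x y, sym D lam x * sym D mu y = _ at h
      rw [← map_smul, h, h, ← map_smul, smul_eq_mul, smul_eq_mul, mul_assoc]

theorem K_smul_idem_mul (ν : Y) (lam : X) (a : Udot D) : gen D (.K ν) • (idem D lam * a) =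
    ((vU ^ D.pairing ν lam : Qvpiˣ) : Qvpi) • (idem D lam * a) := by
  rw [← smul_mul_eq, K_smul_idem, smul_mul_assoc]

theorem isUnit_vU_zpow_sub {m n : ℤ} (h : m ≠ n) :
    IsUnit (((vU ^ m : Qvpiˣ) : Qvpi) - ((vU ^ n : Qvpiˣ) : Qvpi)) := by
  have h1 := isUnit_qden 0 (sub_ne_zero.2 h)
  have e : ((piU ^ (0 : ℤ) * vU ^ (m - n) : Qvpiˣ) : Qvpi) - ((vU ^ (-(m - n)) : Qvpiˣ) : Qvpi) =
      (((vU ^ m : Qvpiˣ) : Qvpi) - ((vU ^ n : Qvpiˣ) : Qvpi)) *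
        (((vU ^ (-n) : Qvpiˣ) : Qvpi) + ((vU ^ (-m) : Qvpiˣ) : Qvpi)) := by
    have hm : ((vU ^ m : Qvpiˣ) : Qvpi) * ((vU ^ (-m) : Qvpiˣ) : Qvpi) = 1 := by
      rw [← Units.val_mul, ← zpow_add, add_neg_cancel, zpow_zero, Units.val_one]
    have hn : ((vU ^ n : Qvpiˣ) : Qvpi) * ((vU ^ (-n) : Qvpiˣ) : Qvpi) = 1 := by
      rw [← Units.val_mul, ← zpow_add, add_neg_cancel, zpow_zero, Units.val_one]
    rw [zpow_zero, one_mul, sub_eq_add_neg m n, neg_add, neg_neg, zpow_add, zpow_add,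
      Units.val_mul, Units.val_mul]
    linear_combination hn - hm
  rw [e] at h1
  exact isUnit_of_mul_isUnit_left h1

/-- Vectors of different left weights are orthogonal, because `τ₁` fixes the `K_ν`. -/
theorem pairing_idem_mul_idem_mul {lam mu : X} (h : lam ≠ mu) (a b : Udot D) :
    pairing D (idem D lam * a) (idem D mu * b) = 0 := by
  obtain ⟨ν, hν⟩ : ∃ ν, D.pairing ν lam ≠ D.pairing ν mu := by
    by_contra! H
    exact h (D.perfect.bijective_right.1 (LinearMap.ext H))
  have h1 := pairing_smul_left D (gen D (.K ν)) (idem D lam * a) (idem D mu * b)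
  rw [tau_K, K_smul_idem_mul, K_smul_idem_mul, map_smul, map_smul, LinearMap.smul_apply,
    ← sub_eq_zero, ← sub_smul] at h1
  exact (isUnit_vU_zpow_sub hν).smul_eq_zero.1 h1

theorem pairing_orthogonal (lam₁ lam₂ lam₁' lam₂' : X) (x x' : Udot D)
    (h : ¬ (lam₁ = lam₁' ∧ lam₂ = lam₂')) :
    pairing D (idem D lam₁ * x * idem D lam₂) (idem D lam₁' * x' * idem D lam₂') = 0 := by
  classical
  by_cases h2 : lam₂ = lam₂'
  · rw [mul_assoc, mul_assoc]
    exact pairing_idem_mul_idem_mul D (fun h1 => h ⟨h1, h2⟩) _ _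
  · obtain ⟨u, hu⟩ := exists_mul_idem_eq_sym D lam₂ (idem D lam₁ * x)
    obtain ⟨w, hw⟩ := exists_mul_idem_eq_sym D lam₂' (idem D lam₁' * x')
    rw [hu, hw, pairing_sym_sym, if_neg h2]

theorem mem_span_hasWeight (u : U D) :
    u ∈ Submodule.span Qvpi {w : U D | ∃ ζ, HasWeight D ζ w} := by
  induction u using U.induction with
  | hgen s => exact Submodule.subset_span ⟨_, HasWeight.gen s⟩
  | halg r => exact Submodule.subset_span ⟨_, HasWeight.algebraMap r⟩
  | hadd x y hx hy => exact add_mem hx hy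
  | hmul x y hx hy =>
    refine Submodule.span_mono ?_ ((Submodule.span_mul_span Qvpi _ _).le
      (Submodule.mul_mem_mul hx hy))
    rintro _ ⟨a, ⟨ζ, ha⟩, b, ⟨η, hb⟩, rfl⟩
    exact ⟨_, ha.mul hb⟩

/-- A pairing with the orthogonality property vanishes between different summands `𝐔 1_λ`. -/
theorem orthogonal_idem_sym {P : Udot D →ₗ[Qvpi] Udot D →ₗ[Qvpi] Qvpi}
    (hP : ∀ (lam₁ lam₂ lam₁' lam₂' : X) (x x' : Udot D), ¬ (lam₁ = lam₁' ∧ lam₂ = lam₂') →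
      P (idem D lam₁ * x * idem D lam₂) (idem D lam₁' * x' * idem D lam₂') = 0)
    {lam mu : X} (h : lam ≠ mu) (u : U D) : P (idem D lam) (sym D mu u) = 0 := by
  have h1 : ∀ lam : X, HasWeight D (lam - lam) (1 : U D) := fun lam => by
    rw [sub_self, ← map_one (algebraMap Qvpi (U D))]
    exact HasWeight.algebraMap 1
  induction mem_span_hasWeight D u using Submodule.span_induction with
  | zero => rw [map_zero, map_zero]
  | add x y _ _ hx hy => rw [map_add, map_add, hx, hy, add_zero]
  | smul r x _ hx =>
    rw [← algebraMap_smul (U D) r, map_smul, algebraMap_smul, map_smul, hx, smul_zero]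
  | mem u hu =>
    obtain ⟨ζ, hu⟩ := hu
    have h2 := hP lam lam (ζ + mu) mu (idem D lam) (sym D mu u) fun hc => h hc.2
    have e1 : idem D lam * idem D lam = idem D lam :=
      (sym_mul_sym D 1 1 (h1 lam)).trans (by rw [mul_one]; rfl)
    have e2 : idem D (ζ + mu) * sym D mu u = sym D mu u :=
      (sym_mul_sym D 1 u (by rwa [add_sub_cancel_right])).trans (by rw [one_mul])
    have e3 : sym D mu u * idem D mu = sym D mu u :=
      (sym_mul_sym D u 1 (h1 mu)).trans (by rw [mul_one])
    rwa [e1, e1, e2, e3] at h2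

theorem pairing_unique {P P' : Udot D →ₗ[Qvpi] Udot D →ₗ[Qvpi] Qvpi}
    {B : Half C →ₗ[Qvpi] Half C →ₗ[Qvpi] Qvpi}
    (hP : ∀ (lam₁ lam₂ lam₁' lam₂' : X) (x x' : Udot D), ¬ (lam₁ = lam₁' ∧ lam₂ = lam₂') →
      P (idem D lam₁ * x * idem D lam₂) (idem D lam₁' * x' * idem D lam₂') = 0)
    (hP' : ∀ (lam₁ lam₂ lam₁' lam₂' : X) (x x' : Udot D), ¬ (lam₁ = lam₁' ∧ lam₂ = lam₂') →
      P' (idem D lam₁ * x * idem D lam₂) (idem D lam₁' * x' * idem D lam₂') = 0)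
    (hτ : ∀ (u : U D) (x y : Udot D), P (u • x) y = P x (tau D u • y))
    (hτ' : ∀ (u : U D) (x y : Udot D), P' (u • x) y = P' x (tau D u • y))
    (hB : ∀ (lam : X) (x x' : Half C),
      P (minus D x • idem D lam) (minus D x' • idem D lam) = B x x')
    (hB' : ∀ (lam : X) (x x' : Half C),
      P' (minus D x • idem D lam) (minus D x' • idem D lam) = B x x') : P = P' := by
  have key : ∀ (lam : X) (u : U D),
      P (idem D lam) (sym D lam u) = P' (idem D lam) (sym D lam u) := by
    intro lam u
    suffices H : (P (idem D lam)).comp ((sym D lam).restrictScalars Qvpi) =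
        (P' (idem D lam)).comp ((sym D lam).restrictScalars Qvpi) from DFunLike.congr_fun H u
    refine functional_ext D lam (fun u hu => ?_) fun x y => ?_
    · simp only [LinearMap.comp_apply, LinearMap.restrictScalars_apply, sym_eq_zero D hu, map_zero]
    · simp only [LinearMap.comp_apply, LinearMap.restrictScalars_apply]
      rw [← smul_eq_mul, map_smul, ← hτ, ← hτ', ← smul_idem_eq_sym, hB, hB']
  ext a b
  induction a using Udot.induction with
  | h0 => simp
  | hadd a a' ha ha' => simp only [map_add, LinearMap.add_apply, ha, ha']
  | hsym lam x =>
    induction b using Udot.induction with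
    | h0 => simp
    | hadd b b' hb hb' => simp only [map_add, hb, hb']
    | hsym mu y =>
      rw [← smul_idem_eq_sym, hτ, hτ', ← map_smul]
      by_cases h : lam = mu
      · subst h
        exact key lam _
      · rw [orthogonal_idem_sym D hP h, orthogonal_idem_sym D hP' h]

end Covering

end

end QCov

theorem mainTheorem7 {I Y X : Type*} [Finite I]
    [AddCommGroup Y] [Module.Free ℤ Y] [Module.Finite ℤ Y]
    [AddCommGroup X] [Module.Free ℤ X] [Module.Finite ℤ X]
    (C : QCov.CartanDatum I) (D : QCov.RootDatum C Y X)
    (hreg : LinearIndependent ℤ D.coroot) :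
    ∃ B : QCov.Half C →ₗ[QCov.Qvpi] QCov.Half C →ₗ[QCov.Qvpi] QCov.Qvpi,
      QCov.IsStandardForm C B ∧ (∀ B', QCov.IsStandardForm C B' → B' = B) ∧
      ∃! P : QCov.Udot D →ₗ[QCov.Qvpi] QCov.Udot D →ₗ[QCov.Qvpi] QCov.Qvpi,
        (∀ (lam₁ lam₂ lam₁' lam₂' : X) (x x' : QCov.Udot D),
          ¬ (lam₁ = lam₁' ∧ lam₂ = lam₂') →
            P (QCov.idem D lam₁ * x * QCov.idem D lam₂)
              (QCov.idem D lam₁' * x' * QCov.idem D lam₂') = 0) ∧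
        (∀ (u : QCov.U D) (x y : QCov.Udot D), P (u • x) y = P x (QCov.tau D u • y)) ∧
        (∀ (lam : X) (x x' : QCov.Half C),
          P (QCov.minus D x • QCov.idem D lam) (QCov.minus D x' • QCov.idem D lam) = B x x') ∧
        (∀ x y : QCov.Udot D, P x y = P y x) := by
  refine ⟨QCov.stdForm C, QCov.isStandardForm_stdForm C,
    fun B' hB' => (QCov.isStandardForm_stdForm C).unique hB', QCov.pairing D,
    ⟨QCov.pairing_orthogonal D, QCov.pairing_smul_left D, QCov.pairing_minus D,
      QCov.pairing_symm D⟩, fun P' ⟨h1, h2, h3, _⟩ => ?_⟩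
  exact QCov.pairing_unique D h1 (QCov.pairing_orthogonal D) h2 (QCov.pairing_smul_left D) h3
    (QCov.pairing_minus D)
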